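/- Let $k_1,\dots,k_5>0$, $\gamma\in\mathbb{R}\setminus\{0\}$, $(\tau_1,\tau_2,\tau_3)\in\{(1,0,0),(0,1,0),(0,0,1)\}$, $\chi:=k_3-k_2$ and $\epsilon_0\in\{0,1\}$. Consider, for $x\in\mathbb{R}$ and $t>0$, the laminated Timoshenko beam with heat conduction of type III and lower-order coupling $$\begin{cases} \varphi_{tt}-k_1(\varphi_x+\psi+w)_x+\tau_1\gamma q_t=0,\\ \psi_{tt}-k_2\psi_{xx}+k_1(\varphi_x+\psi+w)+\tau_2\gamma q_t=0,\\ w_{tt}-k_3w_{xx}+k_1(\varphi_x+\psi+w)+\tau_3\gamma q_t=0,\\ q_{tt}-k_4q_{xx}+D-\gamma(\tau_1\varphi_t+\tau_2\psi_t+\tau_3w_t)=0, \end{cases}\qquad D=\begin{cases}-k_5q_{xxt}&(\epsilon_0=1),\\ \;\;\,k_5q_t&(\epsilon_0=0).\end{cases}$$ In the variables $U=(v,u,z,y,\phi,\theta,\sigma,\eta)^T$ with $v=\varphi_x+\psi+w$, $u=\varphi_t$, $z=\psi_x$, $y=\psi_t$, $\phi=w_x$, $\theta=w_t$, $\sigma=q_x$,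 $\eta=q_t$, it becomes the first-order Cauchy problem $$(\ast)\quad\begin{cases} v_t-u_x-y-\theta=0,\\ u_t-k_1v_x+\tau_1\gamma\eta=0,\\ z_t-y_x=0,\\ y_t-k_2z_x+k_1v+\tau_2\gamma\eta=0,\\ \phi_t-\theta_x=0,\\ \theta_t-k_3\phi_x+k_1v+\tau_3\gamma\eta=0,\\ \sigma_t-\eta_x=0,\\ \eta_t-k_4\sigma_x-\epsilon_0k_5\eta_{xx}+(1-\epsilon_0)k_5\eta-\gamma(\tau_1u+\tau_2y+\tau_3\theta)=0, \end{cases}\qquad U(\cdot,0)=U_0 .$$ A solution of $(\ast)$ is a function $U\in C([0,\infty);L^2(\mathbb{R};\mathbb{C}^8))$ with $U(\cdot,0)=U_0$ which satisfies the equations for $t>0$ in the sense of tempered distributions in $x$. **Theorem.** Let $N,\ell\in\mathbb{N}^*$ with $\ell\le N$ and let $j\in\{0,\dots,N-\ell\}$. In each of the cases below there is a constant $c_0>0$, not depending on $U_0$, $U$ and $t$, such that for every $U_0\in H^N(\mathbb{R})\cap L^1(\mathbb{R})$, every solution $U$ of $(\ast)$ and every $t\ge0$ one has $\partial_x^jU(\cdot,t)\in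 L^2(\mathbb{R})$ and $$\|\partial_x^jU(\cdot,t)\|_{L^2(\mathbb{R})}\le c_0(1+t)^{-a}\|U_0\|_{L^1(\mathbb{R})}+c_0(1+t)^{-b}\|\partial_x^{j+\ell}U_0\|_{L^2(\mathbb{R})},$$ where the exponents are as follows. 1. Case $(\tau_1,\tau_2,\tau_3)=(1,0,0)$ and $\chi\neq0$: $b=\frac{\ell}{4}$, and $a=\frac1{12}+\frac j6$ for $\epsilon_0=1$, $a=\frac18+\frac j4$ for $\epsilon_0=0$. 2. Case $(\tau_1,\tau_2,\tau_3)\in\{(0,1,0),(0,0,1)\}$ and $k_1=k_2=k_3$: $b=\frac{\ell}{2}$, and $a=\frac18+\frac j4$ for $\epsilon_0=1$, $a=\frac14+\frac j2$ for $\epsilon_0=0$. 3. Case $(\tau_1,\tau_2,\tau_3)\in\{(0,1,0),(0,0,1)\}$ and not $k_1=k_2=k_3$: $b=\frac{\ell}{6}$, and $a=\frac18+\frac j4$ for $\epsilon_0=1$, $a=\frac14+\frac j2$ for $\epsilon_0=0$. -/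

import Mathlib

open MeasureTheory TemperedDistribution Set
open scoped SchwartzMap LineDeriv ENNReal

noncomputable section

/-- Coefficients of the laminated Timoshenko beam coupled with heat conduction of type III. -/
structure BeamCoeffs where
  (k₁ k₂ k₃ k₄ k₅ : ℝ)
  γ : ℝ
  (τ₁ τ₂ τ₃ : ℝ)

namespace BeamCoeffs

/-- The stability number. -/
def χ (p : BeamCoeffs) : ℝ := p.k₃ - p.k₂

end BeamCoeffs

/-- Values of the unknown `U = (v, u, z, y, φ, θ, σ, η)`, in this order, where
`v = φ_x + ψ + w`, `u = φ_t`, `z = ψ_x`, `y = ψ_t`, `φ = w_x`, `θ = w_t`, `σ = q_x`, `η = q_t`. -/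
abbrev BeamState : Type := EuclideanSpace ℂ (Fin 8)

namespace BeamCoeffs

/-- Coefficient of `U_xx`. -/
def A₂ (p : BeamCoeffs) (ε₀ : ℝ) (X : BeamState) : BeamState :=
  !₂[0, 0, 0, 0, 0, 0, 0, -((ε₀ * p.k₅ : ℝ) : ℂ) * X 7]

/-- Coefficient of `U_x`. -/
def A₁ (p : BeamCoeffs) (X : BeamState) : BeamState :=
  !₂[-X 1,
     -(p.k₁ : ℂ) * X 0,
     -X 3,
     -(p.k₂ : ℂ) * X 2,
     -X 5,
     -(p.k₃ : ℂ) * X 4,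
     -X 7,
     -(p.k₄ : ℂ) * X 6]

/-- Coefficient of `U`; it contains the coupling of order zero. -/
def A₀ (p : BeamCoeffs) (ε₀ : ℝ) (X : BeamState) : BeamState :=
  !₂[-X 3 - X 5,
     (p.τ₁ * p.γ : ℂ) * X 7,
     0,
     p.k₁ * X 0 + (p.τ₂ * p.γ : ℂ) * X 7,
     0,
     p.k₁ * X 0 + (p.τ₃ * p.γ : ℂ) * X 7,
     0,
     (((1 - ε₀) * p.k₅ : ℝ) : ℂ) * X 7
       - p.γ * (p.τ₁ * X 1 + p.τ₂ * X 3 + p.τ₃ * X 5)]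

end BeamCoeffs

/-- The derivative `∂_x` of a tempered distribution on the real line. -/
def distDeriv (T : 𝓢'(ℝ, BeamState)) : 𝓢'(ℝ, BeamState) := ∂_{(1 : ℝ)} T

/-- The `L²` norm of a tempered distribution; it is `∞` if the distribution is not (given by)
a square integrable function. -/
def distL2Norm (T : 𝓢'(ℝ, BeamState)) : ℝ≥0∞ :=
  ⨅ (g : Lp BeamState 2 (volume : Measure ℝ)) (_ : T = (g : 𝓢'(ℝ, BeamState))), ‖g‖ₑ

theorem distL2Norm_coe (g : Lp BeamState 2 (volume : Measure ℝ)) :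
    distL2Norm (g : 𝓢'(ℝ, BeamState)) = ‖g‖ₑ := by
  have hinj : Function.Injective
      (Lp.toTemperedDistributionCLM BeamState (volume : Measure ℝ) 2) :=
    LinearMap.ker_eq_bot.mp Lp.ker_toTemperedDistributionCLM_eq_bot
  unfold distL2Norm
  apply le_antisymm
  · exact iInf_le_of_le g (iInf_le_of_le rfl le_rfl)
  · refine le_iInf fun g' => le_iInf fun h => ?_
    have e : g = g' := hinj h
    exact le_of_eq (by rw [e])

/-- `U ∈ C([0, ∞); L²)` solves `U_t + A₂ U_xx + A₁ U_x + A₀ U = 0`, `U(·, 0) = U₀`, where the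
equation is satisfied in the sense of tempered distributions in `x` for every `t > 0`.
Here `ε₀ = 1` is the thermal dissipation `-k₅ q_xxt`, and `ε₀ = 0` is `k₅ q_t`. -/
structure IsBeamSolution (p : BeamCoeffs) (ε₀ : ℝ)
    (U₀ : Lp BeamState 2 (volume : Measure ℝ))
    (U : ℝ → Lp BeamState 2 (volume : Measure ℝ)) : Prop where
  continuousOn : ContinuousOn U (Ici 0)
  initial : U 0 = U₀
  equation : ∀ t : ℝ, 0 < t → ∀ g : 𝓢(ℝ, ℂ),
    HasDerivAt (fun s : ℝ => (U s : 𝓢'(ℝ, BeamState)) g)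
      (-(p.A₂ ε₀ (distDeriv (distDeriv (U t : 𝓢'(ℝ, BeamState))) g)
        + p.A₁ (distDeriv (U t : 𝓢'(ℝ, BeamState)) g)
        + p.A₀ ε₀ ((U t : 𝓢'(ℝ, BeamState)) g))) t

/-- There is a constant `c₀ > 0` such that, for all initial data `U₀ ∈ H^N ∩ L¹`, all solutions `U`
and all `t ≥ 0`,
`‖∂_x^j U(t)‖_{L²} ≤ c₀ (1 + t)^(-a) ‖U₀‖_{L¹} + c₀ (1 + t)^(-b) ‖∂_x^(j+ℓ) U₀‖_{L²}`;
in particular `∂_x^j U(t)` is square integrable if the right-hand side is finite. -/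
def BeamDecay (p : BeamCoeffs) (ε₀ : ℝ) (N ℓ j : ℕ) (a b : ℝ) : Prop :=
  ∃ c₀ : ℝ, 0 < c₀ ∧
    ∀ (U₀ : Lp BeamState 2 (volume : Measure ℝ)) (U : ℝ → Lp BeamState 2 (volume : Measure ℝ)),
      MemSobolev (N : ℝ) 2 (U₀ : 𝓢'(ℝ, BeamState)) →
      MemLp (fun x : ℝ => U₀ x) 1 volume →
      IsBeamSolution p ε₀ U₀ U →
      ∀ t : ℝ, 0 ≤ t →
        distL2Norm (distDeriv^[j] (U t : 𝓢'(ℝ, BeamState))) ≤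
          ENNReal.ofReal (c₀ * (1 + t) ^ (-a)) * eLpNorm (fun x : ℝ => U₀ x) 1 volume
          + ENNReal.ofReal (c₀ * (1 + t) ^ (-b))
            * distL2Norm (distDeriv^[j + ℓ] (U₀ : 𝓢'(ℝ, BeamState)))

end

/-! After a Fourier transform in space the system is, at each frequency x, a linear ODE in ℂ⁸. Its
energy E decays only through the last component: E' = -2d|Y 7|², where the damping d is of order x²
(ε₀ = 1) or 1 (ε₀ = 0). Everything rests on how the exponential decay rate of this ODE depends on x:
it is at least a multiple of |x|^μ for |x| ≤ 1 and of |x|^(-ν) for |x| ≥ 1 (`SymbolDecay`).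

No Lyapunov functional is built. The components on a time interval (a, a + T] are regarded as
vectors of L² in time. Differentiation is skew-adjoint there up to boundary terms, which are at most
B, a multiple of E(a). Pairing rows of the system with components therefore gives inequalities
between norms, and these hold in any inner product space (`BeamGram`). If they imply f(x) Σ‖X i‖² ≤
B, then ∫ E is at most a multiple of E(a) / f(x), uniformly in a and T, and
`le_exp_mul_of_integral_le` turns this into decay at a rate proportional to f(x).

To find f, normalise Σ‖X i‖² = 1 and suppose that B is much smaller than f(x). The dissipation makes
‖X 7‖ small, and the coupling passes smallness on from component to component. After rescaling by
powers of |x| the inequalities become quadratic systems with constants independent of x, in which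
the large terms can be absorbed. In the end all eight norms are small, contradicting the
normalisation.

For coupling to a rotation angle, X 7 controls X 3, then X 0, then X 5, then the rest. The cross
terms in this chain carry the factors k₂ - k₁ and k₁ - k₃. If they vanish, f = |x|^(-2) at high
frequencies; otherwise f = |x|^(-6). At low frequencies f = d x². For coupling to the displacement,
X 7 controls X 1 and then X 0, which sees only the sum X 3 + X 5; the two summands are separated by
a bound for ⟪X 3, X 5⟫ that needs χ ≠ 0. Here f = d x⁴ and f = |x|^(-4).

A distributional solution is given at almost every frequency by the matrix exponential
(`IsBeamSolution.fourier_ae_eq`). At low frequencies the transform of U₀ is bounded by its L¹ norm,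
and the L² norm of |x|^j exp(-c|x|^μ t) yields the exponent (2j + 1)/(2μ). At high frequencies
exp(-c|x|^(-ν) t) is traded for (1 + t)^(-ℓ/ν) |x|^ℓ, that is, for ℓ derivatives of U₀. Plancherel's
theorem concludes. -/

section GramIdentities

set_option linter.unusedSimpArgs false

open Complex
open scoped InnerProductSpace

/-- Elements `X 0, …, X 7` of a complex inner product space, thought of as the components of a
solution of the Fourier transformed beam system at frequency `x` on a time interval, with the
inner product of `L²` in time. `X'` are the time derivatives, `B` bounds the boundary terms. -/
structure BeamGram {H : Type*} [NormedAddCommGroup H] [InnerProductSpace ℂ H]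
    (p : BeamCoeffs) (d x B : ℝ) (X X' : Fin 8 → H) : Prop where
  bal : ∀ a b, ‖⟪X' a, X b⟫_ℂ + ⟪X a, X' b⟫_ℂ‖ ≤ B
  diss : d * ‖X 7‖ ^ 2 ≤ B
  row0 : X' 0 = (I * x) • X 1 + X 3 + X 5
  row1 : X' 1 = (I * (p.k₁ * x)) • X 0 - ((p.τ₁ * p.γ : ℝ) : ℂ) • X 7
  row2 : X' 2 = (I * x) • X 3
  row3 : X' 3 = (I * (p.k₂ * x)) • X 2 - (p.k₁ : ℂ) • X 0 - ((p.τ₂ * p.γ : ℝ) : ℂ) • X 7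
  row4 : X' 4 = (I * x) • X 5
  row5 : X' 5 = (I * (p.k₃ * x)) • X 4 - (p.k₁ : ℂ) • X 0 - ((p.τ₃ * p.γ : ℝ) : ℂ) • X 7
  row6 : X' 6 = (I * x) • X 7
  row7 : X' 7 = (I * (p.k₄ * x)) • X 6 - (d : ℂ) • X 7
    + (p.γ : ℂ) • ((p.τ₁ : ℂ) • X 1 + (p.τ₂ : ℂ) • X 3 + (p.τ₃ : ℂ) • X 5)

/-! ### Multiplier identities in an inner product space. -/

namespace BeamGram

variable {H : Type*} [NormedAddCommGroup H] [InnerProductSpace ℂ H]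
  {p : BeamCoeffs} {d x B : ℝ} {X X' : Fin 8 → H}

theorem norm_mul_inner_le {c : ℂ} {C : ℝ} (hc : ‖c‖ ≤ C) (a b : H) :
    ‖c * ⟪a, b⟫_ℂ‖ ≤ C * (‖a‖ * ‖b‖) := by
  rw [norm_mul]
  exact mul_le_mul hc (norm_inner_le_norm a b) (norm_nonneg _) ((norm_nonneg _).trans hc)

theorem norm_mul_le_of_le {c w : ℂ} {C b : ℝ} (hc : ‖c‖ ≤ C) (hw : ‖w‖ ≤ b) :
    ‖c * w‖ ≤ C * b := by
  rw [norm_mul]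
  exact mul_le_mul hc hw (norm_nonneg _) ((norm_nonneg _).trans hc)

theorem inner_self_eq (a : H) : ⟪a, a⟫_ℂ = (‖a‖ : ℂ) ^ 2 :=
  inner_self_eq_norm_sq_to_K a

/-- Equipartition: pairing a velocity with its strain bounds the strain by the velocity, because the
two rows exchange them with the factor i x. `sq_four_le` and `sq_six_le` do the same for the other
two pairs; `sq_one_le` goes from strain to velocity. -/
theorem sq_two_le (hX : BeamGram p d x B X X')  :
    |p.k₂| * |x| * ‖X 2‖ ^ 2 ≤ B + |p.k₁| * (‖X 0‖ * ‖X 2‖) + |p.τ₂| * |p.γ| * (‖X 7‖ * ‖X 2‖)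
      + |x| * (‖X 3‖ * ‖X 3‖) := by
  have e : -(I * (p.k₂ * x)) * (‖X 2‖ : ℂ) ^ 2
      = (1 : ℂ) * (⟪X' 3, X 2⟫_ℂ + ⟪X 3, X' 2⟫_ℂ)
        + (p.k₁ : ℂ) * ⟪X 0, X 2⟫_ℂ
        + ((p.τ₂ * p.γ : ℝ) : ℂ) * ⟪X 7, X 2⟫_ℂ
        + (-(I * x)) * ⟪X 3, X 3⟫_ℂ := by
    rw [hX.row3, hX.row2]
    simp only [inner_add_left, inner_sub_left, inner_add_right, inner_sub_right, inner_smul_left,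
      inner_smul_right, map_mul, conj_I, conj_ofReal, inner_self_eq, ofReal_mul]
    ring
  have hR := norm_add_le_of_le (norm_add_le_of_le (norm_add_le_of_le ((norm_mul_le_of_le (c := (1 : ℂ)) le_rfl (hX.bal 3 2)))
      (norm_mul_inner_le (c := (p.k₁ : ℂ)) le_rfl (X 0) (X 2)))
      (norm_mul_inner_le (c := ((p.τ₂ * p.γ : ℝ) : ℂ)) le_rfl (X 7) (X 2)))
      (norm_mul_inner_le (c := (-(I * x))) le_rfl (X 3) (X 3))
  rw [← e] at hR
  simp only [norm_mul, norm_neg, norm_I, one_mul, norm_one, RCLike.norm_ofNat, norm_real, norm_pow, Real.norm_eq_abs,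
    abs_norm, abs_mul] at hR ⊢
  linarith [hR]

theorem sq_four_le (hX : BeamGram p d x B X X')  :
    |p.k₃| * |x| * ‖X 4‖ ^ 2 ≤ B + |p.k₁| * (‖X 0‖ * ‖X 4‖) + |p.τ₃| * |p.γ| * (‖X 7‖ * ‖X 4‖)
      + |x| * (‖X 5‖ * ‖X 5‖) := by
  have e : -(I * (p.k₃ * x)) * (‖X 4‖ : ℂ) ^ 2
      = (1 : ℂ) * (⟪X' 5, X 4⟫_ℂ + ⟪X 5, X' 4⟫_ℂ)
        + (p.k₁ : ℂ) * ⟪X 0, X 4⟫_ℂ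
        + ((p.τ₃ * p.γ : ℝ) : ℂ) * ⟪X 7, X 4⟫_ℂ
        + (-(I * x)) * ⟪X 5, X 5⟫_ℂ := by
    rw [hX.row5, hX.row4]
    simp only [inner_add_left, inner_sub_left, inner_add_right, inner_sub_right, inner_smul_left,
      inner_smul_right, map_mul, conj_I, conj_ofReal, inner_self_eq, ofReal_mul]
    ring
  have hR := norm_add_le_of_le (norm_add_le_of_le (norm_add_le_of_le ((norm_mul_le_of_le (c := (1 : ℂ)) le_rfl (hX.bal 5 4)))
      (norm_mul_inner_le (c := (p.k₁ : ℂ)) le_rfl (X 0) (X 4)))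
      (norm_mul_inner_le (c := ((p.τ₃ * p.γ : ℝ) : ℂ)) le_rfl (X 7) (X 4)))
      (norm_mul_inner_le (c := (-(I * x))) le_rfl (X 5) (X 5))
  rw [← e] at hR
  simp only [norm_mul, norm_neg, norm_I, one_mul, norm_one, RCLike.norm_ofNat, norm_real, norm_pow, Real.norm_eq_abs,
    abs_norm, abs_mul] at hR ⊢
  linarith [hR]

theorem sq_six_le (hX : BeamGram p d x B X X')  :
    |p.k₄| * |x| * ‖X 6‖ ^ 2 ≤ B + |d| * (‖X 7‖ * ‖X 6‖) + |p.τ₁| * |p.γ| * (‖X 1‖ * ‖X 6‖)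
      + |p.τ₂| * |p.γ| * (‖X 3‖ * ‖X 6‖) + |p.τ₃| * |p.γ| * (‖X 5‖ * ‖X 6‖) + |x| * (‖X 7‖ * ‖X 7‖) := by
  have e : -(I * (p.k₄ * x)) * (‖X 6‖ : ℂ) ^ 2
      = (1 : ℂ) * (⟪X' 7, X 6⟫_ℂ + ⟪X 7, X' 6⟫_ℂ)
        + (d : ℂ) * ⟪X 7, X 6⟫_ℂ
        + (-((p.τ₁ * p.γ : ℝ) : ℂ)) * ⟪X 1, X 6⟫_ℂ
        + (-((p.τ₂ * p.γ : ℝ) : ℂ)) * ⟪X 3, X 6⟫_ℂ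
        + (-((p.τ₃ * p.γ : ℝ) : ℂ)) * ⟪X 5, X 6⟫_ℂ
        + (-(I * x)) * ⟪X 7, X 7⟫_ℂ := by
    rw [hX.row7, hX.row6]
    simp only [inner_add_left, inner_sub_left, inner_add_right, inner_sub_right, inner_smul_left,
      inner_smul_right, map_mul, conj_I, conj_ofReal, inner_self_eq, ofReal_mul]
    ring
  have hR := norm_add_le_of_le (norm_add_le_of_le (norm_add_le_of_le (norm_add_le_of_le (norm_add_le_of_le ((norm_mul_le_of_le (c := (1 : ℂ)) le_rfl (hX.bal 7 6)))
      (norm_mul_inner_le (c := (d : ℂ)) le_rfl (X 7) (X 6)))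
      (norm_mul_inner_le (c := (-((p.τ₁ * p.γ : ℝ) : ℂ))) le_rfl (X 1) (X 6)))
      (norm_mul_inner_le (c := (-((p.τ₂ * p.γ : ℝ) : ℂ))) le_rfl (X 3) (X 6)))
      (norm_mul_inner_le (c := (-((p.τ₃ * p.γ : ℝ) : ℂ))) le_rfl (X 5) (X 6)))
      (norm_mul_inner_le (c := (-(I * x))) le_rfl (X 7) (X 7))
  rw [← e] at hR
  simp only [norm_mul, norm_neg, norm_I, one_mul, norm_one, RCLike.norm_ofNat, norm_real, norm_pow, Real.norm_eq_abs,
    abs_norm, abs_mul] at hR ⊢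
  linarith [hR]

theorem sq_one_le (hX : BeamGram p d x B X X')  :
    |x| * ‖X 1‖ ^ 2 ≤ B + |p.k₁| * |x| * (‖X 0‖ * ‖X 0‖) + |p.τ₁| * |p.γ| * (‖X 7‖ * ‖X 0‖)
      + (‖X 1‖ * ‖X 3‖) + (‖X 1‖ * ‖X 5‖) := by
  have e : (I * x) * (‖X 1‖ : ℂ) ^ 2
      = (1 : ℂ) * (⟪X' 1, X 0⟫_ℂ + ⟪X 1, X' 0⟫_ℂ)
        + (I * (p.k₁ * x)) * ⟪X 0, X 0⟫_ℂ
        + ((p.τ₁ * p.γ : ℝ) : ℂ) * ⟪X 7, X 0⟫_ℂ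
        + (-1 : ℂ) * ⟪X 1, X 3⟫_ℂ
        + (-1 : ℂ) * ⟪X 1, X 5⟫_ℂ := by
    rw [hX.row0, hX.row1]
    simp only [inner_add_left, inner_sub_left, inner_add_right, inner_sub_right, inner_smul_left,
      inner_smul_right, map_mul, conj_I, conj_ofReal, inner_self_eq, ofReal_mul]
    ring
  have hR := norm_add_le_of_le (norm_add_le_of_le (norm_add_le_of_le (norm_add_le_of_le ((norm_mul_le_of_le (c := (1 : ℂ)) le_rfl (hX.bal 1 0)))
      (norm_mul_inner_le (c := (I * (p.k₁ * x))) le_rfl (X 0) (X 0)))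
      (norm_mul_inner_le (c := ((p.τ₁ * p.γ : ℝ) : ℂ)) le_rfl (X 7) (X 0)))
      (norm_mul_inner_le (c := (-1 : ℂ)) le_rfl (X 1) (X 3)))
      (norm_mul_inner_le (c := (-1 : ℂ)) le_rfl (X 1) (X 5))
  rw [← e] at hR
  simp only [norm_mul, norm_neg, norm_I, one_mul, norm_one, RCLike.norm_ofNat, norm_real, norm_pow, Real.norm_eq_abs,
    abs_norm, abs_mul] at hR ⊢
  linarith [hR]

/-- First link of the angle chain. `X 3` enters row 7 with the factor γ, so the pair (7, 3) produces
γ‖X 3‖². Its term in x⟪X 6, X 3⟫ is removed by the pair (6, 2), since i x X 3 is the derivative of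
`X 2`. -/
theorem sq_three_le (hX : BeamGram p d x B X X') (hτ₁ : p.τ₁ = 0) (hτ₂ : p.τ₂ = 1) (hτ₃ : p.τ₃ = 0) :
    |p.γ| * ‖X 3‖ ^ 2 ≤ B + |p.k₄| * B + |d| * (‖X 7‖ * ‖X 3‖) + |p.γ| * (‖X 7‖ * ‖X 7‖)
      + |p.k₄ - p.k₂| * |x| * (‖X 7‖ * ‖X 2‖) + |p.k₁| * (‖X 7‖ * ‖X 0‖) := by
  have e : (p.γ : ℂ) * (‖X 3‖ : ℂ) ^ 2
      = (1 : ℂ) * (⟪X' 7, X 3⟫_ℂ + ⟪X 7, X' 3⟫_ℂ)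
        + (p.k₄ : ℂ) * (⟪X' 6, X 2⟫_ℂ + ⟪X 6, X' 2⟫_ℂ)
        + (d : ℂ) * ⟪X 7, X 3⟫_ℂ
        + (p.γ : ℂ) * ⟪X 7, X 7⟫_ℂ
        + (I * (((p.k₄ - p.k₂ : ℝ) : ℂ) * x)) * ⟪X 7, X 2⟫_ℂ
        + (p.k₁ : ℂ) * ⟪X 7, X 0⟫_ℂ := by
    rw [hX.row2, hX.row3, hX.row6, hX.row7]
    simp only [inner_add_left, inner_sub_left, inner_add_right, inner_sub_right, inner_smul_left,
      inner_smul_right, map_mul, conj_I, conj_ofReal, inner_self_eq, ofReal_mul, hτ₁, hτ₂, hτ₃]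
    push_cast
    ring
  have hR := norm_add_le_of_le (norm_add_le_of_le (norm_add_le_of_le (norm_add_le_of_le (norm_add_le_of_le ((norm_mul_le_of_le (c := (1 : ℂ)) le_rfl (hX.bal 7 3)))
      (norm_mul_le_of_le (c := (p.k₄ : ℂ)) le_rfl (hX.bal 6 2)))
      (norm_mul_inner_le (c := (d : ℂ)) le_rfl (X 7) (X 3)))
      (norm_mul_inner_le (c := (p.γ : ℂ)) le_rfl (X 7) (X 7)))
      (norm_mul_inner_le (c := (I * (((p.k₄ - p.k₂ : ℝ) : ℂ) * x))) le_rfl (X 7) (X 2)))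
      (norm_mul_inner_le (c := (p.k₁ : ℂ)) le_rfl (X 7) (X 0))
  rw [← e] at hR
  simp only [norm_mul, norm_neg, norm_I, one_mul, norm_one, RCLike.norm_ofNat, norm_real, norm_pow, Real.norm_eq_abs,
    abs_norm, abs_mul] at hR ⊢
  linarith [hR]

/-- Second link: row 3 contains -k₁ X 0, so the pair (0, 3) sees ‖X 0‖². The pair (1, 2) cancels x⟪X
0, X 2⟫ and leaves x⟪X 1, X 3⟫ with the difference k₂ - k₁ of wave speeds. -/
theorem sq_zero_le (hX : BeamGram p d x B X X') (hτ₁ : p.τ₁ = 0) (hτ₂ : p.τ₂ = 1) :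
    |p.k₁| * |p.k₁| * ‖X 0‖ ^ 2 ≤ |p.k₁| * B + |p.k₂| * B + |p.k₁| * (‖X 3‖ * ‖X 3‖)
      + |p.k₁| * (‖X 5‖ * ‖X 3‖) + |p.k₂ - p.k₁| * |x| * (‖X 1‖ * ‖X 3‖)
      + |p.k₁| * |p.γ| * (‖X 0‖ * ‖X 7‖) := by
  have e : ((p.k₁ : ℂ) * p.k₁) * (‖X 0‖ : ℂ) ^ 2
      = (-(p.k₁ : ℂ)) * (⟪X' 0, X 3⟫_ℂ + ⟪X 0, X' 3⟫_ℂ)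
        + (-(p.k₂ : ℂ)) * (⟪X' 1, X 2⟫_ℂ + ⟪X 1, X' 2⟫_ℂ)
        + (p.k₁ : ℂ) * ⟪X 3, X 3⟫_ℂ
        + (p.k₁ : ℂ) * ⟪X 5, X 3⟫_ℂ
        + (I * (((p.k₂ - p.k₁ : ℝ) : ℂ) * x)) * ⟪X 1, X 3⟫_ℂ
        + (-((p.k₁ : ℂ) * p.γ)) * ⟪X 0, X 7⟫_ℂ := by
    rw [hX.row0, hX.row1, hX.row2, hX.row3]
    simp only [inner_add_left, inner_sub_left, inner_add_right, inner_sub_right, inner_smul_left,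
      inner_smul_right, map_mul, conj_I, conj_ofReal, inner_self_eq, ofReal_mul, hτ₁, hτ₂]
    push_cast
    ring
  have hR := norm_add_le_of_le (norm_add_le_of_le (norm_add_le_of_le (norm_add_le_of_le (norm_add_le_of_le ((norm_mul_le_of_le (c := (-(p.k₁ : ℂ))) le_rfl (hX.bal 0 3)))
      (norm_mul_le_of_le (c := (-(p.k₂ : ℂ))) le_rfl (hX.bal 1 2)))
      (norm_mul_inner_le (c := (p.k₁ : ℂ)) le_rfl (X 3) (X 3)))
      (norm_mul_inner_le (c := (p.k₁ : ℂ)) le_rfl (X 5) (X 3)))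
      (norm_mul_inner_le (c := (I * (((p.k₂ - p.k₁ : ℝ) : ℂ) * x))) le_rfl (X 1) (X 3)))
      (norm_mul_inner_le (c := (-((p.k₁ : ℂ) * p.γ))) le_rfl (X 0) (X 7))
  rw [← e] at hR
  simp only [norm_mul, norm_neg, norm_I, one_mul, norm_one, RCLike.norm_ofNat, norm_real, norm_pow, Real.norm_eq_abs,
    abs_norm, abs_mul] at hR ⊢
  linarith [hR]

/-- Third link: row 0 contains `X 5`, so the pair (0, 5) sees ‖X 5‖². The pair (1, 4) cancels x⟪X 1,
X 5⟫, and k₁ - k₃ measures what remains. -/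
theorem sq_five_le (hX : BeamGram p d x B X X') (hτ₁ : p.τ₁ = 0) (hτ₃ : p.τ₃ = 0) :
    ‖X 5‖ ^ 2 ≤ B + B + (‖X 3‖ * ‖X 5‖) + |p.k₁| * (‖X 0‖ * ‖X 0‖)
      + |p.k₁ - p.k₃| * |x| * (‖X 0‖ * ‖X 4‖) := by
  have e : (‖X 5‖ : ℂ) ^ 2
      = (1 : ℂ) * (⟪X' 0, X 5⟫_ℂ + ⟪X 0, X' 5⟫_ℂ)
        + (1 : ℂ) * (⟪X' 1, X 4⟫_ℂ + ⟪X 1, X' 4⟫_ℂ)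
        + (-1 : ℂ) * ⟪X 3, X 5⟫_ℂ
        + (p.k₁ : ℂ) * ⟪X 0, X 0⟫_ℂ
        + (I * (((p.k₁ - p.k₃ : ℝ) : ℂ) * x)) * ⟪X 0, X 4⟫_ℂ := by
    rw [hX.row0, hX.row1, hX.row4, hX.row5]
    simp only [inner_add_left, inner_sub_left, inner_add_right, inner_sub_right, inner_smul_left,
      inner_smul_right, map_mul, conj_I, conj_ofReal, inner_self_eq, ofReal_mul, hτ₁, hτ₃]
    push_cast
    ring
  have hR := norm_add_le_of_le (norm_add_le_of_le (norm_add_le_of_le (norm_add_le_of_le ((norm_mul_le_of_le (c := (1 : ℂ)) le_rfl (hX.bal 0 5)))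
      (norm_mul_le_of_le (c := (1 : ℂ)) le_rfl (hX.bal 1 4)))
      (norm_mul_inner_le (c := (-1 : ℂ)) le_rfl (X 3) (X 5)))
      (norm_mul_inner_le (c := (p.k₁ : ℂ)) le_rfl (X 0) (X 0)))
      (norm_mul_inner_le (c := (I * (((p.k₁ - p.k₃ : ℝ) : ℂ) * x))) le_rfl (X 0) (X 4))
  rw [← e] at hR
  simp only [norm_mul, norm_neg, norm_I, one_mul, norm_one, RCLike.norm_ofNat, norm_real, norm_pow, Real.norm_eq_abs,
    abs_norm, abs_mul] at hR ⊢
  linarith [hR]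

/-- First link of the displacement chain. The pair (7, 1) gives γ‖X 1‖², and x⟪X 6, X 1⟫ is removed
by (6, 0) at the price of ⟪X 6, X 3 + X 5⟫. Only i x times this is a derivative (rows 2 and 4),
hence the extra factor x throughout. -/
theorem sq_one_le_of_coupling (hX : BeamGram p d x B X X') (hτ₁ : p.τ₁ = 1) (hτ₂ : p.τ₂ = 0) (hτ₃ : p.τ₃ = 0) :
    |x| * |p.γ| * ‖X 1‖ ^ 2 ≤ |x| * B + |x| * |p.k₄| * B + |p.k₄| * B + |p.k₄| * B
      + |x| * |d| * (‖X 7‖ * ‖X 1‖) + |x| * |p.γ| * (‖X 7‖ * ‖X 7‖)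
      + |x| * (|p.k₄ - p.k₁| * |x|) * (‖X 7‖ * ‖X 0‖) + |p.k₄| * |x| * (‖X 7‖ * ‖X 2‖)
      + |p.k₄| * |x| * (‖X 7‖ * ‖X 4‖) := by
  have e : I * x * (p.γ : ℂ) * (‖X 1‖ : ℂ) ^ 2
      = (I * x) * (⟪X' 7, X 1⟫_ℂ + ⟪X 7, X' 1⟫_ℂ)
        + (I * x * (p.k₄ : ℂ)) * (⟪X' 6, X 0⟫_ℂ + ⟪X 6, X' 0⟫_ℂ)
        + (-(p.k₄ : ℂ)) * (⟪X' 6, X 2⟫_ℂ + ⟪X 6, X' 2⟫_ℂ)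
        + (-(p.k₄ : ℂ)) * (⟪X' 6, X 4⟫_ℂ + ⟪X 6, X' 4⟫_ℂ)
        + (I * x * (d : ℂ)) * ⟪X 7, X 1⟫_ℂ
        + (I * x * (p.γ : ℂ)) * ⟪X 7, X 7⟫_ℂ
        + (I * x * (I * (((p.k₄ - p.k₁ : ℝ) : ℂ) * x))) * ⟪X 7, X 0⟫_ℂ
        + (-(p.k₄ * (I * x))) * ⟪X 7, X 2⟫_ℂ
        + (-(p.k₄ * (I * x))) * ⟪X 7, X 4⟫_ℂ := by
    rw [hX.row0, hX.row1, hX.row2, hX.row4, hX.row6, hX.row7]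
    simp only [inner_add_left, inner_sub_left, inner_add_right, inner_sub_right, inner_smul_left,
      inner_smul_right, map_mul, conj_I, conj_ofReal, inner_self_eq, ofReal_mul, hτ₁, hτ₂, hτ₃]
    push_cast
    ring
  have hR := norm_add_le_of_le (norm_add_le_of_le (norm_add_le_of_le (norm_add_le_of_le (norm_add_le_of_le (norm_add_le_of_le (norm_add_le_of_le (norm_add_le_of_le ((norm_mul_le_of_le (c := (I * x)) le_rfl (hX.bal 7 1)))
      (norm_mul_le_of_le (c := (I * x * (p.k₄ : ℂ))) le_rfl (hX.bal 6 0)))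
      (norm_mul_le_of_le (c := (-(p.k₄ : ℂ))) le_rfl (hX.bal 6 2)))
      (norm_mul_le_of_le (c := (-(p.k₄ : ℂ))) le_rfl (hX.bal 6 4)))
      (norm_mul_inner_le (c := (I * x * (d : ℂ))) le_rfl (X 7) (X 1)))
      (norm_mul_inner_le (c := (I * x * (p.γ : ℂ))) le_rfl (X 7) (X 7)))
      (norm_mul_inner_le (c := (I * x * (I * (((p.k₄ - p.k₁ : ℝ) : ℂ) * x)))) le_rfl (X 7) (X 0)))
      (norm_mul_inner_le (c := (-(p.k₄ * (I * x)))) le_rfl (X 7) (X 2)))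
      (norm_mul_inner_le (c := (-(p.k₄ * (I * x)))) le_rfl (X 7) (X 4))
  rw [← e] at hR
  simp only [norm_mul, norm_neg, norm_I, one_mul, norm_one, RCLike.norm_ofNat, norm_real, norm_pow, Real.norm_eq_abs,
    abs_norm, abs_mul] at hR ⊢
  linarith [hR]

/-- Row 0 contains only the sum X 3 + X 5, so the pair (0, 3) yields ‖X 3‖² together with the mixed
product; a separate bound for the latter isolates the norm. -/
theorem norm_three_add_inner_le (hX : BeamGram p d x B X X') (hτ₂ : p.τ₂ = 0) :
    ‖(‖X 3‖ : ℂ) ^ 2 + ⟪X 5, X 3⟫_ℂ‖ ≤ B + |x| * (‖X 1‖ * ‖X 3‖) + |p.k₂| * |x| * (‖X 0‖ * ‖X 2‖)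
      + |p.k₁| * (‖X 0‖ * ‖X 0‖) := by
  have e : (‖X 3‖ : ℂ) ^ 2 + ⟪X 5, X 3⟫_ℂ
      = (1 : ℂ) * (⟪X' 0, X 3⟫_ℂ + ⟪X 0, X' 3⟫_ℂ)
        + (I * x) * ⟪X 1, X 3⟫_ℂ
        + (-(I * (p.k₂ * x))) * ⟪X 0, X 2⟫_ℂ
        + (p.k₁ : ℂ) * ⟪X 0, X 0⟫_ℂ := by
    rw [hX.row0, hX.row3]
    simp only [inner_add_left, inner_sub_left, inner_add_right, inner_sub_right, inner_smul_left,
      inner_smul_right, map_mul, conj_I, conj_ofReal, inner_self_eq, ofReal_mul, hτ₂]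
    push_cast
    ring
  have hR := norm_add_le_of_le (norm_add_le_of_le (norm_add_le_of_le ((norm_mul_le_of_le (c := (1 : ℂ)) le_rfl (hX.bal 0 3)))
      (norm_mul_inner_le (c := (I * x)) le_rfl (X 1) (X 3)))
      (norm_mul_inner_le (c := (-(I * (p.k₂ * x)))) le_rfl (X 0) (X 2)))
      (norm_mul_inner_le (c := (p.k₁ : ℂ)) le_rfl (X 0) (X 0))
  rw [← e] at hR
  simp only [norm_mul, norm_neg, norm_I, one_mul, norm_one, RCLike.norm_ofNat, norm_real, norm_pow, Real.norm_eq_abs,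
    abs_norm, abs_mul] at hR ⊢
  linarith [hR]

theorem norm_five_add_inner_le (hX : BeamGram p d x B X X') (hτ₃ : p.τ₃ = 0) :
    ‖(‖X 5‖ : ℂ) ^ 2 + ⟪X 3, X 5⟫_ℂ‖ ≤ B + |x| * (‖X 1‖ * ‖X 5‖) + |p.k₃| * |x| * (‖X 0‖ * ‖X 4‖)
      + |p.k₁| * (‖X 0‖ * ‖X 0‖) := by
  have e : (‖X 5‖ : ℂ) ^ 2 + ⟪X 3, X 5⟫_ℂ
      = (1 : ℂ) * (⟪X' 0, X 5⟫_ℂ + ⟪X 0, X' 5⟫_ℂ)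
        + (I * x) * ⟪X 1, X 5⟫_ℂ
        + (-(I * (p.k₃ * x))) * ⟪X 0, X 4⟫_ℂ
        + (p.k₁ : ℂ) * ⟪X 0, X 0⟫_ℂ := by
    rw [hX.row0, hX.row5]
    simp only [inner_add_left, inner_sub_left, inner_add_right, inner_sub_right, inner_smul_left,
      inner_smul_right, map_mul, conj_I, conj_ofReal, inner_self_eq, ofReal_mul, hτ₃]
    push_cast
    ring
  have hR := norm_add_le_of_le (norm_add_le_of_le (norm_add_le_of_le ((norm_mul_le_of_le (c := (1 : ℂ)) le_rfl (hX.bal 0 5)))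
      (norm_mul_inner_le (c := (I * x)) le_rfl (X 1) (X 5)))
      (norm_mul_inner_le (c := (-(I * (p.k₃ * x)))) le_rfl (X 0) (X 4)))
      (norm_mul_inner_le (c := (p.k₁ : ℂ)) le_rfl (X 0) (X 0))
  rw [← e] at hR
  simp only [norm_mul, norm_neg, norm_I, one_mul, norm_one, RCLike.norm_ofNat, norm_real, norm_pow, Real.norm_eq_abs,
    abs_norm, abs_mul] at hR ⊢
  linarith [hR]

/-- The weights k₃ and k₂ on the pairs (3, 4) and (2, 5) cancel x⟪X 2, X 4⟫ and leave χ x⟪X 3, X 5⟫.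
It is here that χ ≠ 0 separates the two angular velocities. -/
theorem norm_inner_three_five_le (hX : BeamGram p d x B X X') (hτ₂ : p.τ₂ = 0) (hτ₃ : p.τ₃ = 0) :
    |p.k₃ - p.k₂| * |x| * ‖⟪X 3, X 5⟫_ℂ‖ ≤ |p.k₃| * B + |p.k₂| * B + |p.k₃| * |p.k₁| * (‖X 0‖ * ‖X 4‖)
      + |p.k₂| * |p.k₁| * (‖X 2‖ * ‖X 0‖) := by
  have e : ((p.k₃ - p.k₂ : ℝ) : ℂ) * (I * x) * ⟪X 3, X 5⟫_ℂ
      = (p.k₃ : ℂ) * (⟪X' 3, X 4⟫_ℂ + ⟪X 3, X' 4⟫_ℂ)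
        + (p.k₂ : ℂ) * (⟪X' 2, X 5⟫_ℂ + ⟪X 2, X' 5⟫_ℂ)
        + ((p.k₃ : ℂ) * (p.k₁ : ℂ)) * ⟪X 0, X 4⟫_ℂ
        + ((p.k₂ : ℂ) * (p.k₁ : ℂ)) * ⟪X 2, X 0⟫_ℂ := by
    rw [hX.row2, hX.row3, hX.row4, hX.row5]
    simp only [inner_add_left, inner_sub_left, inner_add_right, inner_sub_right, inner_smul_left,
      inner_smul_right, map_mul, conj_I, conj_ofReal, inner_self_eq, ofReal_mul, hτ₂, hτ₃]
    push_cast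
    ring
  have hR := norm_add_le_of_le (norm_add_le_of_le (norm_add_le_of_le ((norm_mul_le_of_le (c := (p.k₃ : ℂ)) le_rfl (hX.bal 3 4)))
      (norm_mul_le_of_le (c := (p.k₂ : ℂ)) le_rfl (hX.bal 2 5)))
      (norm_mul_inner_le (c := ((p.k₃ : ℂ) * (p.k₁ : ℂ))) le_rfl (X 0) (X 4)))
      (norm_mul_inner_le (c := ((p.k₂ : ℂ) * (p.k₁ : ℂ))) le_rfl (X 2) (X 0))
  rw [← e] at hR
  simp only [norm_mul, norm_neg, norm_I, one_mul, norm_one, RCLike.norm_ofNat, norm_real, norm_pow, Real.norm_eq_abs,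
    abs_norm, abs_mul] at hR ⊢
  linarith [hR]

/-- This product is the obstruction to bounding ‖X 0‖ by ‖X 1‖ in `sq_zero_le_inner`. Replacing γ X
1 through row 7 gives every non-boundary term a factor ‖X 7‖. -/
theorem norm_inner_one_add_le (hX : BeamGram p d x B X X') (hτ₁ : p.τ₁ = 1) (hτ₂ : p.τ₂ = 0) (hτ₃ : p.τ₃ = 0) :
    |p.γ| * ‖⟪X 1, X 3 + X 5⟫_ℂ‖ ≤ B + B + |p.k₄| * B + |p.k₄| * B + |d| * (‖X 7‖ * ‖X 3 + X 5‖)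
      + |p.k₄ - p.k₂| * |x| * (‖X 7‖ * ‖X 2‖) + |p.k₄ - p.k₃| * |x| * (‖X 7‖ * ‖X 4‖)
      + 2 * |p.k₁| * (‖X 7‖ * ‖X 0‖) := by
  have e : (p.γ : ℂ) * ⟪X 1, X 3 + X 5⟫_ℂ
      = (1 : ℂ) * (⟪X' 7, X 3⟫_ℂ + ⟪X 7, X' 3⟫_ℂ)
        + (1 : ℂ) * (⟪X' 7, X 5⟫_ℂ + ⟪X 7, X' 5⟫_ℂ)
        + (p.k₄ : ℂ) * (⟪X' 6, X 2⟫_ℂ + ⟪X 6, X' 2⟫_ℂ)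
        + (p.k₄ : ℂ) * (⟪X' 6, X 4⟫_ℂ + ⟪X 6, X' 4⟫_ℂ)
        + (d : ℂ) * ⟪X 7, X 3 + X 5⟫_ℂ
        + (I * (((p.k₄ - p.k₂ : ℝ) : ℂ) * x)) * ⟪X 7, X 2⟫_ℂ
        + (I * (((p.k₄ - p.k₃ : ℝ) : ℂ) * x)) * ⟪X 7, X 4⟫_ℂ
        + (2 * (p.k₁ : ℂ)) * ⟪X 7, X 0⟫_ℂ := by
    rw [hX.row2, hX.row3, hX.row4, hX.row5, hX.row6, hX.row7]
    simp only [inner_add_left, inner_sub_left, inner_add_right, inner_sub_right, inner_smul_left,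
      inner_smul_right, map_mul, conj_I, conj_ofReal, inner_self_eq, ofReal_mul, hτ₁, hτ₂, hτ₃]
    push_cast
    ring
  have hR := norm_add_le_of_le (norm_add_le_of_le (norm_add_le_of_le (norm_add_le_of_le (norm_add_le_of_le (norm_add_le_of_le (norm_add_le_of_le ((norm_mul_le_of_le (c := (1 : ℂ)) le_rfl (hX.bal 7 3)))
      (norm_mul_le_of_le (c := (1 : ℂ)) le_rfl (hX.bal 7 5)))
      (norm_mul_le_of_le (c := (p.k₄ : ℂ)) le_rfl (hX.bal 6 2)))
      (norm_mul_le_of_le (c := (p.k₄ : ℂ)) le_rfl (hX.bal 6 4)))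
      (norm_mul_inner_le (c := (d : ℂ)) le_rfl (X 7) (X 3 + X 5)))
      (norm_mul_inner_le (c := (I * (((p.k₄ - p.k₂ : ℝ) : ℂ) * x))) le_rfl (X 7) (X 2)))
      (norm_mul_inner_le (c := (I * (((p.k₄ - p.k₃ : ℝ) : ℂ) * x))) le_rfl (X 7) (X 4)))
      (norm_mul_inner_le (c := (2 * (p.k₁ : ℂ))) le_rfl (X 7) (X 0))
  rw [← e] at hR
  simp only [norm_mul, norm_neg, norm_I, one_mul, norm_one, RCLike.norm_ofNat, norm_real, norm_pow, Real.norm_eq_abs,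
    abs_norm, abs_mul] at hR ⊢
  linarith [hR]

theorem sq_add_le (hX : BeamGram p d x B X X') (hτ₂ : p.τ₂ = 0) (hτ₃ : p.τ₃ = 0) :
    ‖X 3 + X 5‖ ^ 2 ≤ B + B + |x| * (‖X 1‖ * ‖X 3 + X 5‖) + |p.k₂| * |x| * (‖X 0‖ * ‖X 2‖)
      + |p.k₃| * |x| * (‖X 0‖ * ‖X 4‖) + 2 * |p.k₁| * (‖X 0‖ * ‖X 0‖) := by
  have e : (‖X 3 + X 5‖ : ℂ) ^ 2
      = (1 : ℂ) * (⟪X' 0, X 3⟫_ℂ + ⟪X 0, X' 3⟫_ℂ)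
        + (1 : ℂ) * (⟪X' 0, X 5⟫_ℂ + ⟪X 0, X' 5⟫_ℂ)
        + (I * x) * ⟪X 1, X 3 + X 5⟫_ℂ
        + (-(I * (p.k₂ * x))) * ⟪X 0, X 2⟫_ℂ
        + (-(I * (p.k₃ * x))) * ⟪X 0, X 4⟫_ℂ
        + (2 * (p.k₁ : ℂ)) * ⟪X 0, X 0⟫_ℂ := by
    rw [← inner_self_eq, hX.row0, hX.row3, hX.row5]
    simp only [inner_add_left, inner_sub_left, inner_add_right, inner_sub_right, inner_smul_left,
      inner_smul_right, map_mul, conj_I, conj_ofReal, inner_self_eq, ofReal_mul, hτ₂, hτ₃]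
    push_cast
    ring
  have hR := norm_add_le_of_le (norm_add_le_of_le (norm_add_le_of_le (norm_add_le_of_le (norm_add_le_of_le ((norm_mul_le_of_le (c := (1 : ℂ)) le_rfl (hX.bal 0 3)))
      (norm_mul_le_of_le (c := (1 : ℂ)) le_rfl (hX.bal 0 5)))
      (norm_mul_inner_le (c := (I * x)) le_rfl (X 1) (X 3 + X 5)))
      (norm_mul_inner_le (c := (-(I * (p.k₂ * x)))) le_rfl (X 0) (X 2)))
      (norm_mul_inner_le (c := (-(I * (p.k₃ * x)))) le_rfl (X 0) (X 4)))
      (norm_mul_inner_le (c := (2 * (p.k₁ : ℂ))) le_rfl (X 0) (X 0))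
  rw [← e] at hR
  simp only [norm_mul, norm_neg, norm_I, one_mul, norm_one, RCLike.norm_ofNat, norm_real, norm_pow, Real.norm_eq_abs,
    abs_norm, abs_mul] at hR ⊢
  linarith [hR]

theorem sq_zero_le_inner (hX : BeamGram p d x B X X') (hτ₁ : p.τ₁ = 1) :
    ‖(-(I * (p.k₁ * x))) * (‖X 0‖ : ℂ) ^ 2 + ⟪X 1, X 3 + X 5⟫_ℂ‖ ≤ B + |p.γ| * (‖X 7‖ * ‖X 0‖)
      + |x| * (‖X 1‖ * ‖X 1‖) := by
  have e : (-(I * (p.k₁ * x))) * (‖X 0‖ : ℂ) ^ 2 + ⟪X 1, X 3 + X 5⟫_ℂ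
      = (1 : ℂ) * (⟪X' 1, X 0⟫_ℂ + ⟪X 1, X' 0⟫_ℂ)
        + (p.γ : ℂ) * ⟪X 7, X 0⟫_ℂ
        + (-(I * x)) * ⟪X 1, X 1⟫_ℂ := by
    rw [hX.row0, hX.row1]
    simp only [inner_add_left, inner_sub_left, inner_add_right, inner_sub_right, inner_smul_left,
      inner_smul_right, map_mul, conj_I, conj_ofReal, inner_self_eq, ofReal_mul, hτ₁]
    push_cast
    ring
  have hR := norm_add_le_of_le (norm_add_le_of_le ((norm_mul_le_of_le (c := (1 : ℂ)) le_rfl (hX.bal 1 0)))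
      (norm_mul_inner_le (c := (p.γ : ℂ)) le_rfl (X 7) (X 0)))
      (norm_mul_inner_le (c := (-(I * x))) le_rfl (X 1) (X 1))
  rw [← e] at hR
  simp only [norm_mul, norm_neg, norm_I, one_mul, norm_one, RCLike.norm_ofNat, norm_real, norm_pow, Real.norm_eq_abs,
    abs_norm, abs_mul] at hR ⊢
  linarith [hR]

end BeamGram

end GramIdentities

/-! ### From inner products to inequalities between real numbers. -/

section BeamBounds

/-- Inequalities between the `L²` norms in time of the components, if the heat conduction is
coupled to one of the rotation angles. The parameter `κ` is `0` for equal wave speeds. -/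
structure AngleBounds (C κ d x B v u z y f t s h : ℝ) : Prop where
  hC : 1 ≤ C
  hκ : 0 ≤ κ
  hx : 0 < x
  hd : 0 ≤ d
  hB : 0 ≤ B
  hv : 0 ≤ v
  hu : 0 ≤ u
  hz : 0 ≤ z
  hy : 0 ≤ y
  hf : 0 ≤ f
  ht : 0 ≤ t
  hs : 0 ≤ s
  hh : 0 ≤ h
  diss : d * h ^ 2 ≤ B
  y_le : y ^ 2 ≤ C * (B + h ^ 2 + d * h * y + x * h * z + h * v)
  v_le : v ^ 2 ≤ C * (B + y ^ 2 + y * t + v * h + κ * (x * u * y))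
  t_le : t ^ 2 ≤ C * (B + y * t + v ^ 2 + κ * (x * v * f))
  z_le : x * z ^ 2 ≤ C * (B + v * z + h * z + x * y ^ 2)
  s_le : x * s ^ 2 ≤ C * (B + d * h * s + y * s + x * h ^ 2)
  f_le : x * f ^ 2 ≤ C * (B + v * f + x * t ^ 2)
  u_le : x * u ^ 2 ≤ C * (B + x * v ^ 2 + u * y + u * t)

/-- Inequalities between the `L²` norms in time of the components, if the heat conduction is
coupled to the transversal displacement; `w` is the norm of the sum of the angular velocities,
`c` and `g` bound two inner products. -/
structure DisplacementBounds (C d x B v u z y f t s h w c g : ℝ) : Prop where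
  hC : 1 ≤ C
  hx : 0 < x
  hd : 0 ≤ d
  hB : 0 ≤ B
  hv : 0 ≤ v
  hu : 0 ≤ u
  hz : 0 ≤ z
  hy : 0 ≤ y
  hf : 0 ≤ f
  ht : 0 ≤ t
  hs : 0 ≤ s
  hh : 0 ≤ h
  hw : 0 ≤ w
  hg : g ≤ u * y + u * t
  diss : d * h ^ 2 ≤ B
  u_le : x * u ^ 2 ≤ C * (x * B + B + x * d * h * u + x * h ^ 2 + x ^ 2 * h * v + x * h * z
    + x * h * f)
  v_le : x * v ^ 2 ≤ C * (B + h * v + x * u ^ 2 + g)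
  w_le : w ^ 2 ≤ C * (B + x * u * w + x * v * z + x * v * f + v ^ 2)
  g_le : g ≤ C * (B + d * h * w + x * h * z + x * h * f + h * v)
  c_le : x * c ≤ C * (B + v * f + v * z)
  y_le : y ^ 2 ≤ c + C * (B + x * u * y + x * v * z + v ^ 2)
  t_le : t ^ 2 ≤ c + C * (B + x * u * t + x * v * f + v ^ 2)
  z_le : x * z ^ 2 ≤ C * (B + v * z + x * y ^ 2)
  f_le : x * f ^ 2 ≤ C * (B + v * f + x * t ^ 2)
  s_le : x * s ^ 2 ≤ C * (B + d * h * s + u * s + x * h ^ 2)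

namespace BeamGram

open Complex Filter
open scoped InnerProductSpace

theorem le_mul_of_mul_le {c K C T S : ℝ} (hc : 0 < c) (hK : K ≤ C * c) (hS : 0 ≤ S)
    (h : c * T ≤ K * S) : T ≤ C * S := by
  have h2 : c * T ≤ c * (C * S) := by nlinarith [mul_le_mul_of_nonneg_right hK hS]
  exact le_of_mul_le_mul_left h2 hc

theorem eventually_le_mul (K : ℝ) {c : ℝ} (hc : 0 < c) : ∀ᶠ C in atTop, K ≤ C * c := by
  filter_upwards [eventually_ge_atTop (K / c)] with C h using (div_le_iff₀ hc).mp h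

variable {p : BeamCoeffs}

/-- All dependence on the coefficients is collected in one constant C, so that later estimates
involve only norms, x, d and B. -/
theorem exists_angleBounds (hk₁ : 0 < p.k₁) (hk₂ : 0 < p.k₂) (hk₃ : 0 < p.k₃) (hk₄ : 0 < p.k₄)
    (hγ : p.γ ≠ 0) (hτ₁ : p.τ₁ = 0) (hτ₂ : p.τ₂ = 1) (hτ₃ : p.τ₃ = 0) (κ : ℝ)
    (hκ : κ = 1 ∨ κ = 0 ∧ p.k₁ = p.k₂ ∧ p.k₂ = p.k₃) :
    ∃ C : ℝ, 1 ≤ C ∧ ∀ (H : Type) [NormedAddCommGroup H] [InnerProductSpace ℂ H]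
      (X X' : Fin 8 → H) (d x B : ℝ), x ≠ 0 → 0 ≤ d → BeamGram p d x B X X' →
      AngleBounds C κ d |x| B ‖X 0‖ ‖X 1‖ ‖X 2‖ ‖X 3‖ ‖X 4‖ ‖X 5‖ ‖X 6‖ ‖X 7‖ := by
  have hg : 0 < |p.γ| := abs_pos.mpr hγ
  -- A dominates every coefficient on the right-hand sides; C below exceeds 4A divided by each
  -- leading coefficient, where the 4 covers terms that occur more than once.
  obtain ⟨A, hA1, hAA, hAγ, h1A, h2A, h4A, h12, h13, h42⟩ :=
    ((eventually_ge_atTop 1).and <| (eventually_ge_atTop (|p.k₁| * |p.γ|)).and <|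
      (eventually_ge_atTop |p.γ|).and <| (eventually_ge_atTop |p.k₁|).and <|
      (eventually_ge_atTop |p.k₂|).and <| (eventually_ge_atTop |p.k₄|).and <|
      (eventually_ge_atTop |p.k₂ - p.k₁|).and <| (eventually_ge_atTop |p.k₁ - p.k₃|).and <|
      eventually_ge_atTop |p.k₄ - p.k₂|).exists
  obtain ⟨C, hC1, hCk, hCγ, hC11, hC2, hC3, hC4⟩ :=
    ((eventually_ge_atTop 1).and <| (eventually_le_mul (4 * A) one_pos).and <|
      (eventually_le_mul (4 * A) hg).and <|
      (eventually_le_mul (4 * A) (by positivity : 0 < |p.k₁| * |p.k₁|)).and <|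
      (eventually_le_mul (4 * A) (abs_pos.mpr hk₂.ne')).and <|
      (eventually_le_mul (4 * A) (abs_pos.mpr hk₃.ne')).and <|
      eventually_le_mul (4 * A) (abs_pos.mpr hk₄.ne')).exists
  refine ⟨C, hC1, fun H _ _ X X' d x B hx hd hX => ?_⟩
  have hx0 : 0 < |x| := abs_pos.mpr hx
  have hB : 0 ≤ B := (norm_nonneg _).trans (hX.bal 0 0)
  have m {a t : ℝ} (ha : a ≤ A) (ht : 0 ≤ t) : a * t ≤ A * t := mul_le_mul_of_nonneg_right ha ht
  have e1 := hX.sq_one_le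
  have e2 := hX.sq_two_le
  have e4 := hX.sq_four_le
  have e6 := hX.sq_six_le
  have e3 := hX.sq_three_le hτ₁ hτ₂ hτ₃
  have e0 := hX.sq_zero_le hτ₁ hτ₂
  have e5 := hX.sq_five_le hτ₁ hτ₃
  have ediss := hX.diss
  rw [hτ₁, hτ₂, hτ₃] at *
  simp only [abs_zero, zero_mul, abs_one, one_mul, add_zero, abs_of_nonneg hd] at e1 e2 e3 e4 e6
  have n0 := norm_nonneg (X 0)
  have n1 := norm_nonneg (X 1)
  have n2 := norm_nonneg (X 2)
  have n3 := norm_nonneg (X 3)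
  have n4 := norm_nonneg (X 4)
  have n5 := norm_nonneg (X 5)
  have n6 := norm_nonneg (X 6)
  have n7 := norm_nonneg (X 7)
  generalize ‖X 0‖ = v at *
  generalize ‖X 1‖ = u at *
  generalize ‖X 2‖ = z at *
  generalize ‖X 3‖ = y at *
  generalize ‖X 4‖ = f at *
  generalize ‖X 5‖ = t at *
  generalize ‖X 6‖ = s at *
  generalize ‖X 7‖ = h at *
  generalize |x| = x at *
  have hκ0 : 0 ≤ κ := by rcases hκ with h | h <;> simp [h]
  have hκ1 : |p.k₂ - p.k₁| ≤ A * κ := by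
    rcases hκ with h | ⟨h, h', -⟩
    · simpa [h]
    · simp [h, h']
  have hκ3 : |p.k₁ - p.k₃| ≤ A * κ := by
    rcases hκ with h | ⟨h, h', h''⟩
    · simpa [h]
    · simp [h, h', h'']
  refine ⟨hC1, hκ0, hx0, hd, hB, n0, n1, n2, n3, n4, n5, n6, n7, ediss, ?_, ?_, ?_, ?_, ?_, ?_, ?_⟩
  · refine le_mul_of_mul_le hg hCγ (by positivity) (e3.trans ?_)
    linarith [m h4A hB, m hA1 hB, m hAγ (by positivity : 0 ≤ h * h),
      m hA1 (by positivity : 0 ≤ d * (h * y)), m h42 (by positivity : 0 ≤ x * (h * z)),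
      m h1A (by positivity : 0 ≤ h * v), (by positivity : 0 ≤ A * (d * (h * y))),
      (by positivity : 0 ≤ A * (x * (h * z))), (by positivity : 0 ≤ A * (h * h)),
      (by positivity : 0 ≤ A * B), (by positivity : 0 ≤ A * (h * v))]
  · refine le_mul_of_mul_le (by positivity) hC11 (by positivity) (e0.trans ?_)
    linarith [m h1A hB, m h2A hB, m h1A (by positivity : 0 ≤ y * y),
      m h1A (by positivity : 0 ≤ t * y),
      mul_le_mul_of_nonneg_right hκ1 (by positivity : 0 ≤ x * (u * y)),
      m hAA (by positivity : 0 ≤ v * h), (by positivity : 0 ≤ A * (y * y)),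
      (by positivity : 0 ≤ A * (t * y)), (by positivity : 0 ≤ A * κ * (x * (u * y))),
      (by positivity : 0 ≤ A * B), (by positivity : 0 ≤ A * (h * v))]
  · refine le_mul_of_mul_le one_pos hCk (by positivity) ((one_mul _).trans_le (e5.trans ?_))
    linarith [m hA1 hB, m hA1 (by positivity : 0 ≤ y * t), m h1A (by positivity : 0 ≤ v * v),
      mul_le_mul_of_nonneg_right hκ3 (by positivity : 0 ≤ x * (v * f)),
      (by positivity : 0 ≤ A * (y * t)), (by positivity : 0 ≤ A * (v * v)),
      (by positivity : 0 ≤ A * κ * (x * (v * f))), (by positivity : 0 ≤ A * B)]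
  · refine le_mul_of_mul_le (by positivity) hC2 (by positivity)
      ((mul_assoc _ _ _).symm.trans_le (e2.trans ?_))
    linarith [m hA1 hB, m h1A (by positivity : 0 ≤ v * z), m hAγ (by positivity : 0 ≤ h * z),
      m hA1 (by positivity : 0 ≤ x * (y * y)),
      (by positivity : 0 ≤ A * (v * z)), (by positivity : 0 ≤ A * (h * z)),
      (by positivity : 0 ≤ A * (x * (y * y))), (by positivity : 0 ≤ A * B)]
  · refine le_mul_of_mul_le (by positivity) hC4 (by positivity)
      ((mul_assoc _ _ _).symm.trans_le (e6.trans ?_))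
    linarith [m hA1 hB, m hA1 (by positivity : 0 ≤ d * (h * s)), m hAγ (by positivity : 0 ≤ y * s),
      m hA1 (by positivity : 0 ≤ x * (h * h)),
      (by positivity : 0 ≤ A * (y * s)), (by positivity : 0 ≤ A * (d * (h * s))),
      (by positivity : 0 ≤ A * (x * (h * h))), (by positivity : 0 ≤ A * B)]
  · refine le_mul_of_mul_le (by positivity) hC3 (by positivity)
      ((mul_assoc _ _ _).symm.trans_le (e4.trans ?_))
    linarith [m hA1 hB, m h1A (by positivity : 0 ≤ v * f),
      m hA1 (by positivity : 0 ≤ x * (t * t)),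
      (by positivity : 0 ≤ A * (v * f)),
      (by positivity : 0 ≤ A * (x * (t * t))), (by positivity : 0 ≤ A * B)]
  · refine le_mul_of_mul_le one_pos hCk (by positivity) ((one_mul _).trans_le (e1.trans ?_))
    linarith [m hA1 hB, m h1A (by positivity : 0 ≤ x * (v * v)), m hA1 (by positivity : 0 ≤ u * y),
      m hA1 (by positivity : 0 ≤ u * t),
      (by positivity : 0 ≤ A * (u * y)), (by positivity : 0 ≤ A * (u * t)),
      (by positivity : 0 ≤ A * (x * (v * v))), (by positivity : 0 ≤ A * B)]

theorem exists_displacementBounds (hk₁ : 0 < p.k₁) (hk₂ : 0 < p.k₂) (hk₃ : 0 < p.k₃)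
    (hk₄ : 0 < p.k₄) (hγ : p.γ ≠ 0) (hχ : p.χ ≠ 0)
    (hτ₁ : p.τ₁ = 1) (hτ₂ : p.τ₂ = 0) (hτ₃ : p.τ₃ = 0) :
    ∃ C : ℝ, 1 ≤ C ∧ ∀ (H : Type) [NormedAddCommGroup H] [InnerProductSpace ℂ H]
      (X X' : Fin 8 → H) (d x B : ℝ), x ≠ 0 → 0 ≤ d → BeamGram p d x B X X' →
      ∃ w c g : ℝ, DisplacementBounds C d |x| B ‖X 0‖ ‖X 1‖ ‖X 2‖ ‖X 3‖ ‖X 4‖ ‖X 5‖ ‖X 6‖ ‖X 7‖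
        w c g := by
  have hg : 0 < |p.γ| := abs_pos.mpr hγ
  have hχ' : 0 < |p.k₃ - p.k₂| := abs_pos.mpr hχ
  obtain ⟨A, hA1, hAγ, h1A, h2A, h3A, h4A, h31, h21, h41, h42, h43, h11⟩ :=
    ((eventually_ge_atTop 1).and <|
      (eventually_ge_atTop |p.γ|).and <| (eventually_ge_atTop |p.k₁|).and <|
      (eventually_ge_atTop |p.k₂|).and <| (eventually_ge_atTop |p.k₃|).and <|
      (eventually_ge_atTop |p.k₄|).and <| (eventually_ge_atTop (|p.k₃| * |p.k₁|)).and <|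
      (eventually_ge_atTop (|p.k₂| * |p.k₁|)).and <| (eventually_ge_atTop |p.k₄ - p.k₁|).and <|
      (eventually_ge_atTop |p.k₄ - p.k₂|).and <| (eventually_ge_atTop |p.k₄ - p.k₃|).and <|
      eventually_ge_atTop (2 * |p.k₁|)).exists
  obtain ⟨C, hC1, hCk, hCγ, hC1', hC2, hC3, hC4, hCχ⟩ :=
    ((eventually_ge_atTop 1).and <| (eventually_le_mul (4 * A) one_pos).and <|
      (eventually_le_mul (4 * A) hg).and <|
      (eventually_le_mul (4 * A) (abs_pos.mpr hk₁.ne')).and <|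
      (eventually_le_mul (4 * A) (abs_pos.mpr hk₂.ne')).and <|
      (eventually_le_mul (4 * A) (abs_pos.mpr hk₃.ne')).and <|
      (eventually_le_mul (4 * A) (abs_pos.mpr hk₄.ne')).and <|
      eventually_le_mul (4 * A) hχ').exists
  refine ⟨C, hC1, fun H _ _ X X' d x B hx hd hX => ⟨‖X 3 + X 5‖, ‖⟪X 3, X 5⟫_ℂ‖,
    ‖⟪X 1, X 3 + X 5⟫_ℂ‖, ?_⟩⟩
  have hx0 : 0 < |x| := abs_pos.mpr hx
  have hB : 0 ≤ B := (norm_nonneg _).trans (hX.bal 0 0)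
  have m {a t : ℝ} (ha : a ≤ A) (ht : 0 ≤ t) : a * t ≤ A * t := mul_le_mul_of_nonneg_right ha ht
  have e2 := hX.sq_two_le
  have e4 := hX.sq_four_le
  have e6 := hX.sq_six_le
  have e1 := hX.sq_one_le_of_coupling hτ₁ hτ₂ hτ₃
  -- The reverse triangle inequality splits the square from the mixed product, here and in `e3` and
  -- `e5`.
  have e0 : |p.k₁| * |x| * ‖X 0‖ ^ 2 ≤ B + |p.γ| * (‖X 7‖ * ‖X 0‖) + |x| * (‖X 1‖ * ‖X 1‖)
      + ‖⟪X 1, X 3 + X 5⟫_ℂ‖ := by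
    have h := hX.sq_zero_le_inner hτ₁
    have h2 := norm_sub_norm_le (-(I * (p.k₁ * x)) * (‖X 0‖ : ℂ) ^ 2) (-⟪X 1, X 3 + X 5⟫_ℂ)
    rw [sub_neg_eq_add, norm_neg] at h2
    simp only [norm_mul, norm_neg, norm_I, one_mul, norm_real, norm_pow, Real.norm_eq_abs,
      abs_norm] at h2
    linarith
  have e3 : ‖X 3‖ ^ 2 ≤ B + |x| * (‖X 1‖ * ‖X 3‖) + |p.k₂| * |x| * (‖X 0‖ * ‖X 2‖)
      + |p.k₁| * (‖X 0‖ * ‖X 0‖) + ‖⟪X 3, X 5⟫_ℂ‖ := by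
    have h := hX.norm_three_add_inner_le hτ₂
    have h2 := norm_sub_norm_le ((‖X 3‖ : ℂ) ^ 2) (-⟪X 5, X 3⟫_ℂ)
    rw [sub_neg_eq_add, norm_neg, norm_inner_symm] at h2
    simp only [norm_real, norm_pow, Real.norm_eq_abs, abs_norm] at h2
    linarith
  have e5 : ‖X 5‖ ^ 2 ≤ B + |x| * (‖X 1‖ * ‖X 5‖) + |p.k₃| * |x| * (‖X 0‖ * ‖X 4‖)
      + |p.k₁| * (‖X 0‖ * ‖X 0‖) + ‖⟪X 3, X 5⟫_ℂ‖ := by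
    have h := hX.norm_five_add_inner_le hτ₃
    have h2 := norm_sub_norm_le ((‖X 5‖ : ℂ) ^ 2) (-⟪X 3, X 5⟫_ℂ)
    rw [sub_neg_eq_add, norm_neg] at h2
    simp only [norm_real, norm_pow, Real.norm_eq_abs, abs_norm] at h2
    linarith
  have ec := hX.norm_inner_three_five_le hτ₂ hτ₃
  have eg := hX.norm_inner_one_add_le hτ₁ hτ₂ hτ₃
  have ew := hX.sq_add_le hτ₂ hτ₃
  have ediss := hX.diss
  have hg' : ‖⟪X 1, X 3 + X 5⟫_ℂ‖ ≤ ‖X 1‖ * ‖X 3‖ + ‖X 1‖ * ‖X 5‖ := by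
    rw [inner_add_right]
    exact norm_add_le_of_le (norm_inner_le_norm _ _) (norm_inner_le_norm _ _)
  rw [hτ₁, hτ₂, hτ₃] at *
  simp only [abs_zero, zero_mul, abs_one, one_mul, add_zero, abs_of_nonneg hd]
    at e1 e2 e3 e4 e6 e0 e5 eg
  have nw := norm_nonneg (X 3 + X 5)
  have nc := norm_nonneg ⟪X 3, X 5⟫_ℂ
  have ng := norm_nonneg ⟪X 1, X 3 + X 5⟫_ℂ
  generalize ‖⟪X 1, X 3 + X 5⟫_ℂ‖ = g at *
  generalize ‖⟪X 3, X 5⟫_ℂ‖ = c at *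
  generalize ‖X 3 + X 5‖ = w at *
  have n0 := norm_nonneg (X 0)
  have n1 := norm_nonneg (X 1)
  have n2 := norm_nonneg (X 2)
  have n3 := norm_nonneg (X 3)
  have n4 := norm_nonneg (X 4)
  have n5 := norm_nonneg (X 5)
  have n6 := norm_nonneg (X 6)
  have n7 := norm_nonneg (X 7)
  generalize ‖X 0‖ = v at *
  generalize ‖X 1‖ = u at *
  generalize ‖X 2‖ = z at *
  generalize ‖X 3‖ = y at *
  generalize ‖X 4‖ = f at *
  generalize ‖X 5‖ = t at *
  generalize ‖X 6‖ = s at *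
  generalize ‖X 7‖ = h at *
  generalize |x| = x at *
  refine ⟨hC1, hx0, hd, hB, n0, n1, n2, n3, n4, n5, n6, n7, nw, hg', ediss, ?_, ?_, ?_, ?_, ?_, ?_,
    ?_, ?_, ?_, ?_⟩
  · refine le_mul_of_mul_le hg hCγ (by positivity)
      ((by ring : _ = x * |p.γ| * u ^ 2).trans_le (e1.trans ?_))
    linarith [m hA1 (by positivity : 0 ≤ x * B),
      m h4A (by positivity : 0 ≤ x * B),
      m h4A hB,
      m hA1 (by positivity : 0 ≤ x * (d * (h * u))),
      m hAγ (by positivity : 0 ≤ x * (h * h)),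
      m h41 (by positivity : 0 ≤ x * (x * (h * v))),
      m h4A (by positivity : 0 ≤ x * (h * z)),
      m h4A (by positivity : 0 ≤ x * (h * f)),
      (by positivity : 0 ≤ A * (x * B)),
      (by positivity : 0 ≤ A * (B)),
      (by positivity : 0 ≤ A * (x * (d * (h * u)))),
      (by positivity : 0 ≤ A * (x * (h * h))),
      (by positivity : 0 ≤ A * (x * (x * (h * v)))),
      (by positivity : 0 ≤ A * (x * (h * z))),
      (by positivity : 0 ≤ A * (x * (h * f)))]
  · refine le_mul_of_mul_le (by positivity) hC1' (by positivity)
      ((mul_assoc _ _ _).symm.trans_le (e0.trans ?_))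
    linarith [m hA1 hB,
      m hAγ (by positivity : 0 ≤ h * v),
      m hA1 (by positivity : 0 ≤ x * (u * u)),
      m hA1 (by positivity : 0 ≤ g),
      (by positivity : 0 ≤ A * (B)),
      (by positivity : 0 ≤ A * (h * v)),
      (by positivity : 0 ≤ A * (x * (u * u))),
      (by positivity : 0 ≤ A * (g))]
  · refine le_mul_of_mul_le one_pos hCk (by positivity) ((one_mul _).trans_le (ew.trans ?_))
    linarith [m hA1 hB,
      m hA1 (by positivity : 0 ≤ x * (u * w)),
      m h2A (by positivity : 0 ≤ x * (v * z)),
      m h3A (by positivity : 0 ≤ x * (v * f)),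
      m h11 (by positivity : 0 ≤ v * v),
      (by positivity : 0 ≤ A * (B)),
      (by positivity : 0 ≤ A * (x * (u * w))),
      (by positivity : 0 ≤ A * (x * (v * z))),
      (by positivity : 0 ≤ A * (x * (v * f))),
      (by positivity : 0 ≤ A * (v * v))]
  · refine le_mul_of_mul_le hg hCγ (by positivity) (eg.trans ?_)
    linarith [m hA1 hB,
      m h4A hB,
      m hA1 (by positivity : 0 ≤ d * (h * w)),
      m h42 (by positivity : 0 ≤ x * (h * z)),
      m h43 (by positivity : 0 ≤ x * (h * f)),
      m h11 (by positivity : 0 ≤ h * v),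
      (by positivity : 0 ≤ A * (B)),
      (by positivity : 0 ≤ A * (d * (h * w))),
      (by positivity : 0 ≤ A * (x * (h * z))),
      (by positivity : 0 ≤ A * (x * (h * f))),
      (by positivity : 0 ≤ A * (h * v))]
  · refine le_mul_of_mul_le hχ' hCχ (by positivity)
      ((mul_assoc _ _ _).symm.trans_le (ec.trans ?_))
    linarith [m h3A hB,
      m h2A hB,
      m h31 (by positivity : 0 ≤ v * f),
      m h21 (by positivity : 0 ≤ z * v),
      (by positivity : 0 ≤ A * (B)),
      (by positivity : 0 ≤ A * (v * f)),
      (by positivity : 0 ≤ A * (z * v))]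
  · rw [← sub_le_iff_le_add']
    refine le_mul_of_mul_le one_pos hCk (by positivity) ((one_mul _).trans_le
      ((sub_le_sub_right e3 _).trans ?_))
    linarith [m hA1 hB,
      m hA1 (by positivity : 0 ≤ x * (u * y)),
      m h2A (by positivity : 0 ≤ x * (v * z)),
      m h1A (by positivity : 0 ≤ v * v),
      (by positivity : 0 ≤ A * (B)),
      (by positivity : 0 ≤ A * (x * (u * y))),
      (by positivity : 0 ≤ A * (x * (v * z))),
      (by positivity : 0 ≤ A * (v * v))]
  · rw [← sub_le_iff_le_add']
    refine le_mul_of_mul_le one_pos hCk (by positivity) ((one_mul _).trans_le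
      ((sub_le_sub_right e5 _).trans ?_))
    linarith [m hA1 hB,
      m hA1 (by positivity : 0 ≤ x * (u * t)),
      m h3A (by positivity : 0 ≤ x * (v * f)),
      m h1A (by positivity : 0 ≤ v * v),
      (by positivity : 0 ≤ A * (B)),
      (by positivity : 0 ≤ A * (x * (u * t))),
      (by positivity : 0 ≤ A * (x * (v * f))),
      (by positivity : 0 ≤ A * (v * v))]
  · refine le_mul_of_mul_le (by positivity) hC2 (by positivity)
      ((mul_assoc _ _ _).symm.trans_le (e2.trans ?_))
    linarith [m hA1 hB,
      m h1A (by positivity : 0 ≤ v * z),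
      m hA1 (by positivity : 0 ≤ x * (y * y)),
      (by positivity : 0 ≤ A * (B)),
      (by positivity : 0 ≤ A * (v * z)),
      (by positivity : 0 ≤ A * (x * (y * y)))]
  · refine le_mul_of_mul_le (by positivity) hC3 (by positivity)
      ((mul_assoc _ _ _).symm.trans_le (e4.trans ?_))
    linarith [m hA1 hB,
      m h1A (by positivity : 0 ≤ v * f),
      m hA1 (by positivity : 0 ≤ x * (t * t)),
      (by positivity : 0 ≤ A * (B)),
      (by positivity : 0 ≤ A * (v * f)),
      (by positivity : 0 ≤ A * (x * (t * t)))]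
  · refine le_mul_of_mul_le (by positivity) hC4 (by positivity)
      ((mul_assoc _ _ _).symm.trans_le (e6.trans ?_))
    linarith [m hA1 hB,
      m hA1 (by positivity : 0 ≤ d * (h * s)),
      m hAγ (by positivity : 0 ≤ u * s),
      m hA1 (by positivity : 0 ≤ x * (h * h)),
      (by positivity : 0 ≤ A * (B)),
      (by positivity : 0 ≤ A * (d * (h * s))),
      (by positivity : 0 ≤ A * (u * s)),
      (by positivity : 0 ≤ A * (x * (h * h)))]

end BeamGram

end BeamBounds

/-! ### Absorption in quadratic systems. -/

section ScalarEstimates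

/-- For small K the term K p² is absorbed on the left. The quadratic systems are all reduced to this
form. -/
theorem le_of_sq_le_mul_sq_add_one {p K η : ℝ} (hη : 0 ≤ η) (hη1 : η ≤ 1)
    (hK : 2 * K ≤ η ^ 2) (h : p ^ 2 ≤ K * (1 + p ^ 2)) : p ≤ η := by
  have h2 : p ^ 2 ≤ η ^ 2 := by
    have k1 : K * (1 + p ^ 2) ≤ η ^ 2 / 2 * (1 + p ^ 2) := by gcongr; linarith
    have k2 : η ^ 2 * p ^ 2 ≤ 1 * p ^ 2 := by gcongr; exact pow_le_one₀ hη hη1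
    linarith
  exact (abs_le_of_sq_le_sq' h2 hη).2

/-- A closed system of quadratic inequalities, as it arises at low frequencies. -/
theorem le_of_quadratic_system_low {C η p q r ε : ℝ} (hC : 1 ≤ C) (hη : 0 < η) (hη1 : η ≤ 1)
    (hε : 0 < ε) (hεη : 4000 * C ^ 5 * ε ≤ η ^ 4) (hp : 0 ≤ p)
    (h1 : q ^ 2 ≤ C * ε ^ 2 * (4 + q + p))
    (h2 : p ^ 2 ≤ C * (ε ^ 2 + q ^ 2 + q * r + q + ε ^ 2 * p))
    (h3 : r ^ 2 ≤ C * (ε ^ 2 + q * r + p ^ 2 + p)) : p ≤ η ∧ q ≤ η ∧ r ≤ η := by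
  have hC0 : 0 < C := by linarith
  have c1 : C ≤ C ^ 2 := le_self_pow₀ hC (by norm_num)
  have c2 : C ^ 2 ≤ C ^ 3 := pow_le_pow_right₀ hC (by norm_num)
  have c3 : C ^ 3 ≤ C ^ 5 := pow_le_pow_right₀ hC (by norm_num)
  have c4 : C ≤ C ^ 5 := le_self_pow₀ hC (by norm_num)
  have hη4 : η ^ 4 ≤ 1 := pow_le_one₀ hη.le hη1
  have ε5 : C ^ 5 * ε ≤ 1 / 4000 := by linarith
  have ε3 : C ^ 3 * ε ≤ 1 / 4000 := (mul_le_mul_of_nonneg_right c3 hε.le).trans ε5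
  have εC : C * ε ≤ 1 / 4000 := (mul_le_mul_of_nonneg_right c4 hε.le).trans ε5
  have ε1 : ε ≤ 1 / 4000 := (le_mul_of_one_le_left hε.le hC).trans εC
  have εε : ε ^ 2 ≤ ε := by rw [sq]; exact mul_le_of_le_one_left hε.le (by linarith)
  have hM : 0 ≤ 1 + p ^ 2 := by positivity
  have hpM : p ≤ (1 + p ^ 2) / 2 := by nlinarith [sq_nonneg (p - 1)]
  have hCε : C * ε ^ 2 ≤ 1 / 4000 := (mul_le_mul_of_nonneg_left εε hC0.le).trans εC
  -- All quantities are measured against 1 + p²: q² is O(ε²) and r² is O(1) times it. The products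
  -- containing q are then O(ε), and p² ≤ O(ε)(1 + p²) closes.
  have s1 : q ^ 2 ≤ 7 * (C * ε ^ 2) * (1 + p ^ 2) := by
    have : q ≤ (1 + q ^ 2) / 2 := by nlinarith [sq_nonneg (q - 1)]
    have k : C * ε ^ 2 * (4 + q + p) ≤ C * ε ^ 2 * (5 * (1 + p ^ 2) + q ^ 2 / 2) := by
      refine mul_le_mul_of_nonneg_left ?_ (by positivity)
      linarith [sq_nonneg p]
    have k2 : C * ε ^ 2 * q ^ 2 ≤ 1 / 4000 * q ^ 2 := by gcongr
    linarith [mul_nonneg (by positivity : 0 ≤ C * ε ^ 2) hM]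
  have s2' : r ^ 2 ≤ 2 * C * (ε ^ 2 + p ^ 2 + p) + C ^ 2 * q ^ 2 := by
    linarith [sq_nonneg (r - C * q)]
  have s2 : r ^ 2 ≤ 7 * C ^ 2 * (1 + p ^ 2) := by
    have k1 : C ^ 2 * q ^ 2 ≤ C ^ 2 * (7 * (1 / 4000) * (1 + p ^ 2)) := by
      refine mul_le_mul_of_nonneg_left (s1.trans ?_) (by positivity)
      gcongr
    have k2 : 2 * C * (ε ^ 2 + p ^ 2 + p) ≤ 2 * C ^ 2 * (2 * (1 + p ^ 2)) := by
      have : ε ^ 2 + p ^ 2 + p ≤ 2 * (1 + p ^ 2) := by linarith [sq_nonneg p]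
      gcongr
    linarith [mul_nonneg (sq_nonneg C) hM]
  -- Weighted inequality 2ε q r ≤ q² + ε² r², balanced for q of size ε and r of size 1.
  have s3 : q * r ≤ 7 * C ^ 2 * ε * (1 + p ^ 2) := by
    have k : ε * (q * r) ≤ ε * (7 * C ^ 2 * ε * (1 + p ^ 2)) := by
      have k2 : (C * ε ^ 2) * (1 + p ^ 2) ≤ (C ^ 2 * ε ^ 2) * (1 + p ^ 2) := by gcongr
      linarith [sq_nonneg (q - ε * r), mul_le_mul_of_nonneg_left s2 (sq_nonneg ε)]
    exact le_of_mul_le_mul_left k hε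
  have s4 : q ≤ 4 * C * ε * (1 + p ^ 2) := by
    have k : ε * q ≤ ε * (4 * C * ε * (1 + p ^ 2)) := by
      have k2 : ε ^ 2 * 1 ≤ C * ε ^ 2 * (1 + p ^ 2) := by
        rw [mul_comm C, mul_assoc]
        refine mul_le_mul_of_nonneg_left ?_ (by positivity)
        exact one_le_mul_of_one_le_of_one_le hC (by linarith [sq_nonneg p])
      linarith [sq_nonneg (q - ε)]
    exact le_of_mul_le_mul_left k hε
  have s5 : p ^ 2 ≤ (20 * C ^ 3 * ε) * (1 + p ^ 2) := by
    have k : ε ^ 2 + q ^ 2 + q * r + q + ε ^ 2 * p ≤ 20 * C ^ 2 * ε * (1 + p ^ 2) := by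
      have k1 : ε * (1 + p ^ 2) ≤ C ^ 2 * ε * (1 + p ^ 2) := by
        have : 1 ≤ C ^ 2 := hC.trans c1
        gcongr
        exact le_mul_of_one_le_left hε.le this
      have k2 : C * ε * (1 + p ^ 2) ≤ C ^ 2 * ε * (1 + p ^ 2) := by gcongr
      have k3 : C * ε ^ 2 * (1 + p ^ 2) ≤ C * ε * (1 + p ^ 2) := by gcongr
      have k4 : ε ^ 2 * (1 + p) ≤ ε * (2 * (1 + p ^ 2)) :=
        mul_le_mul εε (by linarith [sq_nonneg p]) (by linarith) hε.le
      linarith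
    calc p ^ 2 ≤ _ := h2
      _ ≤ C * (20 * C ^ 2 * ε * (1 + p ^ 2)) := by gcongr
      _ = _ := by ring
  have hη2 : η ^ 2 ≤ η := by rw [sq]; exact mul_le_of_le_one_left hη.le hη1
  have hη' : η ^ 2 / (10 * C) ≤ η := (div_le_self (sq_nonneg η) (by linarith)).trans hη2
  have p1 : p ≤ η ^ 2 / (10 * C) := by
    refine le_of_sq_le_mul_sq_add_one (by positivity) (hη'.trans hη1) ?_ s5
    rw [div_pow, le_div_iff₀ (by positivity)]
    linarith
  have p1' : 10 * C * p ≤ η ^ 2 := by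
    rwa [le_div_iff₀ (by positivity), mul_comm] at p1
  have p2 : p ≤ η := p1.trans hη'
  have p3 : p ^ 2 ≤ p := by rw [sq]; exact mul_le_of_le_one_left hp (p2.trans hη1)
  have η42 : η ^ 4 ≤ η ^ 2 := pow_le_pow_of_le_one hη.le hη1 (by norm_num)
  have ε5' : C ^ 5 * ε ≤ η ^ 2 / 4000 := by linarith
  have εC' : C * ε ≤ η ^ 2 / 4000 := (mul_le_mul_of_nonneg_right c4 hε.le).trans ε5'
  have ε3' : C ^ 3 * ε ≤ η ^ 2 / 4000 := (mul_le_mul_of_nonneg_right c3 hε.le).trans ε5'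
  have qq : q ^ 2 ≤ 14 * (C * ε ^ 2) := by
    have : C * ε ^ 2 * p ^ 2 ≤ C * ε ^ 2 * 1 := by gcongr; linarith
    linarith
  have hCεε : C * ε ^ 2 ≤ C * ε := by gcongr
  refine ⟨p2, (abs_le_of_sq_le_sq' (by linarith [sq_nonneg η]) hη.le).2, (abs_le_of_sq_le_sq' ?_ hη.le).2⟩
  have k1 : C ^ 2 * q ^ 2 ≤ C ^ 2 * (14 * (C * ε ^ 2)) := by gcongr
  have k2 : C ^ 3 * ε ^ 2 ≤ C ^ 3 * ε := by gcongr
  have k3 : C * p ^ 2 ≤ C * p := by gcongr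
  linarith [sq_nonneg η]

/-- A closed system of quadratic inequalities, as it arises at high frequencies. -/
theorem le_of_quadratic_system_high {C η p q r s ε : ℝ} (hC : 1 ≤ C) (hη : 0 < η) (hη1 : η ≤ 1)
    (hε : 0 < ε) (hεη : 4000 * C ^ 4 * ε ≤ η ^ 2) (hp : 0 ≤ p) (hq : 0 ≤ q)
    (h1 : q ^ 2 ≤ C * ε ^ 2 * (3 + q + s + p))
    (h2 : s ^ 2 ≤ C * (ε ^ 2 + p * s + ε ^ 2 * s + q ^ 2))
    (h3 : r ^ 2 ≤ C * (ε ^ 2 + p ^ 2 + r * q + r))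
    (h4 : p ^ 2 ≤ C * (ε ^ 2 + q ^ 2 + q + r * q + ε ^ 2 * p)) : p ≤ η ∧ q ≤ η := by
  have hC0 : 0 < C := by linarith
  have c1 : C ≤ C ^ 2 := le_self_pow₀ hC (by norm_num)
  have c2 : C ^ 2 ≤ C ^ 3 := pow_le_pow_right₀ hC (by norm_num)
  have c3 : C ^ 3 ≤ C ^ 4 := pow_le_pow_right₀ hC (by norm_num)
  have hη2 : η ^ 2 ≤ 1 := pow_le_one₀ hη.le hη1
  have ε4 : C ^ 4 * ε ≤ 1 / 4000 := by linarith
  have ε3 : C ^ 3 * ε ≤ 1 / 4000 := (mul_le_mul_of_nonneg_right c3 hε.le).trans ε4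
  have ε2 : C ^ 2 * ε ≤ 1 / 4000 := (mul_le_mul_of_nonneg_right c2 hε.le).trans ε3
  have εC : C * ε ≤ 1 / 4000 := (mul_le_mul_of_nonneg_right c1 hε.le).trans ε2
  have ε1 : ε ≤ 1 / 4000 := (le_mul_of_one_le_left hε.le hC).trans εC
  have εε : ε ^ 2 ≤ ε := by rw [sq]; exact mul_le_of_le_one_left hε.le (by linarith)
  have hM : 0 ≤ 1 + p ^ 2 := by positivity
  have P0 : 0 ≤ C ^ 4 * ε := by positivity
  have P1 : 0 ≤ C ^ 3 * ε ^ 2 * (1 + p ^ 2) := by positivity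
  have hM1 : 1 ≤ 1 + p ^ 2 := by nlinarith [sq_nonneg p]
  have hpM : p ≤ (1 + p ^ 2) / 2 := by nlinarith [sq_nonneg (p - 1)]
  have s0 : s ^ 2 ≤ 2 * C * q ^ 2 + 4 * C ^ 2 * (1 + p ^ 2) := by
    have k1 : s ^ 2 ≤ 2 * C * (ε ^ 2 + q ^ 2) + C ^ 2 * (p + ε ^ 2) ^ 2 := by
      linarith [sq_nonneg (s - C * (p + ε ^ 2))]
    have k2 : (p + ε ^ 2) ^ 2 ≤ 2 * (1 + p ^ 2) := by
      have : (ε ^ 2) ^ 2 ≤ 1 := pow_le_one₀ (by positivity) (by linarith)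
      linarith [sq_nonneg (p - ε ^ 2)]
    have k3 : C ^ 2 * (p + ε ^ 2) ^ 2 ≤ C ^ 2 * (2 * (1 + p ^ 2)) := by gcongr
    have k4 : 2 * C * ε ^ 2 ≤ 2 * C ^ 2 * (1 + p ^ 2) := by gcongr; linarith
    linarith
  have s1 : q ^ 2 ≤ 14 * (C ^ 3 * ε ^ 2) * (1 + p ^ 2) := by
    have : q ≤ (1 + q ^ 2) / 2 := by nlinarith [sq_nonneg (q - 1)]
    have : s ≤ (1 + s ^ 2) / 2 := by nlinarith [sq_nonneg (s - 1)]
    have k : C * ε ^ 2 * (3 + q + s + p) ≤ C * ε ^ 2 * (7 * C ^ 2 * (1 + p ^ 2) + 2 * C * q ^ 2) := by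
      have : 1 * (1 + p ^ 2) ≤ C ^ 2 * (1 + p ^ 2) := by gcongr; linarith
      have : 1 * q ^ 2 ≤ C * q ^ 2 := by gcongr
      refine mul_le_mul_of_nonneg_left ?_ (by positivity)
      linarith
    have k2 : (C ^ 2 * ε) * ε * q ^ 2 ≤ 1 / 4000 * 1 * q ^ 2 := by gcongr; linarith
    linarith [mul_nonneg (by positivity : 0 ≤ C ^ 3 * ε ^ 2) hM]
  have s2 : r ^ 2 ≤ 5 * C ^ 2 * (1 + p ^ 2) := by
    have k0 : r ^ 2 ≤ 2 * C * (ε ^ 2 + p ^ 2) + C ^ 2 * (q + 1) ^ 2 := by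
      linarith [sq_nonneg (r - C * (q + 1))]
    have k1 : (q + 1) ^ 2 ≤ 2 * q ^ 2 + 2 := by nlinarith [sq_nonneg (q - 1)]
    have k2 : C ^ 3 * ε ^ 2 * (1 + p ^ 2) ≤ 1 / 4000 * (1 + p ^ 2) := by
      gcongr
      exact (mul_le_mul_of_nonneg_left εε (by positivity)).trans ε3
    have k3 : C ^ 2 * (q + 1) ^ 2 ≤ C ^ 2 * (3 * (1 + p ^ 2)) :=
      mul_le_mul_of_nonneg_left (by linarith) (by positivity)
    have k4 : 2 * C * (ε ^ 2 + p ^ 2) ≤ 2 * C ^ 2 * (1 + p ^ 2) := by gcongr; linarith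
    linarith
  have s3 : r * q ≤ 10 * C ^ 3 * ε * (1 + p ^ 2) := by
    have k : ε * (r * q) ≤ ε * (10 * C ^ 3 * ε * (1 + p ^ 2)) := by
      have k2 : (C ^ 2 * ε ^ 2) * (1 + p ^ 2) ≤ (C ^ 3 * ε ^ 2) * (1 + p ^ 2) := by gcongr
      linarith [sq_nonneg (q - ε * r), mul_le_mul_of_nonneg_left s2 (sq_nonneg ε), P1]
    exact le_of_mul_le_mul_left k hε
  have c13 : 1 ≤ C ^ 3 := one_le_pow₀ hC
  have s4 : q ≤ 8 * C ^ 3 * ε * (1 + p ^ 2) := by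
    have k : ε * q ≤ ε * (8 * C ^ 3 * ε * (1 + p ^ 2)) := by
      have k2 : 1 * ε ^ 2 * 1 ≤ C ^ 3 * ε ^ 2 * (1 + p ^ 2) := by gcongr
      linarith [sq_nonneg (q - ε), P1]
    exact le_of_mul_le_mul_left k hε
  have s5 : p ^ 2 ≤ (40 * C ^ 4 * ε) * (1 + p ^ 2) := by
    have k : ε ^ 2 + q ^ 2 + q + r * q + ε ^ 2 * p ≤ 40 * C ^ 3 * ε * (1 + p ^ 2) := by
      have k1 : 1 * ε * (1 + p ^ 2) ≤ C ^ 3 * ε * (1 + p ^ 2) := by gcongr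
      have k3 : C ^ 3 * ε ^ 2 * (1 + p ^ 2) ≤ C ^ 3 * ε * (1 + p ^ 2) := by gcongr
      have k4 : ε ^ 2 * (1 + p) ≤ ε * (2 * (1 + p ^ 2)) :=
        mul_le_mul εε (by linarith [sq_nonneg p]) (by linarith) hε.le
      linarith
    calc p ^ 2 ≤ _ := h4
      _ ≤ C * (40 * C ^ 3 * ε * (1 + p ^ 2)) := by gcongr
      _ = _ := by ring
  have p1 : p ≤ η := le_of_sq_le_mul_sq_add_one hη.le hη1 (by linarith) s5
  refine ⟨p1, (abs_le_of_sq_le_sq' ?_ hη.le).2⟩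
  have k : C ^ 3 * ε ^ 2 * (1 + p ^ 2) ≤ C ^ 3 * ε * 2 := by
    have : p ^ 2 ≤ 1 := pow_le_one₀ hp (p1.trans hη1)
    gcongr
    linarith
  have k2 : C ^ 3 * ε ≤ C ^ 4 * ε := by gcongr
  linarith

end ScalarEstimates

/-! ### Angle coupling at low frequencies. -/

section RegimeEstimates

theorem le_one_of_sum_sq_eq_one {v u z y f t s h : ℝ}
    (hsum : v ^ 2 + u ^ 2 + z ^ 2 + y ^ 2 + f ^ 2 + t ^ 2 + s ^ 2 + h ^ 2 = 1) :
    v ≤ 1 ∧ u ≤ 1 ∧ z ≤ 1 ∧ y ≤ 1 ∧ f ≤ 1 ∧ t ≤ 1 ∧ s ≤ 1 ∧ h ≤ 1 := by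
  have le1 {a : ℝ} (ha : a ^ 2 ≤ 1) : a ≤ 1 := (abs_le_of_sq_le_sq' (by simpa using ha) one_pos.le).2
  have sv := sq_nonneg v
  have su := sq_nonneg u
  have sz := sq_nonneg z
  have sy := sq_nonneg y
  have sf := sq_nonneg f
  have st := sq_nonneg t
  have ss := sq_nonneg s
  have sh := sq_nonneg h
  refine ⟨le1 ?_, le1 ?_, le1 ?_, le1 ?_, le1 ?_, le1 ?_, le1 ?_, le1 ?_⟩ <;> linarith

namespace AngleBounds

variable {C κ d x B v u z y f t s h : ℝ}

/-- End of the contradiction argument. The bounds for z, s, f, u have x on the left, so smallness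
relative to x of the linear terms is needed as well as absolute smallness. The total is at most 4η +
16Cη, which explains the 21. -/
theorem sum_sq_lt_one (hb : AngleBounds C κ d x B v u z y f t s h) {η : ℝ} (hη : 0 < η)
    (hη1 : 21 * C * η ≤ 1)
    (hu1 : u ≤ 1) (hz1 : z ≤ 1) (hf1 : f ≤ 1) (hs1 : s ≤ 1)
    (hv : v ≤ η) (hy : y ≤ η) (ht : t ≤ η) (hh : h ≤ η) (hvx : v ≤ η * x) (hyx : y ≤ η * x)
    (htx : t ≤ η * x) (hhx : h ≤ η * x) (hdx : d * h ≤ η * x) (hBx : B ≤ η * x) :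
    v ^ 2 + u ^ 2 + z ^ 2 + y ^ 2 + f ^ 2 + t ^ 2 + s ^ 2 + h ^ 2 < 1 := by
  obtain ⟨hC, -, hx, hd, hB, v0, u0, z0, y0, f0, t0, s0, h0, -, -, -, -, hz', hs', hf', hu'⟩ := hb
  have hC0 : 0 < C := by linarith
  have hηη : η ≤ 1 := by nlinarith
  have sq_le {a : ℝ} (ha : 0 ≤ a) (h : a ≤ η) : a ^ 2 ≤ η := by nlinarith
  have vv := sq_le v0 hv
  have yy := sq_le y0 hy
  have tt := sq_le t0 ht
  have hhh := sq_le h0 hh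
  have mul1 {a b : ℝ} (ha : a ≤ η * x) (hb0 : 0 ≤ b) (hb : b ≤ 1) : a * b ≤ η * x :=
    (mul_le_mul_of_nonneg_right ha hb0).trans (mul_le_of_le_one_right (by positivity) hb)
  have fin {T S : ℝ} {n : ℝ} (h : x * T ≤ C * S) (hS : S ≤ n * (η * x)) : T ≤ C * (n * η) := by
    have : x * T ≤ x * (C * (n * η)) :=
      h.trans ((mul_le_mul_of_nonneg_left hS hC0.le).trans_eq (by ring))
    exact le_of_mul_le_mul_left this hx
  have zz : z ^ 2 ≤ C * (4 * η) := fin hz' (by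
    linarith [mul1 hvx z0 hz1, mul1 hhx z0 hz1, mul_le_mul_of_nonneg_left yy hx.le])
  have ss : s ^ 2 ≤ C * (4 * η) := fin hs' (by
    linarith [mul1 hdx s0 hs1, mul1 hyx s0 hs1, mul_le_mul_of_nonneg_left hhh hx.le])
  have ff : f ^ 2 ≤ C * (4 * η) := fin hf' (by
    linarith [mul1 hvx f0 hf1, mul_le_mul_of_nonneg_left tt hx.le, mul_pos hη hx])
  have uu : u ^ 2 ≤ C * (4 * η) := fin hu' (by
    linarith [mul1 hyx u0 hu1, mul1 htx u0 hu1, mul_le_mul_of_nonneg_left vv hx.le])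
  have : η ≤ C * η := le_mul_of_one_le_left hη.le hC
  have : 0 < C * η := by positivity
  linarith

/-- If B is much smaller than d x², then h is much smaller than x by dissipation. The quotients p =
v/x, q = y/x, r = t/x satisfy the low-frequency system with constants free of x. -/
theorem exists_le_low (C D : ℝ) (hC : 1 ≤ C) (hD : 0 ≤ D) : ∃ δ : ℝ, 0 < δ ∧
    ∀ d x B v u z y f t s h : ℝ, AngleBounds C 1 d x B v u z y f t s h → x ≤ 1 → 0 < d → d ≤ D →
      v ^ 2 + u ^ 2 + z ^ 2 + y ^ 2 + f ^ 2 + t ^ 2 + s ^ 2 + h ^ 2 = 1 →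
      δ * (d * x ^ 2) ≤ B := by
  -- Enlarged constant absorbing the factor d ≤ D in the term d h y.
  set A := C * (1 + D) with hA
  have hA1 : 1 ≤ A := by nlinarith
  have hCA : C ≤ A := by nlinarith
  have hA0 : 0 < A := by linarith
  set η := 1 / (21 * A) with hη
  have hη0 : 0 < η := by positivity
  have hηA : 21 * A * η = 1 := by rw [hη]; field_simp
  have hη1 : η ≤ 1 := by nlinarith
  set ε := η ^ 4 / (4000 * A ^ 5) with hε
  have hε0 : 0 < ε := by positivity
  have hεη : 4000 * A ^ 5 * ε ≤ η ^ 4 := by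
    apply le_of_eq; rw [hε]; field_simp
  have hη4 : η ^ 4 ≤ η := pow_le_of_le_one hη0.le hη1 (by norm_num)
  have hA5 : A ≤ A ^ 5 := le_self_pow₀ hA1 (by norm_num)
  have hAε : A * ε ≤ η / 4000 := by nlinarith
  have hεη' : ε ≤ η := by nlinarith
  have hε1 : ε ≤ 1 := hεη'.trans hη1
  have hε2 : ε ^ 2 ≤ ε := by nlinarith
  have hDA : D ≤ A := by nlinarith
  have hDε' : D * ε ^ 2 ≤ η := by
    have : D * ε ^ 2 ≤ A * ε := by gcongr
    linarith
  have hDε : ε ^ 2 * D ≤ 1 := by linarith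
  refine ⟨ε ^ 4, by positivity, fun d x B v u z y f t s h hb hx1 hd hdD hsum => ?_⟩
  by_contra! hB
  obtain ⟨hv1, hu1, hz1, -, hf1, -, hs1, -⟩ := le_one_of_sum_sq_eq_one hsum
  have hx := hb.hx
  have x2 : 0 < x ^ 2 := by positivity
  have hh : h ≤ ε ^ 2 * x := by
    refine (abs_le_of_sq_le_sq' ?_ (by positivity)).2
    have := hb.diss.trans hB.le
    refine le_of_mul_le_mul_left (this.trans_eq ?_) hd
    ring
  have hBx : B ≤ ε ^ 2 * x ^ 2 := by
    calc B ≤ ε ^ 4 * (d * x ^ 2) := hB.le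
      _ ≤ ε ^ 4 * (D * x ^ 2) := by gcongr
      _ = ε ^ 2 * x ^ 2 * (ε ^ 2 * D) := by ring
      _ ≤ ε ^ 2 * x ^ 2 := mul_le_of_le_one_right (by positivity) hDε
  have hb' := hb
  obtain ⟨-, -, -, -, hB0, v0, u0, z0, y0, f0, t0, s0, h0, -, y_le, v_le, t_le, -, -, -, -⟩ := hb'
  obtain ⟨p, hp⟩ : ∃ p, v = x * p := ⟨v / x, by field_simp⟩
  obtain ⟨q, hq⟩ : ∃ q, y = x * q := ⟨y / x, by field_simp⟩
  obtain ⟨r, hr⟩ : ∃ r, t = x * r := ⟨t / x, by field_simp⟩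
  have p0 : 0 ≤ p := by rw [hp] at v0; exact nonneg_of_mul_nonneg_right v0 hx
  have q0 : 0 ≤ q := by rw [hq] at y0; exact nonneg_of_mul_nonneg_right y0 hx
  have r0 : 0 ≤ r := by rw [hr] at t0; exact nonneg_of_mul_nonneg_right t0 hx
  have h2 : h ^ 2 ≤ ε ^ 2 * x ^ 2 := by
    calc h ^ 2 ≤ (ε ^ 2 * x) ^ 2 := by gcongr
      _ = ε ^ 2 * x ^ 2 * ε ^ 2 := by ring
      _ ≤ _ := mul_le_of_le_one_right (by positivity) (by linarith)
  have hv' : h * v ≤ ε ^ 2 * x ^ 2 * p := by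
    rw [hp]
    exact (mul_le_mul_of_nonneg_right hh (by positivity)).trans_eq (by ring)
  have up {T S : ℝ} (h : x ^ 2 * T ≤ C * (x ^ 2 * S)) (hS : 0 ≤ S) : T ≤ A * S := by
    have : x ^ 2 * T ≤ x ^ 2 * (A * S) := by
      have := mul_le_mul_of_nonneg_right hCA (by positivity : 0 ≤ x ^ 2 * S)
      linarith
    exact le_of_mul_le_mul_left this x2
  obtain ⟨h1, h2, h3⟩ := le_of_quadratic_system_low (C := A) (p := p) (q := q) (r := r) hA1 hη0 hη1
    hε0 hεη p0 (by
      have k1 : d * h * y ≤ D * (ε ^ 2 * x) * y := by gcongr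
      have k2 : x * h * z ≤ x * (ε ^ 2 * x) * 1 := by gcongr
      rw [hq] at k1 y_le
      have k3 : (x * q) ^ 2 ≤ C * (ε ^ 2 * x ^ 2 * (3 + D * q + p)) := by
        refine y_le.trans (mul_le_mul_of_nonneg_left ?_ (by linarith))
        linarith
      have k4 : 3 + D * q + p ≤ (1 + D) * (4 + q + p) := by linarith [mul_nonneg hD p0]
      have k5 : x ^ 2 * q ^ 2 ≤ x ^ 2 * (A * ε ^ 2 * (4 + q + p)) := by
        calc x ^ 2 * q ^ 2 = (x * q) ^ 2 := by ring
          _ ≤ _ := k3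
          _ ≤ C * (ε ^ 2 * x ^ 2 * ((1 + D) * (4 + q + p))) := by gcongr
          _ = _ := by rw [hA]; ring
      exact le_of_mul_le_mul_left k5 x2) (up (by
      have k1 : x * u * y ≤ x * 1 * y := by gcongr
      rw [hq] at k1
      rw [← mul_pow, ← hp]
      refine v_le.trans (mul_le_mul_of_nonneg_left ?_ (by linarith))
      rw [hq, hr]
      linarith) (by positivity)) (up (by
      have k1 : x * v * f ≤ x * v * 1 := by gcongr
      rw [hp] at k1
      rw [← mul_pow, ← hr]
      refine t_le.trans (mul_le_mul_of_nonneg_left ?_ (by linarith))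
      rw [hq, hr, hp]
      linarith) (by positivity))
  have key {a b : ℝ} (hab : a = x * b) (hb0 : 0 ≤ b) (hb : b ≤ η) : a ≤ η ∧ a ≤ η * x := by
    rw [hab]
    exact ⟨(mul_le_of_le_one_left hb0 hx1).trans hb, by rw [mul_comm]; gcongr⟩
  have hεx : ε ^ 2 * x ≤ η * x := by gcongr; exact hε2.trans hεη'
  have := hb.sum_sq_lt_one hη0 (by linarith [mul_le_mul_of_nonneg_right hCA hη0.le]) hu1 hz1 hf1 hs1 (key hp p0 h1).1 (key hq q0 h2).1
    (key hr r0 h3).1 (hh.trans (hεx.trans (mul_le_of_le_one_right hη0.le hx1)))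
    (key hp p0 h1).2 (key hq q0 h2).2 (key hr r0 h3).2
    (hh.trans hεx) (by
      calc d * h ≤ D * (ε ^ 2 * x) := by gcongr
        _ = D * ε ^ 2 * x := by ring
        _ ≤ η * x := by gcongr) (hBx.trans (by
      calc ε ^ 2 * x ^ 2 = ε ^ 2 * x * x := by ring
        _ ≤ η * x * 1 := by gcongr
        _ = _ := mul_one _))
  linarith

end AngleBounds

end RegimeEstimates

/-! ### Angle coupling at high frequencies. -/

section RegimeEstimatesHigh

namespace AngleBounds

/-- Without the cross terms no rescaling is needed: smallness passes from h to y to v to t, losing a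
square root at each link. Hence e, η₁, η₂, η, each a multiple of the square of the next. -/
theorem exists_le_high_of_eq (C c D : ℝ) (hC : 1 ≤ C) (hc : 0 < c) (hD : 0 < D) :
    ∃ δ : ℝ, 0 < δ ∧
    ∀ d x B v u z y f t s h : ℝ, AngleBounds C 0 d x B v u z y f t s h → 1 ≤ x → c ≤ d →
      d ≤ D * x ^ 2 →
      v ^ 2 + u ^ 2 + z ^ 2 + y ^ 2 + f ^ 2 + t ^ 2 + s ^ 2 + h ^ 2 = 1 →
      δ ≤ B * x ^ 2 := by
  have hC0 : 0 < C := by linarith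
  set η := 1 / (21 * C) with hη
  have hη0 : 0 < η := by positivity
  have hηC : 21 * C * η = 1 := by rw [hη]; field_simp
  have hη1 : η ≤ 1 := by nlinarith
  set η₂ := η ^ 2 / (4 * C) with hη₂
  have hη₂0 : 0 < η₂ := by positivity
  have hη₂C : C * (4 * η₂) = η ^ 2 := by rw [hη₂]; field_simp
  have hη2 : η ^ 2 ≤ η := by nlinarith
  have hη₂η : 4 * η₂ ≤ η := by nlinarith
  set η₁ := η₂ ^ 2 / (4 * C) with hη₁
  have hη₁0 : 0 < η₁ := by positivity
  have hη₁C : C * (4 * η₁) = η₂ ^ 2 := by rw [hη₁]; field_simp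
  have hη22 : η₂ ^ 2 ≤ η₂ := by nlinarith
  have hη₁η : 4 * η₁ ≤ η₂ := by nlinarith
  set e := η₁ ^ 2 / (5 * C) with he
  have he0 : 0 < e := by positivity
  have heC : C * (5 * e) = η₁ ^ 2 := by rw [he]; field_simp
  have hη₁2 : η₁ ^ 2 ≤ η₁ := by nlinarith
  have heη₁ : 5 * e ≤ η₁ := by nlinarith
  have he2 : e ^ 2 ≤ e := by nlinarith
  refine ⟨min (min (e ^ 2 * c) (e ^ 2 / D)) e, by positivity,
    fun d x B v u z y f t s h hb hx1 hcd hdD hsum => ?_⟩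
  by_contra! hB
  obtain ⟨hB', hB3⟩ := lt_min_iff.mp hB
  obtain ⟨hB1, hB2⟩ := lt_min_iff.mp hB'
  obtain ⟨hv1, hu1, hz1, hy1, hf1, ht1, hs1, hh1⟩ := le_one_of_sum_sq_eq_one hsum
  have hx := hb.hx
  have x2 : 0 < x ^ 2 := by positivity
  have x21 : 1 ≤ x ^ 2 := one_le_pow₀ hx1
  have hd : 0 < d := hc.trans_le hcd
  obtain ⟨-, -, -, -, hB0, v0, u0, z0, y0, f0, t0, s0, h0, diss, y_le, v_le, t_le, -, -, -, -⟩ :=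
    id hb
  simp only [zero_mul, add_zero] at v_le t_le
  have hBe : B ≤ e := (le_mul_of_one_le_right hB0 x21).trans hB3.le
  have hxh : x * h ≤ e := by
    refine (abs_le_of_sq_le_sq' ?_ he0.le).2
    have h1 : c * (x * h) ^ 2 ≤ c * e ^ 2 := by
      calc c * (x * h) ^ 2 = c * h ^ 2 * x ^ 2 := by ring
        _ ≤ d * h ^ 2 * x ^ 2 := by gcongr
        _ ≤ B * x ^ 2 := by gcongr
        _ ≤ _ := hB1.le.trans_eq (by ring)
    exact le_of_mul_le_mul_left h1 hc
  -- The damping may grow like x², so d h is controlled through (d h)² = d · d h² ≤ D x² B; this and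
  -- x h explain the weight x² on B.
  have hdh : d * h ≤ e := by
    refine (abs_le_of_sq_le_sq' ?_ he0.le).2
    calc (d * h) ^ 2 = d * (d * h ^ 2) := by ring
      _ ≤ (D * x ^ 2) * B := by gcongr
      _ = D * (B * x ^ 2) := by ring
      _ ≤ D * (e ^ 2 / D) := by gcongr
      _ = e ^ 2 := by field_simp
  have hhe : h ≤ e := (le_mul_of_one_le_left h0 hx1).trans hxh
  have mul1 {a b r : ℝ} (ha : a ≤ r) (hr : 0 ≤ r) (hb0 : 0 ≤ b) (hb : b ≤ 1) : a * b ≤ r :=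
    (mul_le_mul_of_nonneg_right ha hb0).trans (mul_le_of_le_one_right hr hb)
  have hh2 : h ^ 2 ≤ e := by rw [sq]; exact mul1 hhe he0.le h0 hh1
  have yη₁ : y ≤ η₁ := by
    refine (abs_le_of_sq_le_sq' (y_le.trans ?_) hη₁0.le).2
    rw [← heC]
    refine mul_le_mul_of_nonneg_left ?_ hC0.le
    linarith [mul1 hdh he0.le y0 hy1, mul1 hxh he0.le z0 hz1, mul1 hhe he0.le v0 hv1]
  have yy : y ^ 2 ≤ η₁ := by rw [sq]; exact mul1 yη₁ hη₁0.le y0 hy1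
  have vη : v ≤ η₂ := by
    refine (abs_le_of_sq_le_sq' (v_le.trans ?_) hη₂0.le).2
    rw [← hη₁C]
    refine mul_le_mul_of_nonneg_left ?_ hC0.le
    linarith [mul1 yη₁ hη₁0.le t0 ht1, mul_comm v h, mul1 hhe he0.le v0 hv1]
  have vv : v ^ 2 ≤ η₂ := by rw [sq]; exact mul1 vη hη₂0.le v0 hv1
  have tη : t ≤ η := by
    refine (abs_le_of_sq_le_sq' (t_le.trans ?_) hη0.le).2
    rw [← hη₂C]
    refine mul_le_mul_of_nonneg_left ?_ hC0.le
    linarith [mul1 yη₁ hη₁0.le t0 ht1]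
  have k {a : ℝ} (ha : a ≤ η) : a ≤ η * x := ha.trans (le_mul_of_one_le_right hη0.le hx1)
  have v3 : v ≤ η := by linarith
  have y3 : y ≤ η := by linarith
  have h3 : h ≤ η := by linarith
  have := hb.sum_sq_lt_one hη0 hηC.le hu1 hz1 hf1 hs1 v3 y3 tη h3 (k v3) (k y3) (k tη) (k h3)
    (k (by linarith)) (k (by linarith))
  linarith

/-- The cross terms x u y and x v f force y and v to be small relative to powers of 1/x. With p = x
v, q = x² y, r = x u, s = x² z the system is free of x as soon as x³ h, x² d h and x⁴ B are small,
which a bound on x⁶ B provides. -/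
theorem exists_le_high (C c D : ℝ) (hC : 1 ≤ C) (hc : 0 < c) (hD : 0 < D) :
    ∃ δ : ℝ, 0 < δ ∧
    ∀ d x B v u z y f t s h : ℝ, AngleBounds C 1 d x B v u z y f t s h → 1 ≤ x → c ≤ d →
      d ≤ D * x ^ 2 →
      v ^ 2 + u ^ 2 + z ^ 2 + y ^ 2 + f ^ 2 + t ^ 2 + s ^ 2 + h ^ 2 = 1 →
      δ ≤ B * x ^ 6 := by
  have hC0 : 0 < C := by linarith
  set η := 1 / (21 * C) with hη
  have hη0 : 0 < η := by positivity
  have hηC : 21 * C * η = 1 := by rw [hη]; field_simp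
  have hη1 : η ≤ 1 := by nlinarith
  set η₂ := η ^ 2 / (4 * C) with hη₂
  have hη₂0 : 0 < η₂ := by positivity
  have hη₂C : C * (4 * η₂) = η ^ 2 := by rw [hη₂]; field_simp
  have hη2 : η ^ 2 ≤ η := by nlinarith
  have hη₂η : 4 * η₂ ≤ η := by nlinarith
  have hη₂1 : η₂ ≤ 1 := by linarith
  set ε := η₂ ^ 2 / (4000 * C ^ 4) with hε
  have hε0 : 0 < ε := by positivity
  have hεη : 4000 * C ^ 4 * ε ≤ η₂ ^ 2 := by
    apply le_of_eq; rw [hε]; field_simp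
  have hη22 : η₂ ^ 2 ≤ η₂ := by nlinarith
  have hC4 : 1 ≤ C ^ 4 := one_le_pow₀ hC
  have hεη₂ : ε ≤ η₂ := by nlinarith
  have hε1 : ε ≤ 1 := by linarith
  have hε2 : ε ^ 2 ≤ ε := by nlinarith
  refine ⟨min (min (ε ^ 4 * c) (ε ^ 4 / D)) (ε ^ 2), by positivity,
    fun d x B v u z y f t s h hb hx1 hcd hdD hsum => ?_⟩
  by_contra! hB
  obtain ⟨hB', hB3⟩ := lt_min_iff.mp hB
  obtain ⟨hB1, hB2⟩ := lt_min_iff.mp hB'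
  obtain ⟨hv1, hu1, hz1, hy1, hf1, ht1, hs1, hh1⟩ := le_one_of_sum_sq_eq_one hsum
  have hx := hb.hx
  have x2 : 0 < x ^ 2 := by positivity
  have hd : 0 < d := hc.trans_le hcd
  obtain ⟨-, -, -, -, hB0, v0, u0, z0, y0, f0, t0, s0, h0, diss, y_le, v_le, t_le, z_le, -, -,
    u_le⟩ := id hb
  rw [one_mul] at v_le t_le
  have xle {m n : ℕ} (hmn : m ≤ n) : x ^ m ≤ x ^ n := pow_le_pow_right₀ hx1 hmn
  have hBe : B * x ^ 4 ≤ ε ^ 2 := (mul_le_mul_of_nonneg_left (xle (by norm_num)) hB0).trans hB3.le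
  have hxh : x ^ 3 * h ≤ ε ^ 2 := by
    refine (abs_le_of_sq_le_sq' ?_ (by positivity)).2
    have h1 : c * (x ^ 3 * h) ^ 2 ≤ c * (ε ^ 2) ^ 2 := by
      calc c * (x ^ 3 * h) ^ 2 = c * h ^ 2 * x ^ 6 := by ring
        _ ≤ d * h ^ 2 * x ^ 6 := by gcongr
        _ ≤ B * x ^ 6 := by gcongr
        _ ≤ _ := hB1.le.trans_eq (by ring)
    exact le_of_mul_le_mul_left h1 hc
  have hdh : d * h * x ^ 2 ≤ ε ^ 2 := by
    refine (abs_le_of_sq_le_sq' ?_ (by positivity)).2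
    calc (d * h * x ^ 2) ^ 2 = d * (d * h ^ 2) * x ^ 4 := by ring
      _ ≤ (D * x ^ 2) * B * x ^ 4 := by gcongr
      _ = D * (B * x ^ 6) := by ring
      _ ≤ D * (ε ^ 4 / D) := by gcongr
      _ = (ε ^ 2) ^ 2 := by field_simp
  have x21 : 1 ≤ x ^ 2 := one_le_pow₀ hx1
  have x31 : 1 ≤ x ^ 3 := one_le_pow₀ hx1
  have x41 : 1 ≤ x ^ 4 := one_le_pow₀ hx1
  have hhe : h ≤ ε ^ 2 := (le_mul_of_one_le_left h0 x31).trans hxh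
  have mul1 {a b r : ℝ} (ha : a ≤ r) (hr : 0 ≤ r) (hb0 : 0 ≤ b) (hb : b ≤ 1) : a * b ≤ r :=
    (mul_le_mul_of_nonneg_right ha hb0).trans (mul_le_of_le_one_right hr hb)
  have dh0 : 0 ≤ d * h := mul_nonneg hd.le h0
  have ε20 := sq_nonneg ε
  have up {n : ℕ} {T S R : ℝ} (h : T ≤ C * S) (hR : x ^ n * S ≤ R) : x ^ n * T ≤ C * R := by
    calc x ^ n * T ≤ x ^ n * (C * S) := by gcongr
      _ = C * (x ^ n * S) := by ring
      _ ≤ _ := by gcongr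
  obtain ⟨h1, h2⟩ := le_of_quadratic_system_high (C := C) (p := x * v) (q := x ^ 2 * y)
    (r := x * u) (s := x ^ 2 * z) hC hη₂0 hη₂1 hε0 hεη (by positivity) (by positivity) (by
      have := up (n := 4) (R := ε ^ 2 * (3 + x ^ 2 * y + x ^ 2 * z + x * v)) y_le (by
        have k1 : h ^ 2 * x ^ 4 ≤ x ^ 3 * h := by
          calc h ^ 2 * x ^ 4 = (h * x ^ 3) * (h * x) := by ring
            _ ≤ (h * x ^ 3) * (x ^ 3 * h) := by
              gcongr (h * x ^ 3) * ?_
              rw [mul_comm]; gcongr; exact le_self_pow₀ hx1 (by norm_num)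
            _ ≤ (h * x ^ 3) * 1 := by gcongr; linarith
            _ = _ := by ring
        have k2 := mul_le_mul_of_nonneg_right hdh (by positivity : 0 ≤ x ^ 2 * y)
        have k3 := mul_le_mul_of_nonneg_right hxh (by positivity : 0 ≤ x ^ 2 * z)
        have k4 := mul_le_mul_of_nonneg_right hxh (by positivity : 0 ≤ x * v)
        linarith)
      linarith) (by
      have := up (n := 3) (R := ε ^ 2 + (x * v) * (x ^ 2 * z) + ε ^ 2 * (x ^ 2 * z)
          + (x ^ 2 * y) ^ 2) z_le (by
        have k1 : B * x ^ 3 ≤ B * x ^ 4 := by gcongr; norm_num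
        have k2 : x ^ 3 * h * z ≤ ε ^ 2 * (x ^ 2 * z) := by
          gcongr; exact le_mul_of_one_le_left z0 x21
        linarith)
      linarith) (by
      have := up (n := 1) (R := ε ^ 2 + (x * v) ^ 2 + (x * u) * (x ^ 2 * y) + x * u) u_le (by
        have k1 : B * x ≤ B * x ^ 4 := by gcongr; exact le_self_pow₀ hx1 (by norm_num)
        have k2 : x * u * y ≤ x * u * (x ^ 2 * y) := by
          gcongr; exact le_mul_of_one_le_left y0 x21
        have k3 : x * u * t ≤ x * u * 1 := by gcongr
        linarith)
      linarith) (by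
      have := up (n := 2) (R := ε ^ 2 + (x ^ 2 * y) ^ 2 + x ^ 2 * y + (x * u) * (x ^ 2 * y)
          + ε ^ 2 * (x * v)) v_le (by
        have k1 : B * x ^ 2 ≤ B * x ^ 4 := by gcongr; norm_num
        have k2 : x ^ 2 * y ^ 2 ≤ x ^ 4 * y ^ 2 := by gcongr; norm_num
        have k3 : x ^ 2 * y * t ≤ x ^ 2 * y * 1 := by gcongr
        have k4 : v * (x ^ 2 * h) ≤ v * (x ^ 3 * h) := by gcongr; norm_num
        have k5 : v * (x ^ 3 * h) ≤ (x * v) * (x ^ 3 * h) := by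
          gcongr; exact le_mul_of_one_le_left v0 hx1
        have k6 := mul_le_mul_of_nonneg_left hxh (by positivity : 0 ≤ x * v)
        linarith)
      linarith)
  have vη : v ≤ η₂ := (le_mul_of_one_le_left v0 hx1).trans h1
  have yη : y ≤ η₂ := (le_mul_of_one_le_left y0 x21).trans h2
  have hBe' : B ≤ ε ^ 2 := (le_mul_of_one_le_right hB0 x41).trans hBe
  have tη : t ≤ η := by
    refine (abs_le_of_sq_le_sq' (t_le.trans ?_) hη0.le).2
    rw [← hη₂C]
    refine mul_le_mul_of_nonneg_left ?_ hC0.le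
    have k : v ^ 2 ≤ η₂ := by rw [sq]; exact mul1 vη hη₂0.le v0 hv1
    linarith [mul1 yη hη₂0.le t0 ht1, mul1 h1 hη₂0.le f0 hf1]
  have k {a : ℝ} (ha : a ≤ η) : a ≤ η * x := ha.trans (le_mul_of_one_le_right hη0.le hx1)
  have v3 : v ≤ η := by linarith
  have y3 : y ≤ η := by linarith
  have h3 : h ≤ η := by linarith
  have := hb.sum_sq_lt_one hη0 hηC.le hu1 hz1 hf1 hs1 v3 y3 tη h3 (k v3) (k y3) (k tη) (k h3)
    (k ((le_mul_of_one_le_right dh0 x21).trans (by linarith))) (k (by linarith))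
  linarith

end AngleBounds

end RegimeEstimatesHigh

/-! ### Displacement coupling in both frequency regimes. -/

section DisplacementEstimates

namespace DisplacementBounds

variable {C d x B v u z y f t s h w c g : ℝ}

/-- Once v, u and h are small, `c_le` makes the mixed product of y and t small. This releases y and
t, and these release z and f, whose bounds pick up a second factor C. -/
theorem sum_sq_lt_one (hb : DisplacementBounds C d x B v u z y f t s h w c g) {η : ℝ} (hη : 0 < η)
    (hη1 : 40 * C ^ 2 * η ≤ 1)
    (hz1 : z ≤ 1) (hy1 : y ≤ 1) (hf1 : f ≤ 1) (ht1 : t ≤ 1) (hs1 : s ≤ 1)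
    (hv : v ≤ η) (hu : u ≤ η) (hh : h ≤ η) (hxv : x * v ≤ η) (hxu : x * u ≤ η)
    (hvx : v ≤ η * x) (hux : u ≤ η * x) (hdx : d * h ≤ η * x) (hB : B ≤ η) (hBx : B ≤ η * x) :
    v ^ 2 + u ^ 2 + z ^ 2 + y ^ 2 + f ^ 2 + t ^ 2 + s ^ 2 + h ^ 2 < 1 := by
  obtain ⟨hC, hx, hd, hB0, v0, u0, z0, y0, f0, t0, s0, h0, -, -, -, -, -, -, -, hc, hy', ht', hz',
    hf', hs'⟩ := hb
  have hC0 : 0 < C := by linarith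
  have hCC : C ≤ C ^ 2 := le_self_pow₀ hC (by norm_num)
  have hηC : η ≤ C * η := le_mul_of_one_le_left hη.le hC
  have hηC2 : C * η ≤ C ^ 2 * η := by gcongr
  have hηη : η ≤ 1 := by linarith
  have mul1 {a b r : ℝ} (ha : a ≤ r) (hr : 0 ≤ r) (hb0 : 0 ≤ b) (hb : b ≤ 1) : a * b ≤ r :=
    (mul_le_mul_of_nonneg_right ha hb0).trans (mul_le_of_le_one_right hr hb)
  have ηx : 0 ≤ η * x := by positivity
  have sq_le {a : ℝ} (ha : 0 ≤ a) (h : a ≤ η) : a ^ 2 ≤ η := by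
    rw [sq]; exact mul1 h hη.le ha (h.trans hηη)
  have vv := sq_le v0 hv
  have uu := sq_le u0 hu
  have hhh := sq_le h0 hh
  have fin {T S : ℝ} {n : ℝ} (h : x * T ≤ C * S) (hS : S ≤ x * (n * η)) : T ≤ C * (n * η) := by
    have : x * T ≤ x * (C * (n * η)) :=
      h.trans ((mul_le_mul_of_nonneg_left hS hC0.le).trans_eq (by ring))
    exact le_of_mul_le_mul_left this hx
  have cc : c ≤ C * (3 * η) := fin hc (by
    linarith [mul1 hvx ηx f0 hf1, mul1 hvx ηx z0 hz1, mul_pos hη hx])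
  have yy : y ^ 2 ≤ C * (7 * η) := by
    have := mul_le_mul_of_nonneg_left (by linarith [mul1 hxu hη.le y0 hy1, mul1 hxv hη.le z0 hz1] :
      B + x * u * y + x * v * z + v ^ 2 ≤ 4 * η) hC0.le
    linarith
  have tt : t ^ 2 ≤ C * (7 * η) := by
    have := mul_le_mul_of_nonneg_left (by linarith [mul1 hxu hη.le t0 ht1, mul1 hxv hη.le f0 hf1] :
      B + x * u * t + x * v * f + v ^ 2 ≤ 4 * η) hC0.le
    linarith
  have zz : z ^ 2 ≤ C * ((2 + 7 * C) * η) := fin hz' (by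
    linarith [mul1 hvx ηx z0 hz1, mul_le_mul_of_nonneg_left yy hx.le])
  have ff : f ^ 2 ≤ C * ((2 + 7 * C) * η) := fin hf' (by
    linarith [mul1 hvx ηx f0 hf1, mul_le_mul_of_nonneg_left tt hx.le])
  have ss : s ^ 2 ≤ C * (4 * η) := fin hs' (by
    linarith [mul1 hdx ηx s0 hs1, mul1 hux ηx s0 hs1, mul_le_mul_of_nonneg_left hhh hx.le])
  linarith

/-- The scaled unknowns are p = x v and q = x u. Smallness of x⁴ B gives that of x² h and x d h,
which makes the system for p and q free of x. -/
theorem exists_le_high (C c₀ D : ℝ) (hC : 1 ≤ C) (hc : 0 < c₀) (hD : 0 < D) :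
    ∃ δ : ℝ, 0 < δ ∧
    ∀ d x B v u z y f t s h w c g : ℝ, DisplacementBounds C d x B v u z y f t s h w c g → 1 ≤ x →
      c₀ ≤ d → d ≤ D * x ^ 2 →
      v ^ 2 + u ^ 2 + z ^ 2 + y ^ 2 + f ^ 2 + t ^ 2 + s ^ 2 + h ^ 2 = 1 →
      δ ≤ B * x ^ 4 := by
  have hC0 : 0 < C := by linarith
  have hCC : C ≤ C ^ 2 := le_self_pow₀ hC (by norm_num)
  have hC2 : 1 ≤ C ^ 2 := one_le_pow₀ hC
  set η := 1 / (40 * C ^ 2) with hη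
  have hη0 : 0 < η := by positivity
  have hηC : 40 * C ^ 2 * η = 1 := by rw [hη]; field_simp
  have hη1 : η ≤ 1 := by nlinarith
  have hη2 : η ^ 2 ≤ η := by nlinarith
  set ε := η ^ 2 / (40 * C ^ 2) with hε
  have hε0 : 0 < ε := by positivity
  have hεη : 40 * (C ^ 2 * ε) = η ^ 2 := by rw [hε]; field_simp
  have hCε : C * ε ≤ C ^ 2 * ε := by gcongr
  have hCε' : ε ≤ C * ε := le_mul_of_one_le_left hε0.le hC
  have hε1 : ε ≤ 1 := by linarith
  have hε2 : ε ^ 2 ≤ ε := by nlinarith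
  have hCε2 : C * ε ^ 2 ≤ C * ε := by gcongr
  refine ⟨min (min (ε ^ 4 * c₀) (ε ^ 4 / D)) (ε ^ 2), by positivity,
    fun d x B v u z y f t s h w c g hb hx1 hcd hdD hsum => ?_⟩
  by_contra! hB
  obtain ⟨hB', hB3⟩ := lt_min_iff.mp hB
  obtain ⟨hB1, hB2⟩ := lt_min_iff.mp hB'
  obtain ⟨hv1, hu1, hz1, hy1, hf1, ht1, hs1, hh1⟩ := le_one_of_sum_sq_eq_one hsum
  have hx := hb.hx
  have hd : 0 < d := hc.trans_le hcd
  obtain ⟨-, -, -, hB0, v0, u0, z0, y0, f0, t0, s0, h0, -, hg, diss, u_le, v_le, -, -, -, -, -, -,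
    -, -⟩ := id hb
  have x2 : 0 < x ^ 2 := by positivity
  have x21 : 1 ≤ x ^ 2 := one_le_pow₀ hx1
  have x41 : 1 ≤ x ^ 4 := one_le_pow₀ hx1
  have ε20 := sq_nonneg ε
  have hxh : x ^ 2 * h ≤ ε ^ 2 := by
    refine (abs_le_of_sq_le_sq' ?_ (by positivity)).2
    have h1 : c₀ * (x ^ 2 * h) ^ 2 ≤ c₀ * (ε ^ 2) ^ 2 := by
      calc c₀ * (x ^ 2 * h) ^ 2 = c₀ * h ^ 2 * x ^ 4 := by ring
        _ ≤ d * h ^ 2 * x ^ 4 := by gcongr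
        _ ≤ B * x ^ 4 := by gcongr
        _ ≤ _ := hB1.le.trans_eq (by ring)
    exact le_of_mul_le_mul_left h1 hc
  have hdh : d * h * x ≤ ε ^ 2 := by
    refine (abs_le_of_sq_le_sq' ?_ (by positivity)).2
    calc (d * h * x) ^ 2 = d * (d * h ^ 2) * x ^ 2 := by ring
      _ ≤ (D * x ^ 2) * B * x ^ 2 := by gcongr
      _ = D * (B * x ^ 4) := by ring
      _ ≤ D * (ε ^ 4 / D) := by gcongr
      _ = (ε ^ 2) ^ 2 := by field_simp
  have hhe : h ≤ ε ^ 2 := (le_mul_of_one_le_left h0 x21).trans hxh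
  have hBe : B ≤ ε ^ 2 := (le_mul_of_one_le_right hB0 x41).trans hB3.le
  have dh0 : 0 ≤ d * h := mul_nonneg hd.le h0
  obtain ⟨p, hp⟩ : ∃ p, p = x * v := ⟨_, rfl⟩
  obtain ⟨q, hq⟩ : ∃ q, q = x * u := ⟨_, rfl⟩
  have p0 : 0 ≤ p := by rw [hp]; positivity
  have q0 : 0 ≤ q := by rw [hq]; positivity
  have mul1 {a b r : ℝ} (ha : a ≤ r) (hr : 0 ≤ r) (hb0 : 0 ≤ b) (hb : b ≤ 1) : a * b ≤ r :=
    (mul_le_mul_of_nonneg_right ha hb0).trans (mul_le_of_le_one_right hr hb)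
  have up {T S R : ℝ} (h : x * T ≤ C * S) (hR : x * S ≤ R) : x ^ 2 * T ≤ C * R := by
    calc x ^ 2 * T = x * (x * T) := by ring
      _ ≤ x * (C * S) := by gcongr
      _ = C * (x * S) := by ring
      _ ≤ _ := by gcongr
  have h1 : q ^ 2 ≤ C * (ε ^ 2 * (6 + q + p)) := by
    have := up u_le (R := ε ^ 2 * (6 + q + p)) (by
      have k0 : B * x ^ 2 ≤ B * x ^ 4 := by gcongr; norm_num
      have k1 : B * x ≤ B * x ^ 4 := by gcongr; exact le_self_pow₀ hx1 (by norm_num)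
      have k2 := mul_le_mul_of_nonneg_right hdh q0
      have k3 := mul_le_mul_of_nonneg_right hxh p0
      rw [hq, hp] at *
      linarith [mul1 hxh ε20 z0 hz1, mul1 hxh ε20 f0 hf1, mul1 hxh ε20 h0 hh1])
    rwa [← mul_pow, ← hq] at this
  -- The Cauchy–Schwarz bound for g suffices here: x g ≤ q (y + t) ≤ 2 q.
  have h2 : p ^ 2 ≤ C * (ε ^ 2 + ε ^ 2 * p + q ^ 2 + 2 * q) := by
    have := up v_le (R := ε ^ 2 + ε ^ 2 * p + q ^ 2 + 2 * q) (by
      have k1 : B * x ≤ B * x ^ 4 := by gcongr; exact le_self_pow₀ hx1 (by norm_num)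
      have k2 := mul_le_mul_of_nonneg_right hhe p0
      have k3 := mul_le_mul_of_nonneg_left hg hx.le
      rw [hp, hq] at *
      linarith [mul1 le_rfl q0 y0 hy1, mul1 le_rfl q0 t0 ht1])
    rwa [← mul_pow, ← hp] at this
  have hM : 0 ≤ 1 + p ^ 2 := by positivity
  have hpM : p ≤ (1 + p ^ 2) / 2 := by linarith [sq_nonneg (p - 1)]
  have hM1 : 1 ≤ 1 + p ^ 2 := by linarith [sq_nonneg p]
  have s1 : q ^ 2 ≤ 14 * (C * ε ^ 2) * (1 + p ^ 2) := by
    have k : C * (ε ^ 2 * (6 + q + p)) ≤ C * (ε ^ 2 * (7 * (1 + p ^ 2) + q ^ 2 / 2)) := by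
      refine mul_le_mul_of_nonneg_left (mul_le_mul_of_nonneg_left ?_ ε20) hC0.le
      linarith [sq_nonneg p, sq_nonneg (q - 1)]
    have k2 : C * ε ^ 2 * q ^ 2 ≤ 1 * q ^ 2 := by gcongr; linarith
    linarith
  have hεC2 : C * ε * ε * (1 + p ^ 2) ≤ 1 / 40 * ε * (1 + p ^ 2) := by gcongr; linarith
  have hεC3 : 1 * ε * (1 + p ^ 2) ≤ C * ε * (1 + p ^ 2) := by gcongr
  have s2 : 2 * q ≤ 15 * C * ε * (1 + p ^ 2) := by
    have k : ε * (2 * q) ≤ ε * (15 * C * ε * (1 + p ^ 2)) := by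
      have k2 : 1 * ε ^ 2 * 1 ≤ C * ε ^ 2 * (1 + p ^ 2) := by gcongr
      linarith [sq_nonneg (q - ε)]
    exact le_of_mul_le_mul_left k hε0
  have s3 : p ^ 2 ≤ (20 * (C ^ 2 * ε)) * (1 + p ^ 2) := by
    have k : ε ^ 2 * (1 + p) ≤ ε * (2 * (1 + p ^ 2)) :=
      mul_le_mul hε2 (by linarith) (by linarith) hε0.le
    calc p ^ 2 ≤ _ := h2
      _ ≤ C * (20 * (C * ε * (1 + p ^ 2))) := by
        refine mul_le_mul_of_nonneg_left ?_ hC0.le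
        linarith [mul_nonneg hε0.le hM]
      _ = _ := by ring
  have p1 : p ≤ η := le_of_sq_le_mul_sq_add_one hη0.le hη1 (by linarith [sq_nonneg η]) s3
  have q1 : q ≤ η := by
    refine (abs_le_of_sq_le_sq' ?_ hη0.le).2
    have : p ^ 2 ≤ 1 := pow_le_one₀ p0 (p1.trans hη1)
    have k : C * ε ^ 2 * (1 + p ^ 2) ≤ C * ε * 2 := by gcongr; linarith
    linarith [sq_nonneg η]
  have k {a : ℝ} (ha : a ≤ η) : a ≤ η * x := ha.trans (le_mul_of_one_le_right hη0.le hx1)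
  have v3 : v ≤ η := (le_mul_of_one_le_left v0 hx1).trans (hp ▸ p1)
  have u3 : u ≤ η := (le_mul_of_one_le_left u0 hx1).trans (hq ▸ q1)
  have := hb.sum_sq_lt_one hη0 hηC.le hz1 hy1 hf1 ht1 hs1 v3 u3 (by linarith) (hp ▸ p1) (hq ▸ q1)
    (k v3) (k u3) (k ((le_mul_of_one_le_right dh0 hx1).trans (by linarith))) (by linarith)
    (k (by linarith))
  linarith

/-- Low-frequency system for p = v/x, q = u/x, r = w/x. Here q is small outright and r² is O(1 +
p²). Since r enters the bound for p only with the factor D e, p² ≤ (small)(1 + p²). -/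
theorem le_of_quadratic_system {A C D η e p q r : ℝ} (hC : 0 < C) (hA1 : 1 ≤ A) (hCA : C ≤ A)
    (hD : 0 ≤ D) (hDA : D ≤ A) (hη0 : 0 < η) (hη1 : η ≤ 1) (he0 : 0 < e) (heη : 40 * (A ^ 4 * e) = η ^ 2)
    (p0 : 0 ≤ p) (r0 : 0 ≤ r) (h1 : q ^ 2 ≤ A * e)
    (h3 : p ^ 2 ≤ C * (e + e * p + q ^ 2 + C * (3 * e + D * e * r + e * p)))
    (h4 : r ^ 2 ≤ C * (e + q * r + 2 * p + p ^ 2)) : p ≤ η ∧ q ≤ η := by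
  have hA0 : 0 < A := by linarith
  have hη2 : η ^ 2 ≤ 1 := pow_le_one₀ hη0.le hη1
  have e1 : A * e ≤ A ^ 2 * e := by gcongr; exact le_self_pow₀ hA1 (by norm_num)
  have e2 : A ^ 2 * e ≤ A ^ 3 * e := by gcongr; norm_num
  have e3 : A ^ 3 * e ≤ A ^ 4 * e := by gcongr; norm_num
  have e4 : e ≤ A * e := le_mul_of_one_le_left he0.le hA1
  have hM : 0 ≤ 1 + p ^ 2 := by positivity
  have hpM : p ≤ (1 + p ^ 2) / 2 := by linarith [sq_nonneg (p - 1)]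
  have hM1 : 1 ≤ 1 + p ^ 2 := by linarith [sq_nonneg p]
  have s1 : r ^ 2 ≤ 5 * A * (1 + p ^ 2) := by
    have k1 : r ^ 2 ≤ 2 * C * (e + 2 * p + p ^ 2) + C ^ 2 * q ^ 2 := by
      linarith [sq_nonneg (r - C * q)]
    have k2 : C ^ 2 * q ^ 2 ≤ A ^ 2 * (A * e) := by gcongr
    have k3 : 2 * C * (e + 2 * p + p ^ 2) ≤ 2 * A * (2 * (1 + p ^ 2)) :=
      mul_le_mul (by linarith) (by linarith) (by positivity) (by positivity)
    have k4 : 1 * 1 ≤ A * (1 + p ^ 2) := by gcongr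
    linarith
  have s2 : p ^ 2 ≤ (20 * (A ^ 4 * e)) * (1 + p ^ 2) := by
    have k1 : 1 * (1 + p ^ 2) ≤ A * (1 + p ^ 2) := by gcongr
    have k2 : r ≤ 3 * A * (1 + p ^ 2) := by linarith [sq_nonneg (r - 1)]
    have k3 : D * e * r ≤ A * e * (3 * A * (1 + p ^ 2)) := by gcongr
    have n1 : A * e * (1 + p ^ 2) ≤ A ^ 4 * e * (1 + p ^ 2) := by
      gcongr; exact le_self_pow₀ hA1 (by norm_num)
    have n2 : A ^ 2 * e * (1 + p ^ 2) ≤ A ^ 4 * e * (1 + p ^ 2) := by gcongr; norm_num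
    have n3 : A * e * p ≤ A * e * (1 + p ^ 2) := by gcongr; linarith
    have n4 : A ^ 2 * e * p ≤ A ^ 2 * e * (1 + p ^ 2) := by gcongr; linarith
    have n5 : A * e * 1 ≤ A * e * (1 + p ^ 2) := by gcongr
    have n6 : A ^ 2 * e * 1 ≤ A ^ 2 * e * (1 + p ^ 2) := by gcongr
    calc p ^ 2 ≤ _ := h3
      _ ≤ A * (e + e * p + A * e + A * (3 * e + A * e * (3 * A * (1 + p ^ 2)) + e * p)) := by
        gcongr
      _ ≤ _ := by linarith [mul_nonneg (by positivity : 0 ≤ A ^ 4 * e) hM]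
  have p1 : p ≤ η := le_of_sq_le_mul_sq_add_one hη0.le hη1 (by linarith [sq_nonneg η]) s2
  exact ⟨p1, (abs_le_of_sq_le_sq' (by linarith [sq_nonneg η]) hη0.le).2⟩

/-- If B is much smaller than d x⁴, then h is much smaller than x². This is the order at which x u²
and x v² can be compared after division by x³. -/
theorem exists_le_low (C D : ℝ) (hC : 1 ≤ C) (hD : 0 ≤ D) : ∃ δ : ℝ, 0 < δ ∧
    ∀ d x B v u z y f t s h w c g : ℝ, DisplacementBounds C d x B v u z y f t s h w c g → x ≤ 1 →
      0 < d → d ≤ D →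
      v ^ 2 + u ^ 2 + z ^ 2 + y ^ 2 + f ^ 2 + t ^ 2 + s ^ 2 + h ^ 2 = 1 →
      δ * (d * x ^ 4) ≤ B := by
  have hC0 : 0 < C := by linarith
  set A := C * (6 + D) with hA
  have hA1 : 1 ≤ A := by nlinarith
  have hCA : C ≤ A := by nlinarith
  have hDA : D ≤ A := by nlinarith
  have hA0 : 0 < A := by linarith
  set η := 1 / (40 * C ^ 2) with hη
  have hη0 : 0 < η := by positivity
  have hηC : 40 * C ^ 2 * η = 1 := by rw [hη]; field_simp
  have hC2 : 1 ≤ C ^ 2 := one_le_pow₀ hC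
  have hη1 : η ≤ 1 := by nlinarith
  have hη2 : η ^ 2 ≤ η := by nlinarith
  set e := η ^ 2 / (40 * A ^ 4) with he
  have he0 : 0 < e := by positivity
  have heη : 40 * (A ^ 4 * e) = η ^ 2 := by rw [he]; field_simp
  have e1 : A * e ≤ A ^ 2 * e := by gcongr; exact le_self_pow₀ hA1 (by norm_num)
  have e2 : A ^ 2 * e ≤ A ^ 3 * e := by gcongr; norm_num
  have e3 : A ^ 3 * e ≤ A ^ 4 * e := by gcongr; norm_num
  have e4 : e ≤ A * e := le_mul_of_one_le_left he0.le hA1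
  have hDe : D * e ≤ A * e := by gcongr
  have he1 : e ≤ 1 := by linarith
  have heη' : e ≤ η := by linarith
  have hDeη : D * e ≤ η := by linarith
  have hee : e ^ 2 ≤ e := by nlinarith
  refine ⟨e ^ 2, by positivity,
    fun d x B v u z y f t s h w c g hb hx1 hd hdD hsum => ?_⟩
  by_contra! hB
  obtain ⟨hv1, hu1, hz1, hy1, hf1, ht1, hs1, hh1⟩ := le_one_of_sum_sq_eq_one hsum
  have hx := hb.hx
  obtain ⟨-, -, -, hB0, v0, u0, z0, y0, f0, t0, s0, h0, w0, hg, diss, u_le, v_le, w_le, g_le, -, -,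
    -, -, -, -⟩ := id hb
  have x2 : 0 < x ^ 2 := by positivity
  have x3 : 0 < x ^ 3 := by positivity
  have xle {m n : ℕ} (hmn : m ≤ n) : x ^ n ≤ x ^ m := pow_le_pow_of_le_one hx.le hx1 hmn
  have hh : h ≤ e * x ^ 2 := by
    refine (abs_le_of_sq_le_sq' ?_ (by positivity)).2
    have := diss.trans hB.le
    refine le_of_mul_le_mul_left (this.trans_eq ?_) hd
    ring
  have hBx : B ≤ e * x ^ 4 := by
    calc B ≤ e ^ 2 * (d * x ^ 4) := hB.le
      _ ≤ e ^ 2 * (D * x ^ 4) := by gcongr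
      _ = e * x ^ 4 * (D * e) := by ring
      _ ≤ e * x ^ 4 := mul_le_of_le_one_right (by positivity) (by linarith)
  have hBx3 : B ≤ e * x ^ 3 := hBx.trans (mul_le_mul_of_nonneg_left (xle (by norm_num)) he0.le)
  obtain ⟨p, hp⟩ : ∃ p, v = x * p := ⟨v / x, by field_simp⟩
  obtain ⟨q, hq⟩ : ∃ q, u = x * q := ⟨u / x, by field_simp⟩
  obtain ⟨r, hr⟩ : ∃ r, w = x * r := ⟨w / x, by field_simp⟩
  have p0 : 0 ≤ p := by rw [hp] at v0; exact nonneg_of_mul_nonneg_right v0 hx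
  have q0 : 0 ≤ q := by rw [hq] at u0; exact nonneg_of_mul_nonneg_right u0 hx
  have r0 : 0 ≤ r := by rw [hr] at w0; exact nonneg_of_mul_nonneg_right w0 hx
  have mul1 {a b r : ℝ} (ha : a ≤ r) (hr : 0 ≤ r) (hb0 : 0 ≤ b) (hb : b ≤ 1) : a * b ≤ r :=
    (mul_le_mul_of_nonneg_right ha hb0).trans (mul_le_of_le_one_right hr hb)
  have hxh : x * h ≤ e * x ^ 3 := (mul_le_mul_of_nonneg_left hh hx.le).trans_eq (by ring)
  have ex3 : 0 ≤ e * x ^ 3 := by positivity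
  have hhv : h * v ≤ e * x ^ 3 * p := by
    rw [hp]; exact (mul_le_mul_of_nonneg_right hh (by positivity)).trans_eq (by ring)
  have dh : d * h ≤ D * (e * x ^ 2) := by gcongr
  have h1 : q ^ 2 ≤ A * e := by
    have k : x ^ 3 * q ^ 2 ≤ x ^ 3 * (A * e) := by
      calc x ^ 3 * q ^ 2 = x * u ^ 2 := by rw [hq]; ring
        _ ≤ _ := u_le
        _ ≤ C * ((6 + D) * (e * x ^ 3)) := by
          refine mul_le_mul_of_nonneg_left ?_ hC0.le
          have k1 : x * B ≤ 1 * B := by gcongr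
          have k2 : x * (d * h) * u ≤ x * (D * (e * x ^ 2)) * 1 := by gcongr
          have k3 : x * h * (x * v) ≤ x * h * 1 := by
            gcongr; exact mul_le_one₀ hx1 v0 hv1
          linarith [mul1 hxh ex3 h0 hh1, mul1 hxh ex3 z0 hz1, mul1 hxh ex3 f0 hf1]
        _ = _ := by rw [hA]; ring
    exact le_of_mul_le_mul_left k x3
  -- A bound of order x³ is needed, whereas Cauchy–Schwarz gives only order x. So `g_le` is used,
  -- and with it the norm w of the sum of angular velocities.
  have h2 : g ≤ C * (x ^ 3 * (3 * e + D * e * r + e * p)) := by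
    refine g_le.trans (mul_le_mul_of_nonneg_left ?_ hC0.le)
    have k1 : d * h * w ≤ D * (e * x ^ 2) * w := by gcongr
    rw [hr] at k1 ⊢
    linarith [mul1 hxh ex3 z0 hz1, mul1 hxh ex3 f0 hf1]
  have h3 : p ^ 2 ≤ C * (e + e * p + q ^ 2 + C * (3 * e + D * e * r + e * p)) := by
    have k : x ^ 3 * p ^ 2 ≤ x ^ 3 * (C * (e + e * p + q ^ 2 + C * (3 * e + D * e * r + e * p))) := by
      calc x ^ 3 * p ^ 2 = x * v ^ 2 := by rw [hp]; ring
        _ ≤ _ := v_le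
        _ ≤ C * (x ^ 3 * (e + e * p + q ^ 2 + C * (3 * e + D * e * r + e * p))) := by
          refine mul_le_mul_of_nonneg_left ?_ hC0.le
          rw [hq]
          linarith
        _ = _ := by ring
    exact le_of_mul_le_mul_left k x3
  have h4 : r ^ 2 ≤ C * (e + q * r + 2 * p + p ^ 2) := by
    have k : x ^ 2 * r ^ 2 ≤ x ^ 2 * (C * (e + q * r + 2 * p + p ^ 2)) := by
      calc x ^ 2 * r ^ 2 = w ^ 2 := by rw [hr]; ring
        _ ≤ _ := w_le
        _ ≤ C * (x ^ 2 * (e + q * r + 2 * p + p ^ 2)) := by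
          refine mul_le_mul_of_nonneg_left ?_ hC0.le
          have k1 : e * x ^ 3 ≤ e * x ^ 2 := mul_le_mul_of_nonneg_left (xle (by norm_num)) he0.le
          have k2 : x * (x ^ 2 * q * r) ≤ 1 * (x ^ 2 * q * r) := by gcongr
          have k3 : x ^ 2 * p * z ≤ x ^ 2 * p * 1 := by gcongr
          have k4 : x ^ 2 * p * f ≤ x ^ 2 * p * 1 := by gcongr
          rw [hq, hr, hp]
          linarith
        _ = _ := by ring
    exact le_of_mul_le_mul_left k x2
  obtain ⟨p1, q1⟩ := le_of_quadratic_system hC0 hA1 hCA hD hDA hη0 hη1 he0 heη p0 r0 h1 h3 h4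
  have key {a b : ℝ} (hab : a = x * b) (hb0 : 0 ≤ b) (hb : b ≤ η) :
      a ≤ η ∧ a ≤ η * x ∧ x * a ≤ η := by
    have : a ≤ η := by rw [hab]; exact (mul_le_of_le_one_left hb0 hx1).trans hb
    refine ⟨this, by rw [hab, mul_comm]; gcongr, ?_⟩
    exact (mul_le_mul_of_nonneg_left this hx.le).trans (mul_le_of_le_one_left hη0.le hx1)
  have ex2 : e * x ^ 2 ≤ e * x := by gcongr; simpa using xle (m := 1) (n := 2) (by norm_num)
  have ex4 : e * x ^ 4 ≤ e * x := by gcongr; simpa using xle (m := 1) (n := 4) (by norm_num)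
  have ex : e * x ≤ η * x := by gcongr
  have ηx : η * x ≤ η := mul_le_of_le_one_right hη0.le hx1
  obtain ⟨v1, v2, v3⟩ := key hp p0 p1
  obtain ⟨u1, u2, u3⟩ := key hq q0 q1
  have := hb.sum_sq_lt_one hη0 hηC.le hz1 hy1 hf1 ht1 hs1 v1 u1
    (hh.trans (ex2.trans (ex.trans ηx))) v3 u3
    v2 u2 (dh.trans (by
      calc D * (e * x ^ 2) ≤ D * (e * x) := by gcongr
        _ = D * e * x := by ring
        _ ≤ η * x := by gcongr)) (hBx.trans (ex4.trans (ex.trans ηx))) (hBx.trans (ex4.trans ex))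
  linarith

end DisplacementBounds

end DisplacementEstimates

/-! ### Exponential decay from integral bounds; L² in time and the energy. -/

section ExponentialDecay

open Filter Complex
open scoped InnerProductSpace

/-- A nonincreasing function whose integrals over `[s, s + T]` are bounded by `M` times its value
at `s` decays exponentially. -/
theorem le_exp_mul_of_integral_le {E : ℝ → ℝ} (hE : AntitoneOn E (Ici 0)) (hE0 : ∀ t, 0 ≤ E t)
    {M : ℝ} (hM : 0 < M)
    (hint : ∀ s T, 0 ≤ s → 0 ≤ T → ∫ r in s..s + T, E r ≤ M * E s) {t : ℝ} (ht : 0 ≤ t) :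
    E t ≤ Real.exp (1 - t / (Real.exp 1 * M)) * E 0 := by
  have e0 := Real.exp_pos 1
  set L := Real.exp 1 * M with hL
  have hL0 : 0 < L := by positivity
  -- By monotonicity L E(s + L) is at most the integral over [s, s + L], so L = e M gains a factor e
  -- per step. The exponent 1 in the conclusion pays for rounding t / L down.
  have step (s : ℝ) (hs : 0 ≤ s) : Real.exp 1 * E (s + L) ≤ E s := by
    have h1 : L * E (s + L) ≤ M * E s := by
      refine le_trans ?_ (hint s L hs hL0.le)
      have : ∫ _ in s..s + L, E (s + L) = L * E (s + L) := by simp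
      rw [← this]
      refine intervalIntegral.integral_mono_on (by linarith) (by simp) ?_ fun r hr => ?_
      · refine AntitoneOn.intervalIntegrable (hE.mono ?_)
        rw [uIcc_of_le (by linarith)]
        exact fun r hr => hs.trans hr.1
      · exact hE (hs.trans hr.1 : (0 : ℝ) ≤ r) (by simp; linarith) hr.2
    have h2 : M * (Real.exp 1 * E (s + L)) ≤ M * E s := by rw [hL] at *; linarith
    exact le_of_mul_le_mul_left h2 hM
  have iter (n : ℕ) : E (n * L) ≤ Real.exp (-n) * E 0 := by
    induction n with
    | zero => simp
    | succ n ih =>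
      have h := step (n * L) (by positivity)
      have h' : Real.exp (-1) * (Real.exp 1 * E (n * L + L)) ≤ Real.exp (-1) * E (n * L) :=
        mul_le_mul_of_nonneg_left h (Real.exp_pos _).le
      rw [← mul_assoc, ← Real.exp_add, neg_add_cancel, Real.exp_zero, one_mul] at h'
      calc E ((n + 1 : ℕ) * L) = E (n * L + L) := by push_cast; ring_nf
        _ ≤ Real.exp (-1) * E (n * L) := h'
        _ ≤ Real.exp (-1) * (Real.exp (-n) * E 0) := by gcongr
        _ = _ := by rw [← mul_assoc, ← Real.exp_add]; push_cast; ring_nf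
  have hn := Nat.floor_le (div_nonneg ht hL0.le)
  have hn' := (Nat.lt_floor_add_one (t / L)).le
  calc E t ≤ E (⌊t / L⌋₊ * L) :=
        hE (by simp; positivity) ht (by rwa [← le_div_iff₀ hL0])
    _ ≤ Real.exp (-⌊t / L⌋₊) * E 0 := iter _
    _ ≤ _ := by
      refine mul_le_mul_of_nonneg_right (Real.exp_le_exp.mpr (by linarith)) (hE0 0)

theorem memLp_two_Ioc (a T : ℝ) (f : C(ℝ, ℂ)) :
    MemLp f 2 ((volume : Measure ℝ).restrict (Ioc a (a + T))) :=
  (memLp_two_iff_integrable_sq_norm f.continuous.aestronglyMeasurable).mpr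
    (by fun_prop : Continuous fun t => ‖f t‖ ^ 2).integrableOn_Ioc

/-- Continuous functions on the real line as square integrable functions on `(a, a + T]`. -/
noncomputable def continuousToL2 (a T : ℝ) :
    C(ℝ, ℂ) →ₗ[ℂ] Lp ℂ 2 ((volume : Measure ℝ).restrict (Ioc a (a + T))) where
  toFun f := (memLp_two_Ioc a T f).toLp f
  map_add' _ _ := MemLp.toLp_add _ _
  map_smul' c _ := MemLp.toLp_const_smul c _

theorem inner_continuousToL2 {a T : ℝ} (hT : 0 ≤ T) (f g : C(ℝ, ℂ)) :
    ⟪continuousToL2 a T f, continuousToL2 a T g⟫_ℂ = ∫ t in a..a + T, ⟪f t, g t⟫_ℂ := by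
  rw [L2.inner_def, intervalIntegral.integral_of_le (by linarith)]
  refine integral_congr_ae ?_
  filter_upwards [(memLp_two_Ioc a T f).coeFn_toLp, (memLp_two_Ioc a T g).coeFn_toLp] with t h1 h2
  simp only [continuousToL2, LinearMap.coe_mk, AddHom.coe_mk]
  rw [h1, h2]

theorem norm_continuousToL2_sq {a T : ℝ} (hT : 0 ≤ T) (f : C(ℝ, ℂ)) :
    ‖continuousToL2 a T f‖ ^ 2 = ∫ t in a..a + T, ‖f t‖ ^ 2 := by
  have h := inner_continuousToL2 (a := a) hT f f
  have h2 : (fun t => ⟪f t, f t⟫_ℂ) = fun t => ((‖f t‖ ^ 2 : ℝ) : ℂ) := by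
    ext t; rw [inner_self_eq_norm_sq_to_K]; simp
  rw [inner_self_eq_norm_sq_to_K, h2, intervalIntegral.integral_ofReal] at h
  apply ofReal_injective
  rw [← h]
  simp

/-- The vector field of the beam system at frequency `x` with damping `d`. -/
noncomputable def beamField (p : BeamCoeffs) (d x : ℝ) (Y : Fin 8 → ℂ) : Fin 8 → ℂ :=
  ![I * x * Y 1 + Y 3 + Y 5,
    I * (p.k₁ * x) * Y 0 - ((p.τ₁ * p.γ : ℝ) : ℂ) * Y 7,
    I * x * Y 3,
    I * (p.k₂ * x) * Y 2 - p.k₁ * Y 0 - ((p.τ₂ * p.γ : ℝ) : ℂ) * Y 7,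
    I * x * Y 5,
    I * (p.k₃ * x) * Y 4 - p.k₁ * Y 0 - ((p.τ₃ * p.γ : ℝ) : ℂ) * Y 7,
    I * x * Y 7,
    I * (p.k₄ * x) * Y 6 - d * Y 7 + p.γ * (p.τ₁ * Y 1 + p.τ₂ * Y 3 + p.τ₃ * Y 5)]

/-- The energy. -/
noncomputable def beamEnergy (p : BeamCoeffs) (Y : Fin 8 → ℂ) : ℝ :=
  p.k₁ * ‖Y 0‖ ^ 2 + ‖Y 1‖ ^ 2 + p.k₂ * ‖Y 2‖ ^ 2 + ‖Y 3‖ ^ 2 + p.k₃ * ‖Y 4‖ ^ 2 + ‖Y 5‖ ^ 2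
    + p.k₄ * ‖Y 6‖ ^ 2 + ‖Y 7‖ ^ 2

section Trajectory

variable {p : BeamCoeffs} {d x : ℝ} {Y : ℝ → Fin 8 → ℂ}

/-- The weights k₁, …, k₄ make the first-order part conservative and the zero-order couplings skew,
so only the damping of component 7 survives. -/
theorem hasDerivAt_beamEnergy
    (hY : ∀ t a, HasDerivAt (fun s => Y s a) (beamField p d x (Y t) a) t) (t : ℝ) :
    HasDerivAt (fun s => beamEnergy p (Y s)) (-(2 * d * ‖Y t 7‖ ^ 2)) t := by
  have h (a : Fin 8) := (hY t a).norm_sq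
  have := ((((((((h 0).const_mul p.k₁).add (h 1)).add ((h 2).const_mul p.k₂)).add (h 3)).add
    ((h 4).const_mul p.k₃)).add (h 5)).add ((h 6).const_mul p.k₄)).add (h 7)
  refine this.congr_deriv ?_
  simp only [beamField]
  simp [Complex.inner, Complex.sq_norm, normSq_apply]
  ring

end Trajectory

end ExponentialDecay

/-! ### Decay of trajectories at a fixed frequency. -/

section TrajectoryDecay

open Filter Complex
open scoped InnerProductSpace

theorem exists_beamEnergy_equiv {p : BeamCoeffs} (hk₁ : 0 < p.k₁) (hk₂ : 0 < p.k₂) (hk₃ : 0 < p.k₃)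
    (hk₄ : 0 < p.k₄) : ∃ m : ℝ, 1 ≤ m ∧ ∀ Y : Fin 8 → ℂ,
      ∑ i, ‖Y i‖ ^ 2 ≤ m * beamEnergy p Y ∧ beamEnergy p Y ≤ m * ∑ i, ‖Y i‖ ^ 2 := by
  obtain ⟨m, hm, h1, h2, h3, h4, h1', h2', h3', h4'⟩ :=
    ((eventually_ge_atTop (1 : ℝ)).and <| (eventually_ge_atTop p.k₁).and <|
      (eventually_ge_atTop p.k₂).and <| (eventually_ge_atTop p.k₃).and <|
      (eventually_ge_atTop p.k₄).and <| (BeamGram.eventually_le_mul 1 hk₁).and <|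
      (BeamGram.eventually_le_mul 1 hk₂).and <| (BeamGram.eventually_le_mul 1 hk₃).and <|
      BeamGram.eventually_le_mul 1 hk₄).exists
  refine ⟨m, hm, fun Y => ?_⟩
  have n (i : Fin 8) : 0 ≤ ‖Y i‖ ^ 2 := sq_nonneg _
  have k {a b : ℝ} (h : a ≤ b) (i : Fin 8) : a * ‖Y i‖ ^ 2 ≤ b * ‖Y i‖ ^ 2 :=
    mul_le_mul_of_nonneg_right h (n i)
  simp only [beamEnergy, Fin.sum_univ_eight]
  constructor
  · linarith [k h1' 0, k hm 1, k h2' 2, k hm 3, k h3' 4, k hm 5, k h4' 6, k hm 7]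
  · linarith [k h1 0, k hm 1, k h2 2, k hm 3, k h3 4, k hm 5, k h4 6, k hm 7]

variable {p : BeamCoeffs} {d x : ℝ} {Y : ℝ → Fin 8 → ℂ}

theorem continuous_of_trajectory
    (hY : ∀ t a, HasDerivAt (fun s => Y s a) (beamField p d x (Y t) a) t) (a : Fin 8) :
    Continuous fun t => Y t a :=
  continuous_iff_continuousAt.mpr fun t => (hY t a).continuousAt

theorem continuous_beamField
    (hY : ∀ t a, HasDerivAt (fun s => Y s a) (beamField p d x (Y t) a) t) (a : Fin 8) :
    Continuous fun t => beamField p d x (Y t) a := by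
  have h := continuous_of_trajectory hY
  fin_cases a <;> simp only [beamField] <;> simp <;> fun_prop

theorem antitone_beamEnergy (hd : 0 ≤ d)
    (hY : ∀ t a, HasDerivAt (fun s => Y s a) (beamField p d x (Y t) a) t) :
    Antitone fun t => beamEnergy p (Y t) :=
  antitone_of_hasDerivAt_nonpos (hasDerivAt_beamEnergy hY) fun t => by
    have : 0 ≤ d * ‖Y t 7‖ ^ 2 := by positivity
    simp only [Pi.zero_apply]
    linarith

/-- Integrating the derivative of ⟪Y i, Y j⟫ over (a, a + T] leaves the values at the two ends. Each
is at most m times the energy there, hence at most m times the energy at a. Integrating the energy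
identity gives `diss`. -/
theorem beamGram_of_trajectory {m : ℝ} (hm : 1 ≤ m)
    (hmY : ∀ Y : Fin 8 → ℂ, ∑ i, ‖Y i‖ ^ 2 ≤ m * beamEnergy p Y ∧
      beamEnergy p Y ≤ m * ∑ i, ‖Y i‖ ^ 2) (hd : 0 ≤ d)
    (hY : ∀ t a, HasDerivAt (fun s => Y s a) (beamField p d x (Y t) a) t)
    {a T : ℝ} (hT : 0 ≤ T) :
    BeamGram p d x (2 * m * beamEnergy p (Y a))
      (fun i => continuousToL2 a T ⟨fun t => Y t i, continuous_of_trajectory hY i⟩)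
      (fun i => continuousToL2 a T ⟨fun t => beamField p d x (Y t) i, continuous_beamField hY i⟩) := by
  have hm0 : 0 < m := by linarith
  have hE0 (t : ℝ) : 0 ≤ beamEnergy p (Y t) := by
    have : 0 ≤ m * beamEnergy p (Y t) := le_trans (by positivity) (hmY (Y t)).1
    exact nonneg_of_mul_nonneg_right this hm0
  have hE := antitone_beamEnergy hd hY
  have hsq (t : ℝ) (i : Fin 8) : ‖Y t i‖ ^ 2 ≤ m * beamEnergy p (Y t) :=
    (Finset.single_le_sum (f := fun i => ‖Y t i‖ ^ 2) (fun _ _ => by positivity)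
      (Finset.mem_univ i)).trans (hmY (Y t)).1
  have hin (t : ℝ) (i j : Fin 8) : ‖⟪Y t i, Y t j⟫_ℂ‖ ≤ m * beamEnergy p (Y t) := by
    refine (norm_inner_le_norm _ _).trans ?_
    nlinarith [hsq t i, hsq t j, sq_nonneg (‖Y t i‖ - ‖Y t j‖)]
  have cY := continuous_of_trajectory hY
  have cF := continuous_beamField hY
  have hlast : beamEnergy p (Y (a + T)) ≤ beamEnergy p (Y a) := hE (by linarith)
  constructor
  · intro i j
    rw [inner_continuousToL2 hT, inner_continuousToL2 hT, ← intervalIntegral.integral_add]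
    · have hder (t : ℝ) := (hY t i).inner ℂ (hY t j)
      have := intervalIntegral.integral_eq_sub_of_hasDerivAt (a := a) (b := a + T)
        (fun t _ => hder t) (Continuous.intervalIntegrable (by fun_prop) _ _)
      simp only [ContinuousMap.coe_mk]
      simp only [add_comm ⟪beamField p d x _ i, _⟫_ℂ]
      rw [this]
      refine (norm_sub_le_of_le (hin _ i j) (hin _ i j)).trans ?_
      nlinarith
    · exact Continuous.intervalIntegrable (by simp only [ContinuousMap.coe_mk]; fun_prop) _ _
    · exact Continuous.intervalIntegrable (by simp only [ContinuousMap.coe_mk]; fun_prop) _ _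
  · rw [norm_continuousToL2_sq hT]
    have := intervalIntegral.integral_eq_sub_of_hasDerivAt (a := a) (b := a + T)
        (fun t _ => hasDerivAt_beamEnergy hY t) (Continuous.intervalIntegrable (by fun_prop) _ _)
    simp only [← neg_mul, intervalIntegral.integral_const_mul, ContinuousMap.coe_mk] at this ⊢
    nlinarith [hE0 (a + T), hE0 a]
  all_goals
    simp only [← map_smul, ← map_add, ← map_sub]
    rfl

/-- If the norms in `L²((a, a + T])` are controlled by the boundary terms, uniformly in `a` and `T`,
then the trajectory decays exponentially. -/
theorem exists_exp_decay (hk₁ : 0 < p.k₁) (hk₂ : 0 < p.k₂) (hk₃ : 0 < p.k₃) (hk₄ : 0 < p.k₄) {δ : ℝ}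
    (hδ : 0 < δ) : ∃ K c : ℝ, 0 < K ∧ 0 < c ∧ ∀ d x f : ℝ, 0 ≤ d → 0 < f →
      (∀ (H : Type) [NormedAddCommGroup H] [InnerProductSpace ℂ H] (X X' : Fin 8 → H) (B : ℝ),
        BeamGram p d x B X X' → δ * f * ∑ i, ‖X i‖ ^ 2 ≤ B) →
      ∀ Y : ℝ → Fin 8 → ℂ,
      (∀ t a, HasDerivAt (fun s => Y s a) (beamField p d x (Y t) a) t) →
      ∀ t, 0 ≤ t → ∑ i, ‖Y t i‖ ^ 2 ≤ K * Real.exp (-(c * f * t)) * ∑ i, ‖Y 0 i‖ ^ 2 := by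
  obtain ⟨m, hm, hmY⟩ := exists_beamEnergy_equiv hk₁ hk₂ hk₃ hk₄
  have hm0 : 0 < m := by linarith
  refine ⟨m * Real.exp 1 * m, δ / (Real.exp 1 * (2 * m * m)), by positivity, by positivity,
    fun d x f hd hf hgram Y hY t ht => ?_⟩
  have hE0 (t : ℝ) : 0 ≤ beamEnergy p (Y t) := by
    have : 0 ≤ m * beamEnergy p (Y t) := le_trans (by positivity) (hmY (Y t)).1
    exact nonneg_of_mul_nonneg_right this hm0
  have hE := antitone_beamEnergy hd hY
  have hM : 0 < 2 * m * m / (δ * f) := by positivity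
  have cY := continuous_of_trajectory hY
  have key := le_exp_mul_of_integral_le (E := fun t => beamEnergy p (Y t)) (hE.antitoneOn _) hE0 hM
    (fun s T _ hT => by
      -- The abstract bound in L² of (s, s + T] is an observability estimate: ∫ E ≤ (2m² / (δ f))
      -- E(s), uniformly in T.
      have h := hgram _ _ _ _ (beamGram_of_trajectory hm hmY hd hY (a := s) hT)
      simp only [norm_continuousToL2_sq hT, ContinuousMap.coe_mk] at h
      rw [← intervalIntegral.integral_finsetSum
        (fun i _ => Continuous.intervalIntegrable (by fun_prop) _ _)] at h
      have h2 : ∫ r in s..s + T, beamEnergy p (Y r) ≤ m * ∫ r in s..s + T, ∑ i, ‖Y r i‖ ^ 2 := by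
        rw [← intervalIntegral.integral_const_mul]
        refine intervalIntegral.integral_mono_on (by linarith) hE.intervalIntegrable
          (Continuous.intervalIntegrable (by fun_prop) _ _) fun r _ => (hmY (Y r)).2
      rw [div_mul_eq_mul_div, le_div_iff₀ (by positivity)]
      calc (∫ r in s..s + T, beamEnergy p (Y r)) * (δ * f)
          ≤ (m * ∫ r in s..s + T, ∑ i, ‖Y r i‖ ^ 2) * (δ * f) := by gcongr
        _ = m * (δ * f * ∫ r in s..s + T, ∑ i, ‖Y r i‖ ^ 2) := by ring
        _ ≤ m * (2 * m * beamEnergy p (Y s)) := by gcongr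
        _ = _ := by ring) ht
  calc ∑ i, ‖Y t i‖ ^ 2 ≤ m * beamEnergy p (Y t) := (hmY (Y t)).1
    _ ≤ m * (Real.exp (1 - t / (Real.exp 1 * (2 * m * m / (δ * f)))) * beamEnergy p (Y 0)) := by
      gcongr
    _ ≤ m * (Real.exp (1 - t / (Real.exp 1 * (2 * m * m / (δ * f))))
        * (m * ∑ i, ‖Y 0 i‖ ^ 2)) := by gcongr; exact (hmY (Y 0)).2
    _ = _ := by
      rw [sub_eq_add_neg, Real.exp_add]
      have : -(t / (Real.exp 1 * (2 * m * m / (δ * f))))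
          = -(δ / (Real.exp 1 * (2 * m * m)) * f * t) := by field_simp
      rw [this]
      ring

end TrajectoryDecay

/-! ### Decay rates as functions of the frequency. -/

section SymbolDecay

/-- The damping coefficient at frequency `x`. -/
def beamDamping (p : BeamCoeffs) (ε₀ x : ℝ) : ℝ := ε₀ * p.k₅ * x ^ 2 + (1 - ε₀) * p.k₅

/-- Pointwise decay in Fourier space, at the rate `|x| ^ μ` for low and `|x| ^ (-ν)` for high
frequencies. -/
def SymbolDecay (p : BeamCoeffs) (ε₀ : ℝ) (μ ν : ℕ) : Prop :=
  ∃ K c : ℝ, 0 < K ∧ 0 < c ∧ ∀ x : ℝ, x ≠ 0 → ∀ Y : ℝ → Fin 8 → ℂ,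
    (∀ t a, HasDerivAt (fun s => Y s a) (beamField p (beamDamping p ε₀ x) x (Y t) a) t) →
    ∀ t, 0 ≤ t →
      (|x| ≤ 1 → ∑ i, ‖Y t i‖ ^ 2 ≤ K * Real.exp (-(c * |x| ^ μ * t)) * ∑ i, ‖Y 0 i‖ ^ 2) ∧
      (1 ≤ |x| → ∑ i, ‖Y t i‖ ^ 2 ≤ K * Real.exp (-(c * (|x| ^ ν)⁻¹ * t)) * ∑ i, ‖Y 0 i‖ ^ 2)

/-- All norms are controlled by the boundary terms. -/
def GramBound (p : BeamCoeffs) (d x f : ℝ) : Prop :=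
  ∀ (H : Type) [NormedAddCommGroup H] [InnerProductSpace ℂ H] (X X' : Fin 8 → H) (B : ℝ),
    BeamGram p d x B X X' → f * ∑ i, ‖X i‖ ^ 2 ≤ B

variable {p : BeamCoeffs}

theorem BeamGram.smul {H : Type*} [NormedAddCommGroup H] [InnerProductSpace ℂ H] {d x B : ℝ}
    {X X' : Fin 8 → H} (hX : BeamGram p d x B X X') (r : ℝ) :
    BeamGram p d x (r ^ 2 * B) (fun i => (r : ℂ) • X i) (fun i => (r : ℂ) • X' i) where
  bal a b := by
    have : inner ℂ ((r : ℂ) • X' a) ((r : ℂ) • X b) + inner ℂ ((r : ℂ) • X a) ((r : ℂ) • X' b)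
        = ((r ^ 2 : ℝ) : ℂ) * (inner ℂ (X' a) (X b) + inner ℂ (X a) (X' b)) := by
      simp only [inner_smul_left, inner_smul_right, Complex.conj_ofReal]
      push_cast
      ring
    rw [this, norm_mul, Complex.norm_real, Real.norm_of_nonneg (sq_nonneg r)]
    exact mul_le_mul_of_nonneg_left (hX.bal a b) (sq_nonneg r)
  diss := by
    have := mul_le_mul_of_nonneg_left hX.diss (sq_nonneg r)
    rw [norm_smul, mul_pow, Complex.norm_real, Real.norm_eq_abs, sq_abs]
    linarith
  row0 := by rw [hX.row0]; module
  row1 := by rw [hX.row1]; module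
  row2 := by rw [hX.row2]; module
  row3 := by rw [hX.row3]; module
  row4 := by rw [hX.row4]; module
  row5 := by rw [hX.row5]; module
  row6 := by rw [hX.row6]; module
  row7 := by rw [hX.row7]; module

/-- The relations are linear and B is quadratic, so scaling by S^(-1/2) reduces to unit sum of
squares. If the sum is zero, B ≥ 0 is enough. -/
theorem gramBound_of_normalized {d x f : ℝ}
    (h : ∀ (H : Type) [NormedAddCommGroup H] [InnerProductSpace ℂ H] (X X' : Fin 8 → H) (B : ℝ),
      BeamGram p d x B X X' → ‖X 0‖ ^ 2 + ‖X 1‖ ^ 2 + ‖X 2‖ ^ 2 + ‖X 3‖ ^ 2 + ‖X 4‖ ^ 2 + ‖X 5‖ ^ 2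
        + ‖X 6‖ ^ 2 + ‖X 7‖ ^ 2 = 1 → f ≤ B) : GramBound p d x f := by
  intro H _ _ X X' B hX
  have hB : 0 ≤ B := (norm_nonneg _).trans (hX.bal 0 0)
  rcases (Finset.sum_nonneg fun i _ => sq_nonneg ‖X i‖ : 0 ≤ ∑ i, ‖X i‖ ^ 2).eq_or_lt with h0 | h0
  · rwa [← h0, mul_zero]
  · set S := ∑ i, ‖X i‖ ^ 2 with hS
    have hr : √(S⁻¹) ^ 2 = S⁻¹ := Real.sq_sqrt (by positivity)
    have := h H _ _ _ (hX.smul √(S⁻¹)) (by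
      simp only [norm_smul, mul_pow, Complex.norm_real, Real.norm_eq_abs, sq_abs, hr, ← mul_add]
      rw [← Fin.sum_univ_eight (fun i => ‖X i‖ ^ 2), ← hS, inv_mul_cancel₀ h0.ne'])
    rwa [hr, ← div_eq_inv_mul, le_div_iff₀ h0] at this

/-- Exchange of the two rotation angles. -/
def BeamCoeffs.swap (p : BeamCoeffs) : BeamCoeffs :=
  { p with k₂ := p.k₃, k₃ := p.k₂, τ₂ := p.τ₃, τ₃ := p.τ₂ }

/-- Exchanging ψ and w permutes the rows, so coupling to the third equation reduces to coupling to
the second. -/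
theorem GramBound.of_swap {d x f : ℝ} (h : GramBound p.swap d x f) : GramBound p d x f := by
  intro H _ _ X X' B hX
  have := h H ![X 0, X 1, X 4, X 5, X 2, X 3, X 6, X 7] ![X' 0, X' 1, X' 4, X' 5, X' 2, X' 3, X' 6, X' 7]
    B { bal := fun a b => by fin_cases a <;> fin_cases b <;> exact hX.bal _ _
        diss := hX.diss
        row0 := hX.row0.trans (add_right_comm _ _ _)
        row1 := hX.row1
        row2 := hX.row4
        row3 := hX.row5
        row4 := hX.row2
        row5 := hX.row3
        row6 := hX.row6
        row7 := hX.row7.trans (by simp only [BeamCoeffs.swap]; simp; abel) }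
  refine le_trans (le_of_eq ?_) this
  simp only [Fin.sum_univ_eight]
  simp
  ring_nf
  simp

theorem symbolDecay_of_gramBound (hk₁ : 0 < p.k₁) (hk₂ : 0 < p.k₂) (hk₃ : 0 < p.k₃)
    (hk₄ : 0 < p.k₄) (hk₅ : 0 < p.k₅) {ε₀ : ℝ} (hε : ε₀ = 1 ∨ ε₀ = 0) {μ ν : ℕ} {δ₁ δ₂ : ℝ}
    (hδ₁ : 0 < δ₁) (hδ₂ : 0 < δ₂)
    (hlow : ∀ x : ℝ, x ≠ 0 → |x| ≤ 1 → GramBound p (beamDamping p ε₀ x) x (δ₁ * |x| ^ μ))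
    (hhigh : ∀ x : ℝ, 1 ≤ |x| → GramBound p (beamDamping p ε₀ x) x (δ₂ * (|x| ^ ν)⁻¹)) :
    SymbolDecay p ε₀ μ ν := by
  obtain ⟨K, c, hK, hc, h⟩ := exists_exp_decay hk₁ hk₂ hk₃ hk₄ (lt_min hδ₁ hδ₂)
  refine ⟨K, c, hK, hc, fun x hx Y hY t ht => ?_⟩
  have hx0 : 0 < |x| := abs_pos.mpr hx
  have hd : 0 ≤ beamDamping p ε₀ x := by
    rcases hε with rfl | rfl <;> simp [beamDamping] <;> positivity
  constructor
  · intro hx1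
    refine h _ x _ hd (by positivity) (fun H _ _ X X' B hX => ?_) Y hY t ht
    refine le_trans ?_ (hlow x hx hx1 H X X' B hX)
    gcongr
    exact min_le_left _ _
  · intro hx1
    refine h _ x _ hd (by positivity) (fun H _ _ X X' B hX => ?_) Y hY t ht
    refine le_trans ?_ (hhigh x hx1 H X X' B hX)
    gcongr
    exact min_le_right _ _

theorem beamDamping_low (hk₅ : 0 < p.k₅) {ε₀ x : ℝ} (hε : ε₀ = 1 ∨ ε₀ = 0) (hx : x ≠ 0)
    (hx1 : |x| ≤ 1) : 0 < beamDamping p ε₀ x ∧ beamDamping p ε₀ x ≤ p.k₅ := by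
  have hx2 : x ^ 2 ≤ 1 := (sq_le_one_iff_abs_le_one x).mpr hx1
  rcases hε with rfl | rfl
  · simp only [beamDamping, one_mul, sub_self, zero_mul, add_zero]
    exact ⟨by positivity, mul_le_of_le_one_right hk₅.le hx2⟩
  · simpa [beamDamping] using hk₅

/-- Both kinds of damping lie between k₅ and k₅ x², so a single high-frequency estimate serves both.
-/
theorem beamDamping_high (hk₅ : 0 < p.k₅) {ε₀ x : ℝ} (hε : ε₀ = 1 ∨ ε₀ = 0)
    (hx1 : 1 ≤ |x|) :
    p.k₅ ≤ beamDamping p ε₀ x ∧ beamDamping p ε₀ x ≤ p.k₅ * |x| ^ 2 := by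
  have hx2 : 1 ≤ x ^ 2 := (one_le_sq_iff_one_le_abs x).mpr hx1
  rw [sq_abs]
  rcases hε with rfl | rfl
  · simp only [beamDamping, one_mul, sub_self, zero_mul, add_zero]
    exact ⟨le_mul_of_one_le_right hk₅.le hx2, le_rfl⟩
  · simpa [beamDamping] using le_mul_of_one_le_right hk₅.le hx2

/-- Source of the two low-frequency exponents: the damping contributes |x|² to the rate d |x|^n
exactly when ε₀ = 1. -/
theorem beamDamping_mul_sq {ε₀ : ℝ} (hε : ε₀ = 1 ∨ ε₀ = 0) (x : ℝ) (n : ℕ) :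
    beamDamping p ε₀ x * |x| ^ n = p.k₅ * |x| ^ (n + if ε₀ = 1 then 2 else 0) := by
  rcases hε with rfl | rfl
  · simp only [beamDamping, if_true, pow_add, sq_abs]; ring
  · simp [beamDamping]

theorem gramBound_angle_low (hk₁ : 0 < p.k₁) (hk₂ : 0 < p.k₂) (hk₃ : 0 < p.k₃)
    (hk₄ : 0 < p.k₄) (hk₅ : 0 < p.k₅) (hγ : p.γ ≠ 0) (hτ₁ : p.τ₁ = 0) (hτ₂ : p.τ₂ = 1)
    (hτ₃ : p.τ₃ = 0) {ε₀ : ℝ} (hε : ε₀ = 1 ∨ ε₀ = 0) :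
    ∃ δ : ℝ, 0 < δ ∧ ∀ x : ℝ, x ≠ 0 → |x| ≤ 1 →
      GramBound p (beamDamping p ε₀ x) x (δ * |x| ^ (2 + if ε₀ = 1 then 2 else 0)) := by
  obtain ⟨C, hC, h⟩ := BeamGram.exists_angleBounds hk₁ hk₂ hk₃ hk₄ hγ hτ₁ hτ₂ hτ₃ 1 (.inl rfl)
  obtain ⟨δ, hδ, h'⟩ := AngleBounds.exists_le_low C p.k₅ hC hk₅.le
  refine ⟨δ * p.k₅, by positivity, fun x hx hx1 => gramBound_of_normalized ?_⟩
  intro H _ _ X X' B hX hsum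
  obtain ⟨d0, d1⟩ := beamDamping_low hk₅ hε hx hx1
  rw [mul_assoc, ← beamDamping_mul_sq hε]
  exact h' _ _ _ _ _ _ _ _ _ _ _ (h H X X' _ x B hx d0.le hX) hx1 d0 d1 hsum

theorem gramBound_angle_high (hk₁ : 0 < p.k₁) (hk₂ : 0 < p.k₂) (hk₃ : 0 < p.k₃)
    (hk₄ : 0 < p.k₄) (hk₅ : 0 < p.k₅) (hγ : p.γ ≠ 0) (hτ₁ : p.τ₁ = 0) (hτ₂ : p.τ₂ = 1)
    (hτ₃ : p.τ₃ = 0) {ε₀ : ℝ} (hε : ε₀ = 1 ∨ ε₀ = 0) :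
    ∃ δ : ℝ, 0 < δ ∧ ∀ x : ℝ, 1 ≤ |x| →
      GramBound p (beamDamping p ε₀ x) x (δ * (|x| ^ 6)⁻¹) := by
  obtain ⟨C, hC, h⟩ := BeamGram.exists_angleBounds hk₁ hk₂ hk₃ hk₄ hγ hτ₁ hτ₂ hτ₃ 1 (.inl rfl)
  obtain ⟨δ, hδ, h'⟩ := AngleBounds.exists_le_high C p.k₅ p.k₅ hC hk₅ hk₅
  refine ⟨δ, hδ, fun x hx1 => gramBound_of_normalized ?_⟩
  intro H _ _ X X' B hX hsum
  have hx0 : 0 < |x| := by linarith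
  obtain ⟨d0, d1⟩ := beamDamping_high hk₅ hε hx1
  rw [← div_eq_mul_inv, div_le_iff₀ (by positivity)]
  exact h' _ _ _ _ _ _ _ _ _ _ _ (h H X X' _ x B (abs_pos.mp hx0) (hk₅.le.trans d0) hX) hx1 d0 d1
    hsum

theorem gramBound_angle_high_of_eq (hk₁ : 0 < p.k₁) (hk₂ : 0 < p.k₂) (hk₃ : 0 < p.k₃)
    (hk₄ : 0 < p.k₄) (hk₅ : 0 < p.k₅) (hγ : p.γ ≠ 0) (hτ₁ : p.τ₁ = 0) (hτ₂ : p.τ₂ = 1)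
    (hτ₃ : p.τ₃ = 0) (heq : p.k₁ = p.k₂ ∧ p.k₂ = p.k₃) {ε₀ : ℝ} (hε : ε₀ = 1 ∨ ε₀ = 0) :
    ∃ δ : ℝ, 0 < δ ∧ ∀ x : ℝ, 1 ≤ |x| →
      GramBound p (beamDamping p ε₀ x) x (δ * (|x| ^ 2)⁻¹) := by
  obtain ⟨C, hC, h⟩ := BeamGram.exists_angleBounds hk₁ hk₂ hk₃ hk₄ hγ hτ₁ hτ₂ hτ₃ 0
    (.inr ⟨rfl, heq⟩)
  obtain ⟨δ, hδ, h'⟩ := AngleBounds.exists_le_high_of_eq C p.k₅ p.k₅ hC hk₅ hk₅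
  refine ⟨δ, hδ, fun x hx1 => gramBound_of_normalized ?_⟩
  intro H _ _ X X' B hX hsum
  have hx0 : 0 < |x| := by linarith
  obtain ⟨d0, d1⟩ := beamDamping_high hk₅ hε hx1
  rw [← div_eq_mul_inv, div_le_iff₀ (by positivity)]
  exact h' _ _ _ _ _ _ _ _ _ _ _ (h H X X' _ x B (abs_pos.mp hx0) (hk₅.le.trans d0) hX) hx1 d0 d1
    hsum

theorem symbolDecay_displacement (hk₁ : 0 < p.k₁) (hk₂ : 0 < p.k₂) (hk₃ : 0 < p.k₃)
    (hk₄ : 0 < p.k₄) (hk₅ : 0 < p.k₅) (hγ : p.γ ≠ 0) (hχ : p.χ ≠ 0) (hτ₁ : p.τ₁ = 1)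
    (hτ₂ : p.τ₂ = 0) (hτ₃ : p.τ₃ = 0) {ε₀ : ℝ} (hε : ε₀ = 1 ∨ ε₀ = 0) :
    SymbolDecay p ε₀ (4 + if ε₀ = 1 then 2 else 0) 4 := by
  obtain ⟨C, hC, h⟩ := BeamGram.exists_displacementBounds hk₁ hk₂ hk₃ hk₄ hγ hχ hτ₁ hτ₂ hτ₃
  obtain ⟨δ₁, hδ₁, h₁⟩ := DisplacementBounds.exists_le_low C p.k₅ hC hk₅.le
  obtain ⟨δ₂, hδ₂, h₂⟩ := DisplacementBounds.exists_le_high C p.k₅ p.k₅ hC hk₅ hk₅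
  refine symbolDecay_of_gramBound hk₁ hk₂ hk₃ hk₄ hk₅ hε (by positivity : 0 < δ₁ * p.k₅) hδ₂
    (fun x hx hx1 => gramBound_of_normalized ?_) (fun x hx1 => gramBound_of_normalized ?_)
  · intro H _ _ X X' B hX hsum
    obtain ⟨d0, d1⟩ := beamDamping_low hk₅ hε hx hx1
    obtain ⟨w, c, g, hb⟩ := h H X X' _ x B hx d0.le hX
    rw [mul_assoc, ← beamDamping_mul_sq hε]
    exact h₁ _ _ _ _ _ _ _ _ _ _ _ _ _ _ hb hx1 d0 d1 hsum
  · intro H _ _ X X' B hX hsum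
    have hx0 : 0 < |x| := by linarith
    obtain ⟨d0, d1⟩ := beamDamping_high hk₅ hε hx1
    obtain ⟨w, c, g, hb⟩ := h H X X' _ x B (abs_pos.mp hx0) (hk₅.le.trans d0) hX
    rw [← div_eq_mul_inv, div_le_iff₀ (by positivity)]
    exact h₂ _ _ _ _ _ _ _ _ _ _ _ _ _ _ hb hx1 d0 d1 hsum

theorem symbolDecay_angle (hk₁ : 0 < p.k₁) (hk₂ : 0 < p.k₂) (hk₃ : 0 < p.k₃)
    (hk₄ : 0 < p.k₄) (hk₅ : 0 < p.k₅) (hγ : p.γ ≠ 0)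
    (hτ : (p.τ₁, p.τ₂, p.τ₃) ∈ ({(0, 1, 0), (0, 0, 1)} : Set (ℝ × ℝ × ℝ))) {ε₀ : ℝ}
    (hε : ε₀ = 1 ∨ ε₀ = 0) :
    SymbolDecay p ε₀ (2 + if ε₀ = 1 then 2 else 0) 6 ∧
      (p.k₁ = p.k₂ ∧ p.k₂ = p.k₃ → SymbolDecay p ε₀ (2 + if ε₀ = 1 then 2 else 0) 2) := by
  simp only [mem_insert_iff, mem_singleton_iff, Prod.mk.injEq] at hτ
  rcases hτ with ⟨h1, h2, h3⟩ | ⟨h1, h2, h3⟩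
  · obtain ⟨δ₁, hδ₁, b₁⟩ := gramBound_angle_low hk₁ hk₂ hk₃ hk₄ hk₅ hγ h1 h2 h3 hε
    obtain ⟨δ₂, hδ₂, b₂⟩ := gramBound_angle_high hk₁ hk₂ hk₃ hk₄ hk₅ hγ h1 h2 h3 hε
    refine ⟨symbolDecay_of_gramBound hk₁ hk₂ hk₃ hk₄ hk₅ hε hδ₁ hδ₂ b₁ b₂, fun heq => ?_⟩
    obtain ⟨δ₃, hδ₃, b₃⟩ := gramBound_angle_high_of_eq hk₁ hk₂ hk₃ hk₄ hk₅ hγ h1 h2 h3 heq hε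
    exact symbolDecay_of_gramBound hk₁ hk₂ hk₃ hk₄ hk₅ hε hδ₁ hδ₃ b₁ b₃
  · obtain ⟨δ₁, hδ₁, b₁⟩ := gramBound_angle_low (p := p.swap) hk₁ hk₃ hk₂ hk₄ hk₅ hγ h1 h3 h2 hε
    obtain ⟨δ₂, hδ₂, b₂⟩ := gramBound_angle_high (p := p.swap) hk₁ hk₃ hk₂ hk₄ hk₅ hγ h1 h3 h2 hε
    refine ⟨symbolDecay_of_gramBound hk₁ hk₂ hk₃ hk₄ hk₅ hε hδ₁ hδ₂
      (fun x hx hx1 => (b₁ x hx hx1).of_swap) (fun x hx1 => (b₂ x hx1).of_swap), fun heq => ?_⟩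
    obtain ⟨δ₃, hδ₃, b₃⟩ := gramBound_angle_high_of_eq (p := p.swap) hk₁ hk₃ hk₂ hk₄ hk₅ hγ h1 h3 h2
      ⟨heq.1.trans heq.2, heq.2.symm⟩ hε
    exact symbolDecay_of_gramBound hk₁ hk₂ hk₃ hk₄ hk₅ hε hδ₁ hδ₃
      (fun x hx hx1 => (b₁ x hx hx1).of_swap) (fun x hx1 => (b₃ x hx1).of_swap)

end SymbolDecay

/-! ### Weak solutions of pointwise linear equations in L². -/

section Multiplication

variable {E : Type*} [NormedAddCommGroup E] [NormedSpace ℂ E]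

/-- Multiplication by a continuous operator valued function, cut off to a bounded interval, is
bounded on `L²`. -/
theorem exists_multiplication_operator {m : ℝ → E →L[ℂ] E} (hm : Continuous m) (R : ℝ) :
    ∃ M : Lp E 2 (volume : Measure ℝ) →L[ℂ] Lp E 2 (volume : Measure ℝ), ∀ f,
      ∀ᵐ ξ, M f ξ = (Ioo (-R) R).indicator (fun ξ => m ξ (f ξ)) ξ := by
  obtain ⟨C, hC⟩ := isCompact_Icc.exists_bound_of_continuousOn (s := Icc (-R) R) hm.continuousOn
  have hC0 : ∀ ξ, ‖(Ioo (-R) R).indicator m ξ‖ ≤ max C 0 := fun ξ => by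
    by_cases h : ξ ∈ Ioo (-R) R
    · rw [indicator_of_mem h]
      exact (hC ξ (Ioo_subset_Icc_self h)).trans (le_max_left _ _)
    · rw [indicator_of_notMem h, norm_zero]
      exact le_max_right _ _
  have hL : MemLp ((Ioo (-R) R).indicator m) ∞ (volume : Measure ℝ) :=
    memLp_top_of_bound (hm.aestronglyMeasurable.indicator measurableSet_Ioo) _ (.of_forall hC0)
  refine ⟨(ContinuousLinearMap.id ℂ (E →L[ℂ] E)).holderL volume ∞ 2 2 hL.toLp, fun f => ?_⟩
  rw [ContinuousLinearMap.holderL_apply_apply]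
  filter_upwards [(ContinuousLinearMap.id ℂ (E →L[ℂ] E)).coeFn_holder (r := 2) hL.toLp f,
    hL.coeFn_toLp] with ξ h1 h2
  rw [h1, h2]
  by_cases h : ξ ∈ Ioo (-R) R
  · simp [indicator_of_mem h]
  · simp [indicator_of_notMem h]

variable {m : ℝ → E →L[ℂ] E} {R : ℝ}
  {M : Lp E 2 (volume : Measure ℝ) →L[ℂ] Lp E 2 (volume : Measure ℝ)}

theorem multiplication_operator_pow
    (hM : ∀ f, ∀ᵐ ξ, M f ξ = (Ioo (-R) R).indicator (fun ξ => m ξ (f ξ)) ξ)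
    (f : Lp E 2 (volume : Measure ℝ)) (n : ℕ) :
    ∀ᵐ ξ, ξ ∈ Ioo (-R) R → (M ^ n) f ξ = (m ξ ^ n) (f ξ) := by
  induction n with
  | zero => exact .of_forall fun ξ _ => by simp
  | succ n ih =>
    filter_upwards [ih, hM ((M ^ n) f)] with ξ h1 h2 hξ
    rw [pow_succ', pow_succ']
    change M ((M ^ n) f) ξ = m ξ ((m ξ ^ n) (f ξ))
    rw [h2, indicator_of_mem hξ, h1 hξ]

theorem multiplication_operator_exp [CompleteSpace E]
    (hM : ∀ f, ∀ᵐ ξ, M f ξ = (Ioo (-R) R).indicator (fun ξ => m ξ (f ξ)) ξ)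
    (f : Lp E 2 (volume : Measure ℝ)) (z : ℂ) :
    ∀ᵐ ξ, ξ ∈ Ioo (-R) R → NormedSpace.exp (z • M) f ξ = NormedSpace.exp (z • m ξ) (f ξ) := by
  have h1 : Filter.Tendsto (fun N => ∑ n ∈ Finset.range N, (n.factorial⁻¹ : ℂ) • ((z • M) ^ n) f)
      Filter.atTop (nhds (NormedSpace.exp (z • M) f)) := by
    have := ((NormedSpace.exp_series_hasSum_exp' (𝕂 := ℂ) (z • M)).mapL
      (ContinuousLinearMap.apply ℂ _ f)).tendsto_sum_nat
    simpa using this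
  -- The L² limit of the partial sums is an almost everywhere limit along a subsequence, while the
  -- pointwise exponential series converges at every ξ. The limits must agree.
  obtain ⟨ns, hns, hlim⟩ := (tendstoInMeasure_of_tendsto_Lp h1).exists_seq_tendsto_ae
  have h2 : ∀ᵐ ξ, ∀ N : ℕ, (∑ n ∈ Finset.range N, (n.factorial⁻¹ : ℂ) • ((z • M) ^ n) f :
      Lp E 2 (volume : Measure ℝ)) ξ
        = ∑ n ∈ Finset.range N, ((n.factorial⁻¹ : ℂ) • ((z • M) ^ n) f : Lp E 2 _) ξ := by
    rw [ae_all_iff]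
    intro N
    filter_upwards [Lp.coeFn_finsetSum (Finset.range N)
      (fun n => (n.factorial⁻¹ : ℂ) • ((z • M) ^ n) f)] with ξ h
    rw [h, Finset.sum_apply]
  have h3 : ∀ᵐ ξ, ∀ n : ℕ, ξ ∈ Ioo (-R) R → ((n.factorial⁻¹ : ℂ) • ((z • M) ^ n) f : Lp E 2 _) ξ
      = (n.factorial⁻¹ : ℂ) • ((z • m ξ) ^ n) (f ξ) := by
    rw [ae_all_iff]
    intro n
    have e : (n.factorial⁻¹ : ℂ) • ((z • M) ^ n) f
        = ((n.factorial⁻¹ : ℂ) * z ^ n) • (M ^ n) f := by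
      rw [smul_pow, smul_apply, smul_smul]
    rw [e]
    filter_upwards [Lp.coeFn_smul ((n.factorial⁻¹ : ℂ) * z ^ n) ((M ^ n) f),
      multiplication_operator_pow hM f n] with ξ h4 h5 hξ
    rw [h4, Pi.smul_apply, h5 hξ, smul_pow, smul_apply, smul_smul]
  filter_upwards [hlim, h2, h3] with ξ h4 h5 h6 hξ
  have h7 := ((NormedSpace.exp_series_hasSum_exp' (𝕂 := ℂ) (z • m ξ)).mapL
      (ContinuousLinearMap.apply ℂ _ (f ξ))).tendsto_sum_nat.comp hns.tendsto_atTop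
  refine tendsto_nhds_unique h4 (h7.congr fun i => ?_)
  rw [Function.comp_apply, h5]
  refine Finset.sum_congr rfl fun n _ => ?_
  rw [h6 n hξ]
  simp

/-- A weak solution of `V_t = m V` in `L²`, tested with functions supported in an open interval, is
given there by the matrix exponential. -/
theorem ae_eq_exp_of_weak_solution [CompleteSpace E] (hm : Continuous m) (R : ℝ)
    {V : ℝ → Lp E 2 (volume : Measure ℝ)} (hV : ContinuousOn V (Ici 0))
    (h : ∀ t, 0 < t → ∀ g : 𝓢(ℝ, ℂ), HasCompactSupport g →
      HasDerivAt (fun s => (V s : 𝓢'(ℝ, E)) g) (∫ ξ, g ξ • m ξ (V t ξ)) t) {t : ℝ} (ht : 0 ≤ t) :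
    ∀ᵐ ξ, ξ ∈ Ioo (-R) R → V t ξ = NormedSpace.exp ((t : ℂ) • m ξ) (V 0 ξ) := by
  obtain ⟨M, hM⟩ := exists_multiplication_operator hm R
  -- V is constrained only for s ≥ 0; its constant extension is continuous on the whole line.
  set V' : ℝ → Lp E 2 (volume : Measure ℝ) := fun s => V (max s 0) with hV'
  have hV'c : Continuous V' :=
    hV.comp_continuous (continuous_id.max continuous_const) fun s => mem_Ici.mpr (le_max_right _ _)
  -- V is only weakly differentiable, and only for positive times. Z is a norm-differentiable
  -- substitute that will agree with V on the interval.
  set Z : ℝ → Lp E 2 (volume : Measure ℝ) := fun s => V 0 + ∫ r in (0 : ℝ)..s, M (V' r) with hZ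
  have hMc : Continuous fun r => M (V' r) := M.continuous.comp hV'c
  have hZd : ∀ s, HasDerivAt Z (M (V' s)) s := fun s =>
    (intervalIntegral.integral_hasDerivAt_right (hMc.intervalIntegrable _ _)
      (hMc.stronglyMeasurableAtFilter _ _) hMc.continuousAt).const_add _
  have hZV : ∀ s, 0 ≤ s → ∀ᵐ ξ, ξ ∈ Ioo (-R) R → Z s ξ = V s ξ := by
    intro s hs
    have hloc : LocallyIntegrableOn (fun ξ => Z s ξ - V s ξ) (Ioo (-R) R) volume := by
      have h1 : LocallyIntegrable (Z s) volume := (Lp.memLp (Z s)).locallyIntegrable (by norm_num)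
      have h2 : LocallyIntegrable (V s) volume := (Lp.memLp (V s)).locallyIntegrable (by norm_num)
      exact (h1.sub h2).locallyIntegrableOn _
    have := isOpen_Ioo.ae_eq_zero_of_integral_contDiff_smul_eq_zero hloc ?_
    · filter_upwards [this] with ξ h1 hξ
      exact sub_eq_zero.mp (h1 hξ)
    intro g hg hgc hgs
    have hgc' : HasCompactSupport (fun ξ => (g ξ : ℂ)) := hgc.comp_left Complex.ofReal_zero
    set G : 𝓢(ℝ, ℂ) := hgc'.toSchwartzMap (Complex.ofRealCLM.contDiff.comp hg) with hG
    have hGg : ∀ ξ, G ξ = (g ξ : ℂ) := fun ξ => rfl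
    set T : Lp E 2 (volume : Measure ℝ) →L[ℂ] E :=
      (PointwiseConvergenceCLM.evalCLM (RingHom.id ℂ) E G).comp
        (Lp.toTemperedDistributionCLM E (volume : Measure ℝ) 2) with hT
    have hTa : ∀ f : Lp E 2 (volume : Measure ℝ), T f = ∫ ξ, G ξ • f ξ := fun f =>
      Lp.toTemperedDistribution_apply f G
    have hTM : ∀ f : Lp E 2 (volume : Measure ℝ), T (M f) = ∫ ξ, G ξ • m ξ (f ξ) := fun f => by
      rw [hTa]
      refine integral_congr_ae ?_
      filter_upwards [hM f] with ξ h1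
      by_cases hξ : ξ ∈ Ioo (-R) R
      · rw [h1, indicator_of_mem hξ]
      · rw [hGg, image_eq_zero_of_notMem_tsupport fun h => hξ (hgs h), Complex.ofReal_zero,
          zero_smul, zero_smul]
    -- On the support of the test function the cutoff is invisible, so Z and V have the same weak
    -- derivative.
    have hd : ∀ r ∈ Ioo 0 s, HasDerivAt (fun r => T (Z r - V r)) 0 r := by
      intro r hr
      have e1 : HasDerivAt (fun r => T (Z r)) (T (M (V' r))) r :=
        (T.restrictScalars ℝ).hasFDerivAt.comp_hasDerivAt r (hZd r)
      have e2 : HasDerivAt (fun r => T (V r)) (∫ ξ, G ξ • m ξ (V r ξ)) r := h r hr.1 G hgc'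
      have e3 : V' r = V r := by simp only [hV', max_eq_left hr.1.le]
      have := e1.sub e2
      rw [hTM, e3, sub_self] at this
      simpa only [map_sub] using! this
    have hc : ContinuousOn (fun r => T (Z r - V r)) (Icc 0 s) := by
      refine T.continuous.comp_continuousOn (ContinuousOn.sub ?_ (hV.mono Icc_subset_Ici_self))
      exact fun r _ => (hZd r).continuousAt.continuousWithinAt
    have key : T (Z s - V s) = 0 := by
      rcases hs.eq_or_lt with rfl | hs'
      · simp [hZ]
      · have h0 : T (Z 0 - V 0) = 0 := by simp [hZ]
        rw [← h0]
        have hI := intervalIntegral.integral_eq_sub_of_hasDerivAt_of_le hs hc hd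
          intervalIntegrable_const
        rw [intervalIntegral.integral_zero] at hI
        exact sub_eq_zero.mp hI.symm
    rw [← key, hTa]
    refine integral_congr_ae ?_
    filter_upwards [Lp.coeFn_sub (Z s) (V s)] with ξ h1
    rw [h1, hGg, Pi.sub_apply, Complex.coe_smul]
  -- M sees only (-R, R), where Z = V. Hence Z solves the closed equation Z' = M Z with bounded M,
  -- and uniqueness identifies it with the exponential.
  have hMZ : ∀ s, 0 ≤ s → M (V' s) = M (Z s) := by
    intro s hs
    have e3 : V' s = V s := by simp only [hV', max_eq_left hs]
    rw [e3]
    refine Lp.ext ?_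
    filter_upwards [hM (V s), hM (Z s), hZV s hs] with ξ h1 h2 h3
    rw [h1, h2]
    by_cases hξ : ξ ∈ Ioo (-R) R
    · rw [indicator_of_mem hξ, indicator_of_mem hξ, h3 hξ]
    · rw [indicator_of_notMem hξ, indicator_of_notMem hξ]
  set W : ℝ → Lp E 2 (volume : Measure ℝ) := fun s => NormedSpace.exp ((s : ℂ) • M) (V 0) with hW
  have hWd : ∀ s, HasDerivAt W (M (W s)) s := fun s => by
    have h1 := (hasDerivAt_exp_smul_const' (𝕂 := ℂ) M (s : ℂ)).scomp s Complex.ofRealCLM.hasDerivAt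
    rw [Complex.ofRealCLM_apply, Complex.ofReal_one, one_smul] at h1
    exact (((ContinuousLinearMap.apply ℂ _ (V 0)).restrictScalars ℝ).hasFDerivAt).comp_hasDerivAt s
      h1
  have hEq : EqOn Z W (Icc 0 t) := by
    refine ODE_solution_unique (v := fun _ f => M f) (K := ‖M‖₊) (fun _ => M.lipschitz)
      (fun r _ => (hZd r).continuousAt.continuousWithinAt)
      (fun r hr => ?_) (fun r _ => (hWd r).continuousAt.continuousWithinAt)
      (fun r _ => (hWd r).hasDerivWithinAt) ?_
    · rw [← hMZ r hr.1]
      exact (hZd r).hasDerivWithinAt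
    · have : ((0 : ℝ) : ℂ) • M = 0 := by rw [Complex.ofReal_zero, zero_smul]
      simp only [hZ, hW, this, NormedSpace.exp_zero, intervalIntegral.integral_same, add_zero]
      rfl
  have hZW : Z t = W t := hEq ⟨ht, le_rfl⟩
  filter_upwards [hZV t ht, multiplication_operator_exp hM (V 0) (t : ℂ)] with ξ h1 h2 hξ
  rw [← h1 hξ, hZW, ← h2 hξ]

end Multiplication

/-! ### The beam system on the Fourier side. -/

section FourierSide

open FourierTransform

variable (p : BeamCoeffs) (ε₀ : ℝ)

/-- The matrix `A₂` as a continuous linear map. -/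
noncomputable def BeamCoeffs.A₂L : BeamState →L[ℂ] BeamState :=
  LinearMap.toContinuousLinearMap
    { toFun := p.A₂ ε₀
      map_add' := fun X Y => by ext i; fin_cases i <;> simp [BeamCoeffs.A₂]; ring
      map_smul' := fun c X => by ext i; fin_cases i <;> simp [BeamCoeffs.A₂]; ring }

/-- The matrix `A₁` as a continuous linear map. -/
noncomputable def BeamCoeffs.A₁L : BeamState →L[ℂ] BeamState :=
  LinearMap.toContinuousLinearMap
    { toFun := p.A₁
      map_add' := fun X Y => by ext i; fin_cases i <;> simp [BeamCoeffs.A₁] <;> ring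
      map_smul' := fun c X => by ext i; fin_cases i <;> simp [BeamCoeffs.A₁] <;> ring }

/-- The matrix `A₀` as a continuous linear map. -/
noncomputable def BeamCoeffs.A₀L : BeamState →L[ℂ] BeamState :=
  LinearMap.toContinuousLinearMap
    { toFun := p.A₀ ε₀
      map_add' := fun X Y => by ext i; fin_cases i <;> simp [BeamCoeffs.A₀] <;> ring
      map_smul' := fun c X => by ext i; fin_cases i <;> simp [BeamCoeffs.A₀] <;> ring }

theorem BeamCoeffs.A₂L_apply (X : BeamState) : p.A₂L ε₀ X = p.A₂ ε₀ X := rfl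
theorem BeamCoeffs.A₁L_apply (X : BeamState) : p.A₁L X = p.A₁ X := rfl
theorem BeamCoeffs.A₀L_apply (X : BeamState) : p.A₀L ε₀ X = p.A₀ ε₀ X := rfl

/-- The Fourier symbol of `-(A₂ ∂_xx + A₁ ∂_x + A₀)`, where `ζ` stands for the symbol of `∂_x`. -/
noncomputable def beamSymbol (ζ : ℂ) : BeamState →L[ℂ] BeamState :=
  -(ζ ^ 2 • p.A₂L ε₀ + ζ • p.A₁L + p.A₀L ε₀)

theorem continuous_beamSymbol : Continuous (beamSymbol p ε₀) := by
  unfold beamSymbol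
  fun_prop

/-- At ζ = i x the second-order term becomes the damping ε₀ k₅ x². With the Fourier convention used
here, x = 2πξ. -/
theorem beamSymbol_apply (x : ℝ) (X : BeamState) (a : Fin 8) :
    beamSymbol p ε₀ (Complex.I * x) X a = beamField p (beamDamping p ε₀ x) x X a := by
  simp only [beamSymbol, neg_apply, add_apply, smul_apply, BeamCoeffs.A₂L_apply,
    BeamCoeffs.A₁L_apply, BeamCoeffs.A₀L_apply, PiLp.neg_apply, PiLp.add_apply, PiLp.smul_apply,
    mul_pow, Complex.I_sq]
  fin_cases a <;> simp [BeamCoeffs.A₂, BeamCoeffs.A₁, BeamCoeffs.A₀, beamField, beamDamping] <;>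
    ring

theorem hasTemperateGrowth_two_pi_I_mul_pow (n : ℕ) :
    Function.HasTemperateGrowth fun ξ : ℝ => (2 * Real.pi * Complex.I * ξ : ℂ) ^ n := by
  have h : Function.HasTemperateGrowth fun ξ : ℝ => (ξ : ℂ) := by fun_prop
  fun_prop

theorem fourier_distDeriv (T : 𝓢'(ℝ, BeamState)) :
    𝓕 (distDeriv T) = smulLeftCLM BeamState (fun ξ : ℝ => (2 * Real.pi * Complex.I * ξ : ℂ))
      (𝓕 T) := by
  have h : Function.HasTemperateGrowth fun ξ : ℝ => (ξ : ℂ) := by fun_prop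
  have e : (fun ξ : ℝ => (2 * Real.pi * Complex.I * ξ : ℂ))
      = (2 * Real.pi * Complex.I : ℂ) • fun ξ : ℝ => (ξ : ℂ) := by
    ext ξ
    simp
  rw [distDeriv, fourier_lineDerivOp_eq, e, smulLeftCLM_smul h]
  simp

theorem fourier_distDeriv_iterate (T : 𝓢'(ℝ, BeamState)) (n : ℕ) :
    𝓕 (distDeriv^[n] T)
      = smulLeftCLM BeamState (fun ξ : ℝ => (2 * Real.pi * Complex.I * ξ : ℂ) ^ n) (𝓕 T) := by
  induction n with
  | zero => simp
  | succ n ih =>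
    rw [Function.iterate_succ_apply', fourier_distDeriv, ih, smulLeftCLM_smulLeftCLM_apply
      (hasTemperateGrowth_two_pi_I_mul_pow n)
      (by simpa using hasTemperateGrowth_two_pi_I_mul_pow 1)]
    simp only [Pi.mul_def, pow_succ]

theorem integrable_schwartz_smul (g : 𝓢(ℝ, ℂ)) (f : Lp BeamState 2 (volume : Measure ℝ)) :
    Integrable fun ξ => g ξ • f ξ :=
  memLp_one_iff_integrable.mp ((Lp.memLp f).smul (p := 2) (q := 2) (g.memLp 2))

theorem fourier_distDeriv_iterate_apply (f : Lp BeamState 2 (volume : Measure ℝ)) (n : ℕ)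
    (g : 𝓢(ℝ, ℂ)) :
    𝓕 (distDeriv^[n] (f : 𝓢'(ℝ, BeamState))) g
        = ∫ ξ, g ξ • (2 * Real.pi * Complex.I * ξ : ℂ) ^ n • 𝓕 f ξ ∧
      Integrable fun ξ => g ξ • (2 * Real.pi * Complex.I * ξ : ℂ) ^ n • 𝓕 f ξ := by
  have e : ∀ ξ, SchwartzMap.smulLeftCLM ℂ (fun ξ : ℝ => (2 * Real.pi * Complex.I * ξ : ℂ) ^ n) g ξ
      • 𝓕 f ξ = g ξ • (2 * Real.pi * Complex.I * ξ : ℂ) ^ n • 𝓕 f ξ := fun ξ => by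
    rw [SchwartzMap.smulLeftCLM_apply_apply (hasTemperateGrowth_two_pi_I_mul_pow n), smul_smul,
      smul_eq_mul, mul_comm]
  constructor
  · rw [fourier_distDeriv_iterate, smulLeftCLM_apply_apply, Lp.fourier_toTemperedDistribution_eq,
      Lp.toTemperedDistribution_apply]
    simp_rw [e]
  · simp_rw [← e]
    exact integrable_schwartz_smul _ _

variable {p ε₀} {U₀ : Lp BeamState 2 (volume : Measure ℝ)}
  {U : ℝ → Lp BeamState 2 (volume : Measure ℝ)}

/-- The equation is tested with 𝓕 g, which moves the transform onto the distribution and turns ∂_x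
into 2πiξ. The rapid decay of g makes the resulting products integrable. -/
theorem IsBeamSolution.hasDerivAt_fourier (hU : IsBeamSolution p ε₀ U₀ U) {t : ℝ} (ht : 0 < t)
    (g : 𝓢(ℝ, ℂ)) :
    HasDerivAt (fun s => ((𝓕 (U s) : Lp BeamState 2 (volume : Measure ℝ)) : 𝓢'(ℝ, BeamState)) g)
      (∫ ξ, g ξ • beamSymbol p ε₀ (2 * Real.pi * Complex.I * ξ) (𝓕 (U t) ξ)) t := by
  have h := hU.equation t ht (𝓕 g)
  obtain ⟨e2, i2⟩ := fourier_distDeriv_iterate_apply (U t) 2 g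
  obtain ⟨e1, i1⟩ := fourier_distDeriv_iterate_apply (U t) 1 g
  obtain ⟨e0, i0⟩ := fourier_distDeriv_iterate_apply (U t) 0 g
  change distDeriv (distDeriv (U t : 𝓢'(ℝ, BeamState))) (𝓕 g) = _ at e2
  change distDeriv (U t : 𝓢'(ℝ, BeamState)) (𝓕 g) = _ at e1
  change (U t : 𝓢'(ℝ, BeamState)) (𝓕 g) = _ at e0
  simp only [e2, e1, e0, ← BeamCoeffs.A₂L_apply, ← BeamCoeffs.A₁L_apply,
    ← BeamCoeffs.A₀L_apply] at h
  rw [← ContinuousLinearMap.integral_comp_comm _ i2, ← ContinuousLinearMap.integral_comp_comm _ i1,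
    ← ContinuousLinearMap.integral_comp_comm _ i0,
    ← integral_add (ContinuousLinearMap.integrable_comp _ i2)
      (ContinuousLinearMap.integrable_comp _ i1),
    ← integral_add ((ContinuousLinearMap.integrable_comp _ i2).add
      (ContinuousLinearMap.integrable_comp _ i1)) (ContinuousLinearMap.integrable_comp _ i0),
    ← integral_neg] at h
  simp_rw [← Lp.fourier_toTemperedDistribution_eq]
  change HasDerivAt (fun s => (U s : 𝓢'(ℝ, BeamState)) (𝓕 g)) _ t
  convert h using 1
  refine integral_congr_ae (.of_forall fun ξ => ?_)
  simp only [beamSymbol, neg_apply, add_apply, smul_apply, map_smul, smul_neg, smul_add, pow_one,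
    pow_zero, one_smul]

/-- The symbol is unbounded in ξ, so the representation is obtained on each interval (-n, n), and
countably many null sets are discarded. -/
theorem IsBeamSolution.fourier_ae_eq (hU : IsBeamSolution p ε₀ U₀ U) {t : ℝ} (ht : 0 ≤ t) :
    ∀ᵐ ξ : ℝ, 𝓕 (U t) ξ = NormedSpace.exp
      ((t : ℂ) • beamSymbol p ε₀ (2 * Real.pi * Complex.I * ξ)) (𝓕 U₀ ξ) := by
  have hm : Continuous fun ξ : ℝ => beamSymbol p ε₀ (2 * Real.pi * Complex.I * ξ) :=
    (continuous_beamSymbol p ε₀).comp (by fun_prop)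
  have hV : ContinuousOn (fun s => (𝓕 (U s) : Lp BeamState 2 (volume : Measure ℝ))) (Ici 0) :=
    (Lp.fourierTransformₗᵢ ℝ BeamState).continuous.comp_continuousOn hU.continuousOn
  have h : ∀ᵐ ξ : ℝ, ∀ n : ℕ, ξ ∈ Ioo (-(n : ℝ)) n → 𝓕 (U t) ξ = NormedSpace.exp
      ((t : ℂ) • beamSymbol p ε₀ (2 * Real.pi * Complex.I * ξ)) (𝓕 U₀ ξ) := by
    rw [ae_all_iff]
    intro n
    have := ae_eq_exp_of_weak_solution hm n hV (fun s hs g _ => hU.hasDerivAt_fourier hs g) ht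
    rwa [hU.initial] at this
  filter_upwards [h] with ξ hξ
  obtain ⟨n, hn⟩ := exists_nat_gt |ξ|
  exact hξ n (abs_lt.mp hn)

theorem norm_exp_beamSymbol_sq_le {μ ν : ℕ} (h : SymbolDecay p ε₀ μ ν) :
    ∃ K c : ℝ, 0 < K ∧ 0 < c ∧ ∀ x : ℝ, x ≠ 0 → ∀ X : BeamState, ∀ t : ℝ, 0 ≤ t →
      (|x| ≤ 1 → ‖NormedSpace.exp ((t : ℂ) • beamSymbol p ε₀ (Complex.I * x)) X‖ ^ 2
        ≤ K * Real.exp (-(c * |x| ^ μ * t)) * ‖X‖ ^ 2) ∧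
      (1 ≤ |x| → ‖NormedSpace.exp ((t : ℂ) • beamSymbol p ε₀ (Complex.I * x)) X‖ ^ 2
        ≤ K * Real.exp (-(c * (|x| ^ ν)⁻¹ * t)) * ‖X‖ ^ 2) := by
  obtain ⟨K, c, hK, hc, h⟩ := h
  refine ⟨K, c, hK, hc, fun x hx X t ht => ?_⟩
  set m := beamSymbol p ε₀ (Complex.I * x) with hm
  have hd : ∀ s : ℝ, HasDerivAt (fun r : ℝ => NormedSpace.exp ((r : ℂ) • m) X)
      (m (NormedSpace.exp ((s : ℂ) • m) X)) s := fun s => by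
    have h1 := (hasDerivAt_exp_smul_const' (𝕂 := ℂ) m (s : ℂ)).scomp s Complex.ofRealCLM.hasDerivAt
    rw [Complex.ofRealCLM_apply, Complex.ofReal_one, one_smul] at h1
    exact (((ContinuousLinearMap.apply ℂ _ X).restrictScalars ℝ).hasFDerivAt).comp_hasDerivAt s h1
  have := h x hx (fun s a => NormedSpace.exp ((s : ℂ) • m) X a) (fun s a => by
    rw [← beamSymbol_apply, ← hm]
    exact ((EuclideanSpace.proj (𝕜 := ℂ) a).restrictScalars ℝ).hasFDerivAt.comp_hasDerivAt s
      (hd s)) t ht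
  have h0 : NormedSpace.exp (((0 : ℝ) : ℂ) • m) X = X := by
    have : ((0 : ℝ) : ℂ) • m = 0 := by
      rw [Complex.ofReal_zero]
      exact zero_smul ℂ m
    rw [this, NormedSpace.exp_zero]
    rfl
  simpa only [h0, ← EuclideanSpace.norm_sq_eq] using this

end FourierSide

/-! ### Fourier bounds and Plancherel's theorem for derivatives. -/

section FourierNorms

open FourierTransform

theorem ae_eq_of_integral_schwartz_smul_eq {E : Type*} [NormedAddCommGroup E] [NormedSpace ℂ E]
    [CompleteSpace E]
    {f f' : ℝ → E} (hf : LocallyIntegrable f volume) (hf' : LocallyIntegrable f' volume)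
    (h : ∀ g : 𝓢(ℝ, ℂ), ∫ ξ, g ξ • f ξ = ∫ ξ, g ξ • f' ξ) : ∀ᵐ ξ, f ξ = f' ξ := by
  refine ae_eq_of_integral_contDiff_smul_eq hf hf' fun g hg hgc => ?_
  have hgc' : HasCompactSupport (fun ξ => (g ξ : ℂ)) := hgc.comp_left Complex.ofReal_zero
  have := h (hgc'.toSchwartzMap (Complex.ofRealCLM.contDiff.comp hg))
  have e : ∀ ξ, (hgc'.toSchwartzMap (Complex.ofRealCLM.contDiff.comp hg)) ξ = (g ξ : ℂ) :=
    fun ξ => rfl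
  simpa only [e, Complex.coe_smul] using this

/-- The Fourier transform of a function in `L¹ ∩ L²` is bounded by the `L¹` norm. -/
theorem ae_norm_fourier_le (f : Lp BeamState 2 (volume : Measure ℝ))
    (hf : MemLp (fun x : ℝ => f x) 1 volume) : ∀ᵐ ξ : ℝ, ‖𝓕 f ξ‖ ≤ ∫ x, ‖f x‖ := by
  have hi : Integrable (fun x : ℝ => f x) volume := memLp_one_iff_integrable.mp hf
  have hc : Continuous (𝓕 (fun x : ℝ => f x)) :=
    VectorFourier.fourierIntegral_continuous Real.continuous_fourierChar
      (by exact continuous_inner) hi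
  -- The L² transform and the integral transform agree against Schwartz functions, hence almost
  -- everywhere; the integral bounds the latter pointwise.
  have h := ae_eq_of_integral_schwartz_smul_eq
    ((Lp.memLp (𝓕 f)).locallyIntegrable (by norm_num)) hc.locallyIntegrable fun g => ?_
  · filter_upwards [h] with ξ hξ
    rw [hξ]
    exact VectorFourier.norm_fourierIntegral_le_integral_norm _ _ _ _ _
  · rw [← Lp.toTemperedDistribution_apply, ← Lp.fourier_toTemperedDistribution_eq,
      TemperedDistribution.fourier_apply, Lp.toTemperedDistribution_apply, SchwartzMap.fourier_coe]
    have := VectorFourier.integral_fourierIntegral_smul_eq_flip (L := innerₗ ℝ)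
      Real.continuous_fourierChar continuous_inner (g.integrable (μ := volume)) hi
    rw [flip_innerₗ] at this
    exact this

/-- Plancherel's theorem for the derivatives of a square integrable function. -/
theorem distL2Norm_distDeriv_iterate (f : Lp BeamState 2 (volume : Measure ℝ)) (n : ℕ) :
    distL2Norm (distDeriv^[n] (f : 𝓢'(ℝ, BeamState)))
      = eLpNorm (fun ξ : ℝ => (2 * Real.pi * Complex.I * ξ : ℂ) ^ n • 𝓕 f ξ) 2 volume := by
  have hcont : Continuous fun ξ : ℝ => (2 * Real.pi * Complex.I * ξ : ℂ) ^ n := by fun_prop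
  have hF : AEStronglyMeasurable (fun ξ : ℝ => (2 * Real.pi * Complex.I * ξ : ℂ) ^ n • 𝓕 f ξ)
      volume := hcont.aestronglyMeasurable.smul (Lp.aestronglyMeasurable _)
  have hloc : LocallyIntegrable (fun ξ : ℝ => (2 * Real.pi * Complex.I * ξ : ℂ) ^ n • 𝓕 f ξ)
      volume :=
    LocallyIntegrable.continuous_smul hcont ((Lp.memLp (𝓕 f)).locallyIntegrable (by norm_num))
  apply le_antisymm
  · rcases eq_or_ne (eLpNorm (fun ξ : ℝ => (2 * Real.pi * Complex.I * ξ : ℂ) ^ n • 𝓕 f ξ) 2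
      volume) ⊤ with h | h
    · rw [h]
      exact le_top
    have hm : MemLp (fun ξ : ℝ => (2 * Real.pi * Complex.I * ξ : ℂ) ^ n • 𝓕 f ξ) 2 volume :=
      ⟨hF, h.lt_top⟩
    have e : distDeriv^[n] (f : 𝓢'(ℝ, BeamState))
        = ((𝓕⁻ hm.toLp : Lp BeamState 2 (volume : Measure ℝ)) : 𝓢'(ℝ, BeamState)) := by
      rw [← Lp.fourierInv_toTemperedDistribution_eq]
      have h1 : distDeriv^[n] (f : 𝓢'(ℝ, BeamState))
          = 𝓕⁻ (𝓕 (distDeriv^[n] (f : 𝓢'(ℝ, BeamState))) : 𝓢'(ℝ, BeamState)) :=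
        (fourierInv_fourier_eq _).symm
      rw [h1]
      congr 1
      ext1 g
      rw [(fourier_distDeriv_iterate_apply f n g).1, Lp.toTemperedDistribution_apply]
      refine integral_congr_ae ?_
      filter_upwards [hm.coeFn_toLp] with ξ hξ
      rw [hξ]
    rw [e, distL2Norm_coe, ← ofReal_norm, ← Lp.norm_fourier_eq, fourier_fourierInv_eq,
      ofReal_norm, Lp.enorm_toLp]
  · refine le_iInf fun g => le_iInf fun hg => le_of_eq ?_
    have h := ae_eq_of_integral_schwartz_smul_eq hloc
      ((Lp.memLp (𝓕 g)).locallyIntegrable (by norm_num)) fun u => by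
        rw [← (fourier_distDeriv_iterate_apply f n u).1, hg, Lp.fourier_toTemperedDistribution_eq,
          Lp.toTemperedDistribution_apply]
    rw [eLpNorm_congr_ae h, ← Lp.enorm_def, ← ofReal_norm, Lp.norm_fourier_eq, ofReal_norm]

end FourierNorms

/-! ### Integrals over low frequencies. -/

section FrequencyIntegrals

/-- From y ≤ exp y at y = b s / a, raised to the power a. -/
theorem exists_rpow_mul_exp_neg_le {a b : ℝ} (ha : 0 < a) (hb : 0 < b) :
    ∃ C : ℝ, 0 < C ∧ ∀ s : ℝ, 0 ≤ s → s ^ a * Real.exp (-(b * s)) ≤ C := by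
  refine ⟨(a / b) ^ a, by positivity, fun s hs => ?_⟩
  have h1 : b * s / a ≤ Real.exp (b * s / a) := by
    linarith [Real.add_one_le_exp (b * s / a)]
  have h2 := Real.rpow_le_rpow (by positivity) h1 ha.le
  rw [← Real.exp_mul, div_mul_cancel₀ _ ha.ne'] at h2
  have h3 : s = a / b * (b * s / a) := by field_simp
  calc s ^ a * Real.exp (-(b * s))
      = (a / b) ^ a * ((b * s / a) ^ a * Real.exp (-(b * s))) := by
        conv_lhs => rw [h3, Real.mul_rpow (by positivity) (by positivity)]
        rw [show a / b * (b * s / a) = s by field_simp]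
        ring
    _ ≤ (a / b) ^ a * (Real.exp (b * s) * Real.exp (-(b * s))) := by gcongr
    _ = (a / b) ^ a := by rw [← Real.exp_add, add_neg_cancel, Real.exp_zero, mul_one]

/-- Powers of the frequency against the decay of low frequencies. -/
theorem exists_eLpNorm_low_le {c : ℝ} (hc : 0 < c) {μ : ℕ} (hμ : 0 < μ) (j : ℕ) :
    ∃ C : ℝ, 0 < C ∧ ∀ s : ℝ, 0 < s →
      eLpNorm (fun ξ : ℝ => |2 * Real.pi * ξ| ^ j * Real.exp (-(c * |2 * Real.pi * ξ| ^ μ * s))) 2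
        volume ≤ ENNReal.ofReal (C * s ^ (-((2 * j + 1) / (2 * μ) : ℝ))) := by
  set q : ℝ := (2 * j + 1) / μ with hq
  have hμ' : (0 : ℝ) < μ := by exact_mod_cast hμ
  have hq0 : 0 < q := by positivity
  set A : ℝ := (2 * Real.pi)⁻¹ * (2 * ((2 * c) ^ (-q) * (1 / μ) * Real.Gamma q)) with hA
  have hΓ := Real.Gamma_pos_of_pos hq0
  have hA0 : 0 < A := by positivity
  refine ⟨√A, Real.sqrt_pos.mpr hA0, fun s hs => ?_⟩
  set F : ℝ → ℝ := fun ξ => |2 * Real.pi * ξ| ^ j * Real.exp (-(c * |2 * Real.pi * ξ| ^ μ * s))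
    with hF
  have hFc : Continuous F := by fun_prop
  have hI : ∫ ξ, F ξ ^ 2 = A * s ^ (-q) := by
    have h1 : ∀ ξ, F ξ ^ 2 = (fun y => (fun r : ℝ => r ^ (2 * j : ℝ)
        * Real.exp (-(2 * c * s) * r ^ (μ : ℝ))) |y|) (2 * Real.pi * ξ) := fun ξ => by
      simp only [hF, mul_pow, ← Real.exp_nat_mul, ← pow_mul, Real.rpow_natCast]
      rw [show (2 * j : ℝ) = ((2 * j : ℕ) : ℝ) by push_cast; ring, Real.rpow_natCast, mul_comm j 2]
      congr 2
      push_cast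
      ring
    simp_rw [h1]
    rw [Measure.integral_comp_mul_left (fun y => (fun r : ℝ => r ^ (2 * j : ℝ)
        * Real.exp (-(2 * c * s) * r ^ (μ : ℝ))) |y|),
      integral_comp_abs (f := fun r : ℝ => r ^ (2 * j : ℝ)
        * Real.exp (-(2 * c * s) * r ^ (μ : ℝ))),
      integral_rpow_mul_exp_neg_mul_rpow hμ' (by
        have : (0 : ℝ) ≤ 2 * j := by positivity
        linarith) (by positivity),
      neg_div, ← hq, Real.mul_rpow (by positivity) hs.le, abs_of_pos (by positivity), smul_eq_mul,
      hA]
    ring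
  have hint : Integrable fun ξ => F ξ ^ 2 := by
    -- A nonintegrable function has Bochner integral 0, but the value computed above is positive.
    by_contra h
    rw [integral_undef h] at hI
    have : 0 < A * s ^ (-q) := by positivity
    linarith
  have hm : MemLp F 2 volume := (memLp_two_iff_integrable_sq hFc.aestronglyMeasurable).mpr hint
  rw [hm.eLpNorm_eq_integral_rpow_norm two_ne_zero ENNReal.ofNat_ne_top]
  apply ENNReal.ofReal_le_ofReal (le_of_eq _)
  have h2 : ∀ ξ, ‖F ξ‖ ^ (2 : ℝ≥0∞).toReal = F ξ ^ 2 := fun ξ => by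
    rw [ENNReal.toReal_ofNat, Real.rpow_ofNat, Real.norm_eq_abs, sq_abs]
  simp_rw [h2]
  rw [hI, ENNReal.toReal_ofNat, Real.mul_rpow hA0.le (by positivity), ← Real.rpow_mul hs.le,
    Real.sqrt_eq_rpow, hq]
  congr 2
  · norm_num
  · field_simp

end FrequencyIntegrals

/-! ### Synthesis of the frequency regimes and decay of solutions. -/

section Decay

open FourierTransform

/-- Loss of regularity: the weak exponential is traded for the power -ℓ/ν of time at the cost of
r^ℓ, because s^(ℓ/ν) exp(-c s) is bounded and s = r^(-ν)(1 + t). Replacing t by 1 + t costs exp c.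
-/
theorem exists_high_frequency_bound {c : ℝ} (hc : 0 < c) {ν ℓ : ℕ} (hν : 0 < ν) (hℓ : 0 < ℓ) :
    ∃ D : ℝ, 0 < D ∧ ∀ r t : ℝ, 1 ≤ r → 0 ≤ t →
      Real.exp (-(c * (r ^ ν)⁻¹ * t)) ≤ D * (1 + t) ^ (-((ℓ : ℝ) / ν)) * r ^ ℓ := by
  have hν' : (0 : ℝ) < ν := by exact_mod_cast hν
  have ha : 0 < (ℓ : ℝ) / ν := by positivity
  obtain ⟨C, hC, h⟩ := exists_rpow_mul_exp_neg_le ha hc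
  refine ⟨Real.exp c * C, by positivity, fun r t hr ht => ?_⟩
  have hr0 : 0 < r := by linarith
  set w := (r ^ ν)⁻¹ with hw
  have hw0 : 0 < w := by positivity
  have hw1 : w ≤ 1 := inv_le_one_of_one_le₀ (one_le_pow₀ hr)
  have hwr : w ^ ((ℓ : ℝ) / ν) = (r ^ ℓ)⁻¹ := by
    rw [hw, Real.inv_rpow (by positivity), ← Real.rpow_natCast r ν, ← Real.rpow_mul hr0.le,
      mul_div_cancel₀ _ hν'.ne', Real.rpow_natCast]
  have h1 := h (w * (1 + t)) (by positivity)
  rw [Real.mul_rpow hw0.le (by positivity), hwr] at h1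
  have h2 : Real.exp (-(c * w * t)) ≤ Real.exp c * Real.exp (-(c * (w * (1 + t)))) := by
    rw [← Real.exp_add]
    apply Real.exp_le_exp.mpr
    nlinarith [mul_le_mul_of_nonneg_left hw1 hc.le]
  have hT : 0 < (1 + t) ^ ((ℓ : ℝ) / ν) := by positivity
  have h3 : Real.exp (-(c * (w * (1 + t)))) ≤ C * (1 + t) ^ (-((ℓ : ℝ) / ν)) * r ^ ℓ := by
    rw [Real.rpow_neg (by positivity)]
    have : Real.exp (-(c * (w * (1 + t)))) = ((r ^ ℓ)⁻¹ * (1 + t) ^ ((ℓ : ℝ) / ν)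
        * Real.exp (-(c * (w * (1 + t))))) * (((1 + t) ^ ((ℓ : ℝ) / ν))⁻¹ * r ^ ℓ) := by
      field_simp
    rw [this, mul_assoc C]
    gcongr
  calc _ ≤ Real.exp c * Real.exp (-(c * (w * (1 + t)))) := h2
    _ ≤ Real.exp c * (C * (1 + t) ^ (-((ℓ : ℝ) / ν)) * r ^ ℓ) := by gcongr
    _ = _ := by ring

variable {p : BeamCoeffs} {ε₀ : ℝ}

/-- Decay of the norm of solutions from decay of the Fourier symbol. -/
theorem SymbolDecay.beamDecay {μ ν : ℕ} (h : SymbolDecay p ε₀ μ ν) (hμ : 0 < μ) (hν : 0 < ν)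
    (N j : ℕ) {ℓ : ℕ} (hℓ : 0 < ℓ) :
    BeamDecay p ε₀ N ℓ j ((2 * j + 1) / (2 * μ)) ((ℓ : ℝ) / ν) := by
  obtain ⟨K, c, hK, hc, hexp⟩ := norm_exp_beamSymbol_sq_le h
  obtain ⟨C, hC, hlow⟩ := exists_eLpNorm_low_le (half_pos hc) hμ j
  obtain ⟨D, hD, hhigh⟩ := exists_high_frequency_bound (half_pos hc) hν hℓ
  refine ⟨√K * (Real.exp (c / 2) * C + D), by positivity, fun U₀ U _ hU₁ hU t ht => ?_⟩
  have ht1 : 0 < 1 + t := by linarith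
  set L : ℝ := ∫ x, ‖U₀ x‖ with hL
  have hL0 : 0 ≤ L := integral_nonneg fun x => norm_nonneg _
  have hLe : eLpNorm (fun x : ℝ => U₀ x) 1 volume = ENNReal.ofReal L := by
    rw [eLpNorm_one_eq_lintegral_enorm, hL,
      ofReal_integral_norm_eq_lintegral_enorm (memLp_one_iff_integrable.mp hU₁)]
  -- With 1 + t instead of t the profile is square integrable also at t = 0. At low frequencies this
  -- costs only the factor exp(c / 2); c is halved because the symbol estimate is for squared norms.
  set F : ℝ → ℝ := fun ξ =>
    |2 * Real.pi * ξ| ^ j * Real.exp (-(c / 2 * |2 * Real.pi * ξ| ^ μ * (1 + t))) with hF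
  set G : ℝ → BeamState := fun ξ => (2 * Real.pi * Complex.I * ξ : ℂ) ^ (j + ℓ) • 𝓕 U₀ ξ with hG
  have hGm : AEStronglyMeasurable G volume := by
    have : Continuous fun ξ : ℝ => (2 * Real.pi * Complex.I * ξ : ℂ) ^ (j + ℓ) := by fun_prop
    exact this.aestronglyMeasurable.smul (Lp.aestronglyMeasurable _)
  have hFm : Continuous F := by fun_prop
  set a₁ : ℝ := √K * Real.exp (c / 2) * L with ha₁
  set a₂ : ℝ := √K * (D * (1 + t) ^ (-((ℓ : ℝ) / ν))) with ha₂
  have ha₁0 : 0 ≤ a₁ := by positivity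
  have ha₂0 : 0 ≤ a₂ := by positivity
  have hx : ∀ (n : ℕ) (ξ : ℝ), ‖(2 * Real.pi * Complex.I * ξ : ℂ) ^ n‖ = |2 * Real.pi * ξ| ^ n :=
    fun n ξ => by
      rw [norm_pow]
      congr 1
      simp [abs_mul, abs_of_pos Real.pi_pos]
  have hpt : ∀ᵐ ξ : ℝ, ‖(2 * Real.pi * Complex.I * ξ : ℂ) ^ j • 𝓕 (U t) ξ‖
      ≤ (a₁ • F + a₂ • fun ξ => ‖G ξ‖) ξ := by
    have hne : ∀ᵐ ξ : ℝ, ξ ≠ 0 := by simp [ae_iff]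
    filter_upwards [hU.fourier_ae_eq ht, ae_norm_fourier_le U₀ hU₁, hne] with ξ h1 h2 h3
    have e : (2 * Real.pi * Complex.I * ξ : ℂ) = Complex.I * ((2 * Real.pi * ξ : ℝ) : ℂ) := by
      push_cast
      ring
    have hx0 : 2 * Real.pi * ξ ≠ 0 := by positivity
    simp only [Pi.add_apply, Pi.smul_apply, smul_eq_mul, hF, hG, norm_smul, hx]
    rw [h1, e]
    set r := |2 * Real.pi * ξ| with hr
    have hr0 : 0 < r := abs_pos.mpr hx0
    obtain ⟨b1, b2⟩ := hexp _ hx0 (𝓕 U₀ ξ) t ht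
    set Y := ‖NormedSpace.exp ((t : ℂ) • beamSymbol p ε₀
      (Complex.I * ((2 * Real.pi * ξ : ℝ) : ℂ))) (𝓕 U₀ ξ)‖
    have hsq : ∀ w : ℝ, Y ^ 2 ≤ K * Real.exp (-(c * w)) * ‖𝓕 U₀ ξ‖ ^ 2 →
        Y ≤ √K * Real.exp (-(c / 2 * w)) * ‖𝓕 U₀ ξ‖ := by
      intro w hw
      refine le_of_sq_le_sq ?_ (by positivity)
      have hc2 : ((2 : ℕ) : ℝ) * -(c / 2 * w) = -(c * w) := by
        push_cast
        ring
      rwa [mul_pow, mul_pow, Real.sq_sqrt hK.le, ← Real.exp_nat_mul, hc2]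
    -- Each regime is bounded by one of the two summands on the whole line, so no cutoff is needed.
    rcases le_total r 1 with hr1 | hr1
    · have b3 := hsq (r ^ μ * t) (by rw [← mul_assoc]; exact b1 hr1)
      have b4 : Real.exp (-(c / 2 * (r ^ μ * t)))
          ≤ Real.exp (c / 2) * Real.exp (-(c / 2 * r ^ μ * (1 + t))) := by
        rw [← Real.exp_add]
        apply Real.exp_le_exp.mpr
        nlinarith [mul_le_mul_of_nonneg_left (pow_le_one₀ hr0.le hr1 : r ^ μ ≤ 1) hc.le]
      calc r ^ j * Y ≤ r ^ j * (√K * (Real.exp (c / 2) * Real.exp (-(c / 2 * r ^ μ * (1 + t))))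
            * L) := by
            refine mul_le_mul_of_nonneg_left (b3.trans ?_) (by positivity)
            gcongr
        _ = a₁ * (r ^ j * Real.exp (-(c / 2 * r ^ μ * (1 + t)))) := by
            rw [ha₁]
            ring
        _ ≤ _ := le_add_of_nonneg_right (by positivity)
    · have b3 := hsq ((r ^ ν)⁻¹ * t) (by rw [← mul_assoc]; exact b2 hr1)
      have b4 := hhigh r t hr1 ht
      rw [mul_assoc] at b4
      calc r ^ j * Y ≤ r ^ j * (√K * (D * (1 + t) ^ (-((ℓ : ℝ) / ν)) * r ^ ℓ)
            * ‖𝓕 U₀ ξ‖) := by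
            refine mul_le_mul_of_nonneg_left (b3.trans ?_) (by positivity)
            gcongr
        _ = a₂ * (r ^ (j + ℓ) * ‖𝓕 U₀ ξ‖) := by
            rw [ha₂, pow_add]
            ring
        _ ≤ _ := le_add_of_nonneg_left (by positivity)
  rw [distL2Norm_distDeriv_iterate, distL2Norm_distDeriv_iterate]
  refine (eLpNorm_mono_ae_real hpt).trans ((eLpNorm_add_le
    (hFm.aestronglyMeasurable.const_smul _) (hGm.norm.const_smul _) one_le_two).trans ?_)
  rw [eLpNorm_const_smul, eLpNorm_const_smul, eLpNorm_norm, Real.enorm_of_nonneg ha₁0,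
    Real.enorm_of_nonneg ha₂0]
  gcongr ?_ + ?_
  · calc ENNReal.ofReal a₁ * eLpNorm F 2 volume
        ≤ ENNReal.ofReal a₁ * ENNReal.ofReal (C * (1 + t) ^ (-((2 * j + 1) / (2 * μ) : ℝ))) := by
          gcongr
          exact hlow _ ht1
      _ = ENNReal.ofReal (√K * (Real.exp (c / 2) * C) * (1 + t) ^ (-((2 * j + 1) / (2 * μ) : ℝ)))
          * ENNReal.ofReal L := by
          rw [← ENNReal.ofReal_mul ha₁0, ← ENNReal.ofReal_mul (by positivity)]
          congr 1
          rw [ha₁]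
          ring
      _ ≤ _ := by
          rw [hLe]
          gcongr
          linarith
  · gcongr
    rw [ha₂, ← mul_assoc]
    gcongr
    have : 0 < Real.exp (c / 2) * C := by positivity
    linarith

end Decay

theorem mainTheorem5 (p : BeamCoeffs)
    (hk₁ : 0 < p.k₁) (hk₂ : 0 < p.k₂) (hk₃ : 0 < p.k₃) (hk₄ : 0 < p.k₄) (hk₅ : 0 < p.k₅)
    (hγ : p.γ ≠ 0)
    (N ℓ j : ℕ) (hℓ : 1 ≤ ℓ) (hN : ℓ ≤ N) (hj : j ≤ N - ℓ) :
    ((p.τ₁, p.τ₂, p.τ₃) = ((1, 0, 0) : ℝ × ℝ × ℝ) → p.χ ≠ 0 →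
      BeamDecay p 1 N ℓ j (1 / 12 + (j : ℝ) / 6) ((ℓ : ℝ) / 4) ∧
      BeamDecay p 0 N ℓ j (1 / 8 + (j : ℝ) / 4) ((ℓ : ℝ) / 4)) ∧
    ((p.τ₁, p.τ₂, p.τ₃) ∈ ({(0, 1, 0), (0, 0, 1)} : Set (ℝ × ℝ × ℝ)) →
      (p.k₁ = p.k₂ ∧ p.k₂ = p.k₃) →
      BeamDecay p 1 N ℓ j (1 / 8 + (j : ℝ) / 4) ((ℓ : ℝ) / 2) ∧
      BeamDecay p 0 N ℓ j (1 / 4 + (j : ℝ) / 2) ((ℓ : ℝ) / 2)) ∧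
    ((p.τ₁, p.τ₂, p.τ₃) ∈ ({(0, 1, 0), (0, 0, 1)} : Set (ℝ × ℝ × ℝ)) →
      ¬ (p.k₁ = p.k₂ ∧ p.k₂ = p.k₃) →
      BeamDecay p 1 N ℓ j (1 / 8 + (j : ℝ) / 4) ((ℓ : ℝ) / 6) ∧
      BeamDecay p 0 N ℓ j (1 / 4 + (j : ℝ) / 2) ((ℓ : ℝ) / 6)) := by
  have hℓ0 : 0 < ℓ := hℓ
  -- The exponents are (2j + 1)/(2μ) and ℓ/ν. For displacement coupling μ is 6 or 4 and ν = 4; for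
  -- angle coupling μ is 4 or 2, with ν = 2 for equal coefficients and ν = 6 otherwise. The first
  -- value of μ is for ε₀ = 1.
  refine ⟨fun hτ hχ => ?_, fun hτ heq => ?_, fun hτ _ => ?_⟩
  · simp only [Prod.mk.injEq] at hτ
    have h1 := symbolDecay_displacement hk₁ hk₂ hk₃ hk₄ hk₅ hγ hχ hτ.1 hτ.2.1 hτ.2.2
      (ε₀ := 1) (.inl rfl)
    have h0 := symbolDecay_displacement hk₁ hk₂ hk₃ hk₄ hk₅ hγ hχ hτ.1 hτ.2.1 hτ.2.2
      (ε₀ := 0) (.inr rfl)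
    rw [if_pos rfl] at h1
    rw [if_neg zero_ne_one] at h0
    refine ⟨?_, ?_⟩
    · convert h1.beamDecay (by norm_num) (by norm_num) N j hℓ0 using 1 <;> push_cast <;> ring
    · convert h0.beamDecay (by norm_num) (by norm_num) N j hℓ0 using 1 <;> push_cast <;> ring
  · have h1 := (symbolDecay_angle hk₁ hk₂ hk₃ hk₄ hk₅ hγ hτ (ε₀ := 1) (.inl rfl)).2 heq
    have h0 := (symbolDecay_angle hk₁ hk₂ hk₃ hk₄ hk₅ hγ hτ (ε₀ := 0) (.inr rfl)).2 heq
    rw [if_pos rfl] at h1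
    rw [if_neg zero_ne_one] at h0
    refine ⟨?_, ?_⟩
    · convert h1.beamDecay (by norm_num) (by norm_num) N j hℓ0 using 1 <;> push_cast <;> ring
    · convert h0.beamDecay (by norm_num) (by norm_num) N j hℓ0 using 1 <;> push_cast <;> ring
  · have h1 := (symbolDecay_angle hk₁ hk₂ hk₃ hk₄ hk₅ hγ hτ (ε₀ := 1) (.inl rfl)).1
    have h0 := (symbolDecay_angle hk₁ hk₂ hk₃ hk₄ hk₅ hγ hτ (ε₀ := 0) (.inr rfl)).1
    rw [if_pos rfl] at h1
    rw [if_neg zero_ne_one] at h0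
    refine ⟨?_, ?_⟩
    · convert h1.beamDecay (by norm_num) (by norm_num) N j hℓ0 using 1 <;> push_cast <;> ring
    · convert h0.beamDecay (by norm_num) (by norm_num) N j hℓ0 using 1 <;> push_cast <;> ring
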